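/- Let $k$ be a non-archimedean local field of characteristic $0$ (for example the completion of a number field at a finite place), with ring of integers $\mathfrak o$, uniformizer $\varpi$, residue field of $q$ elements, and $|\varpi|=q^{-1}$. Let $n\ge 0$, let $B$ be a nondegenerate quadratic form on $k^n$, and equip $k^{n+3}=(k\cdot x')\oplus k^n\oplus(k\cdot x)\oplus(k\cdot e_-)$ with the symmetric form that is $B$ on $k^n$, for which $x',x$ is a hyperbolic pair ($\langle x,x\rangle=\langle x',x'\rangle=0$, $\langle x',x\rangle=1$) and $\langle e_-,e_-\rangle=-1$, the decomposition being otherwise orthogonal. Put $e_+=x'+\tfrac12x$ and $e=e_++e_-$. Let $G=\mathrm O(n+3)$ be the isometry group, acting on the right on row vectors, $H=\mathrm O(n+2)$ the fixer of $e_-$, $\varTheta=\mathrm O(n+1)$ the fixer of $e_+$ and $e_-$, $Q\subset H$ the stabilizer of the line $k\cdot x$, and $K^H\subset H$ the stabilizer of the integral vectors. Fix a nonzero right $H$-invariant Radon measure on $\varTheta\backslash H$, the Haar measure $dt$ on $k^\times$ giving $\mathfrak o^\times$ volume $1$, and the Haar measure on $k^n$ giving $\mathfrak o^n$ volume $1$.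 With $\Phi$ the characteristic function of $\mathfrak o^{n+3}$, put for $\Re\alpha>0$ $$\psi(g)=\int_{k^\times}|t|^\alpha\,\Phi(te\cdot g)\,dt,\qquad \varphi_\omega=\psi/\psi(1),\qquad Z(\alpha)=\frac1{1-q^{-\alpha}},$$ and, with $z=q^{-\beta}$, $$X_\ell(\rho)=\operatorname{meas}\Bigl\{a\in\mathfrak o^n:\tfrac{B(a)-\rho}2=0 \bmod \varpi^\ell\Bigr\},\quad X(\beta;\rho)=\sum_{\ell\ge0}z^\ell X_\ell(\rho),\quad \Pi^n(\alpha,\beta)=\int_{k^\times\cap\mathfrak o}|t|^\alpha X(\beta;t^2)\,dt .$$ For $\beta\in\mathbb C$ let $f=f_\beta$ be a left $\varTheta$-invariant function on $H$ with $f(1)=1$ that generates a degenerate unramified principal series with parameter $\beta$ with respect to $Q$: $f(hq)=|\lambda|^\beta f(h)$ for all $h\in H$ and all $q\in Q$ with $x\cdot q=x/\lambda$. Then: (1) For $\Re\alpha>0$, $\psi(1)=|2|^\alpha Z(\alpha)$; moreover $\varphi_\omega(1)=1$, and if $p\in G$ satisfies $e\cdot p=e/t$ then $\varphi_\omega(pg)=|t|^\alpha\varphi_\omega(g)$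 for all $g\in G$. (2) If $\Re\beta>-1$, then $\int_{\varTheta\backslash H}\varphi_\omega\cdot f$ converges absolutely for all $\alpha$ with $\Re\alpha$ sufficiently large (depending on $\beta$). (3) There is a constant $C>0$, independent of $\alpha$, $\beta$ and $f$, such that whenever $\Re\alpha>0$ and the integral $\int_{\varTheta\backslash H}\varphi_\omega\cdot f$ converges absolutely, the series and integral defining $\Pi^n(\alpha-\beta-n,\beta)$ converge absolutely and $$\int_{\varTheta\backslash H}\varphi_\omega\cdot f=\frac1{\psi(1)}\int_{\varTheta\backslash H}\psi\cdot f=C\cdot\frac{\Pi^n(\alpha-\beta-n,\beta)}{|2|^\alpha\,Z(\alpha)} .$$ (4) For $\Re\beta>-1$ put $m_\beta(h)=\int_{K^H}f_\beta(hk)\,dk$ (with $K^H$ of volume $1$). For each $h\in H$ the function $\beta\mapsto m_\beta(h)$, and for each $t\in k^\times$ the function $\beta\mapsto X(\beta;t^2)$, continue meromorphically to $\beta\in\mathbb C$. For every $\beta\in\mathbb C$ with $q^{-\beta-1}\ne1$ and $m_\beta(1)\ne0$, the spherical vector $f^\circ=m_\beta/m_\beta(1)$ satisfies, for $\Re\alpha$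 sufficiently large (depending on $\beta$) and with all integrals absolutely convergent, $$\int_{\varTheta\backslash H}\varphi_\omega\cdot f^\circ=\frac1{\psi(1)}\int_{\varTheta\backslash H}\psi\cdot f^\circ=\frac{C}{m_\beta(1)}\cdot\frac{\Pi^n(\alpha-\beta-n,\beta)}{|2|^\alpha\,Z(\alpha)},$$ where $\Pi^n$ is formed with the continued $X$ and $C$ is the constant of (3). -/

import Mathlib

open MeasureTheory Matrix

noncomputable section

namespace LocalPeriod

/-! ### The local field -/

section Field

variable (F : Type*) [NontriviallyNormedField F] [IsUltrametricDist F]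

attribute [local instance] NormedField.toValued

/-- The cardinality `q` of the residue field. -/
def residueCard : ℕ := Nat.card (IsLocalRing.ResidueField (Valued.integer F))

/-- The absolute value is the normalized one: a uniformizer has absolute value `1 / q`. -/
def IsNormalizedNorm : Prop :=
  ∀ ϖ : Valued.integer F, Irreducible ϖ → ‖(ϖ : F)‖ = (residueCard F : ℝ)⁻¹

end Field

section Measures

variable {F : Type*} [NontriviallyNormedField F] [MeasurableSpace F] [BorelSpace F]

instance instBorelSpaceUnits : BorelSpace Fˣ :=
  ⟨by
    have h : (inferInstance : TopologicalSpace Fˣ)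
        = TopologicalSpace.induced Units.val inferInstance := Units.isEmbedding_val₀.eq_induced
    change MeasurableSpace.comap Units.val _ = @borel Fˣ inferInstance
    rw [h, BorelSpace.measurable_eq (α := F), borel_comap]⟩

variable (F) in
/-- The invariant measure on `Fˣ` for which the units of the ring of integers have volume `1`. -/
def mulMeasure [ProperSpace F] : Measure Fˣ :=
  (Measure.haar {u : Fˣ | ‖(u : F)‖ = 1})⁻¹ • Measure.haar

/-- The integral vectors of a coordinate space `F ^ ι`. -/
def IntegralVec {ι : Type*} (v : ι → F) : Prop := ∀ i, ‖v i‖ ≤ 1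

/-- The measure of a subset of `F ^ n`, normalized so that the set of integral vectors has
measure `1`. -/
def meas [ProperSpace F] {n : ℕ} (S : Set (Fin n → F)) : ℝ :=
  (Measure.addHaar S / Measure.addHaar {a : Fin n → F | IntegralVec a}).toReal

/-- `|t| ^ α` -/
def absPow (t : F) (α : ℂ) : ℂ := ((‖t‖ : ℝ) : ℂ) ^ α

end Measures

/-! ### Meromorphic continuation -/

/-- `g'` is the meromorphic continuation to the complex plane of the function `g`, which is given on
the half plane `Re β > -1`.  (Normal form: away from its poles `g'` is analytic.) -/
def IsContinuation (g g' : ℂ → ℂ) : Prop :=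
  MeromorphicNFOn g' Set.univ ∧ ∀ β : ℂ, -1 < β.re → g' β = g β

/-! ### The functions `Z`, `X` and `Π` -/

section Functions

variable {F : Type*} [NontriviallyNormedField F] [IsUltrametricDist F] [ProperSpace F]
  [MeasurableSpace F] [BorelSpace F] {n : ℕ}

variable (F) in
/-- `Z(α) = 1 / (1 - q ^ (-α))` -/
def zetaFactor (α : ℂ) : ℂ := (1 - (residueCard F : ℂ) ^ (-α))⁻¹

/-- `X_ℓ(ρ)`, the measure of the set of integral `a` with `(B(a) - ρ) / 2 = 0 mod ϖ ^ ℓ`. -/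
def XCoeff (B : Matrix (Fin n) (Fin n) F) (l : ℕ) (ρ : F) : ℝ :=
  meas {a : Fin n → F | IntegralVec a ∧
    ‖(a ⬝ᵥ B *ᵥ a - ρ) / 2‖ ≤ ((residueCard F : ℝ)⁻¹) ^ l}

/-- `X(β; ρ) = ∑ z ^ ℓ X_ℓ(ρ)` with `z = q ^ (-β)` -/
def XSeries (B : Matrix (Fin n) (Fin n) F) (β : ℂ) (ρ : F) : ℂ :=
  ∑' l : ℕ, ((residueCard F : ℂ) ^ (-β)) ^ l * (XCoeff B l ρ : ℂ)

/-- The integrand `|t| ^ α X(t ^ 2)` of `Π`. -/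
def PiIntegrand (X : F → ℂ) (α : ℂ) (t : Fˣ) : ℂ := absPow (t : F) α * X ((t : F) ^ 2)

variable (F) in
/-- The nonzero integral elements of `F`. -/
def integralUnits : Set Fˣ := {t : Fˣ | ‖(t : F)‖ ≤ 1}

/-- The integral of `|t| ^ α X(t ^ 2)` over the nonzero integral `t`. -/
def PiOf (X : F → ℂ) (α : ℂ) : ℂ := ∫ t in integralUnits F, PiIntegrand X α t ∂(mulMeasure F)

/-- `Π(α, β)` -/
def PiIntegral (B : Matrix (Fin n) (Fin n) F) (α β : ℂ) : ℂ := PiOf (XSeries B β) α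

/-- The series and the integral that define `Π(α, β)` converge absolutely. -/
def PiConverges (B : Matrix (Fin n) (Fin n) F) (α β : ℂ) : Prop :=
  (∀ t ∈ integralUnits F, Summable fun l : ℕ =>
    ((residueCard F : ℂ) ^ (-β)) ^ l * (XCoeff B l ((t : F) ^ 2) : ℂ)) ∧
  IntegrableOn (PiIntegrand (XSeries B β) α) (integralUnits F) (mulMeasure F)

end Functions

/-! ### The quadratic space and its groups

The coordinates on `F ^ (n + 3)` are those of `F ^ n` (left summand), and then those of
`x'`, `x` and `e₋` (right summand, in this order).  Matrices act on row vectors from the right. -/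

section Groups

variable {F : Type*} [NontriviallyNormedField F] {n : ℕ}

/-- The index set of the coordinates. -/
abbrev Idx (n : ℕ) : Type := Fin n ⊕ Fin 3

/-- The Gram matrix: `B` on `F ^ n`, a hyperbolic pair `x'`, `x`, and `⟨e₋, e₋⟩ = -1`. -/
def gram (B : Matrix (Fin n) (Fin n) F) : Matrix (Idx n) (Idx n) F :=
  Matrix.fromBlocks B 0 0 !![0, 1, 0; 1, 0, 0; 0, 0, -1]

variable (F n) in
/-- The isotropic vector `x`. -/
def xVec : Idx n → F := Sum.elim 0 ![0, 1, 0]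

variable (F n) in
/-- `e₊ = x' + x / 2` -/
def ePlus : Idx n → F := Sum.elim 0 ![1, 1 / 2, 0]

variable (F n) in
/-- `e₋` -/
def eMinus : Idx n → F := Sum.elim 0 ![0, 0, 1]

variable (F n) in
/-- `e = e₊ + e₋` -/
def eVec : Idx n → F := ePlus F n + eMinus F n

/-- The isometry group `G = O(n + 3)`. -/
def groupG (B : Matrix (Fin n) (Fin n) F) : Subgroup (GL (Idx n) F) where
  carrier := {g | (g : Matrix (Idx n) (Idx n) F) * gram B * (g : Matrix (Idx n) (Idx n) F)ᵀ
    = gram B}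
  one_mem' := by simp
  mul_mem' := by
    intro a b ha hb
    simp only [Set.mem_ofPred_eq, Units.val_mul, Matrix.transpose_mul] at *
    calc (a : Matrix (Idx n) (Idx n) F) * b * gram B * ((b : Matrix (Idx n) (Idx n) F)ᵀ * (a : Matrix (Idx n) (Idx n) F)ᵀ)
        = a * (b * gram B * (b : Matrix (Idx n) (Idx n) F)ᵀ) * (a : Matrix (Idx n) (Idx n) F)ᵀ := by
          simp only [Matrix.mul_assoc]
      _ = gram B := by rw [hb, ha]
  inv_mem' := by
    intro a ha
    simp only [Set.mem_ofPred_eq] at *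
    have h1 : ((a⁻¹ : GL (Idx n) F) : Matrix (Idx n) (Idx n) F) * a = 1 := a.inv_mul
    have h2 : (a : Matrix (Idx n) (Idx n) F)ᵀ * ((a⁻¹ : GL (Idx n) F) : Matrix (Idx n) (Idx n) F)ᵀ
        = 1 := by rw [← Matrix.transpose_mul, h1, Matrix.transpose_one]
    conv_lhs => rw [← ha]
    rw [Matrix.mul_assoc, Matrix.mul_assoc, Matrix.mul_assoc, h2, Matrix.mul_one,
      ← Matrix.mul_assoc, h1, Matrix.one_mul]

/-- The invertible matrices that fix the row vector `v`. -/
def fixer (v : Idx n → F) : Subgroup (GL (Idx n) F) where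
  carrier := {g | v ᵥ* (g : Matrix (Idx n) (Idx n) F) = v}
  one_mem' := by simp
  mul_mem' := by
    intro a b ha hb
    simp only [Set.mem_ofPred_eq, Units.val_mul] at *
    rw [← Matrix.vecMul_vecMul, ha, hb]
  inv_mem' := by
    intro a ha
    simp only [Set.mem_ofPred_eq] at *
    conv_lhs => rw [← ha]
    rw [Matrix.vecMul_vecMul, ← Units.val_mul, mul_inv_cancel, Units.val_one, Matrix.vecMul_one]

/-- `H = O(n + 2)`, the fixer of `e₋` in `G`. -/
def groupH (B : Matrix (Fin n) (Fin n) F) : Subgroup (GL (Idx n) F) :=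
  groupG B ⊓ fixer (eMinus F n)

/-- `Θ = O(n + 1)`, the fixer of `e₊` and `e₋` in `G`, as a subgroup of `H`. -/
def groupTheta (B : Matrix (Fin n) (Fin n) F) : Subgroup (groupH B) :=
  (fixer (ePlus F n)).subgroupOf (groupH B)

/-- The stabilizer of the lattice of integral vectors. -/
def latticeStabilizer (F : Type*) [NontriviallyNormedField F] (n : ℕ) :
    Subgroup (GL (Idx n) F) where
  carrier := {g | ∀ v : Idx n → F,
    IntegralVec (v ᵥ* (g : Matrix (Idx n) (Idx n) F)) ↔ IntegralVec v}
  one_mem' := by simp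
  mul_mem' := by
    intro a b ha hb v
    rw [Units.val_mul, ← Matrix.vecMul_vecMul]
    exact (hb _).trans (ha v)
  inv_mem' := by
    intro a ha v
    rw [← ha (v ᵥ* _), Matrix.vecMul_vecMul, ← Units.val_mul, inv_mul_cancel, Units.val_one,
      Matrix.vecMul_one]

/-- `K^H`, the stabilizer in `H` of the integral vectors.  (An element of `H` fixes `e₋` and
preserves its orthogonal complement `F ^ (n + 2)`, so stabilizing the integral vectors of
`F ^ (n + 3)` or those of `F ^ (n + 2)` is the same.) -/
def groupK (B : Matrix (Fin n) (Fin n) F) : Subgroup (groupH B) :=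
  (latticeStabilizer F n).subgroupOf (groupH B)

instance : MeasurableSpace (GL (Idx n) F) := borel _

instance : BorelSpace (GL (Idx n) F) := ⟨rfl⟩

/-- The space `Θ \ H` of cosets `Θ h`. -/
def ThetaQuot (B : Matrix (Fin n) (Fin n) F) : Type _ :=
  Quotient (QuotientGroup.rightRel (groupTheta B))

variable {B : Matrix (Fin n) (Fin n) F}

/-- The quotient topology. -/
instance : TopologicalSpace (ThetaQuot B) :=
  inferInstanceAs (TopologicalSpace (Quotient (QuotientGroup.rightRel (groupTheta B))))

instance : MeasurableSpace (ThetaQuot B) := borel _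

instance : BorelSpace (ThetaQuot B) := ⟨rfl⟩

/-- The coset `Θ h`. -/
def ThetaQuot.mk (h : groupH B) : ThetaQuot B :=
  Quotient.mk (QuotientGroup.rightRel (groupTheta B)) h

/-- The right action of `H` on `Θ \ H`: it sends `(Θ h', h)` to `Θ h' h`. -/
def ThetaQuot.act (y : ThetaQuot B) (h : groupH B) : ThetaQuot B :=
  Quotient.map' (s₁ := QuotientGroup.rightRel (groupTheta B))
    (s₂ := QuotientGroup.rightRel (groupTheta B)) (fun h' => h' * h)
    (by
      intro a b hab
      rw [QuotientGroup.rightRel_apply] at hab ⊢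
      simpa [mul_assoc] using hab) y

end Groups

/-! ### The functions `ψ` and `φ_ω`, and the vector `f` -/

section Vectors

variable {F : Type*} [NontriviallyNormedField F] [ProperSpace F] [MeasurableSpace F]
  [BorelSpace F] {n : ℕ}

/-- `ψ(g)`, the integral over `t ∈ Fˣ` of `|t| ^ α Φ(t e g)`, where `Φ` is the characteristic
function of the integral vectors. -/
def psi (α : ℂ) (g : GL (Idx n) F) : ℂ :=
  ∫ t : Fˣ, absPow (t : F) α *
    Set.indicator {v : Idx n → F | IntegralVec v} 1
      (((t : F) • eVec F n) ᵥ* (g : Matrix (Idx n) (Idx n) F))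
    ∂(mulMeasure F)

/-- `φ_ω = ψ / ψ(1)` -/
def phi (α : ℂ) (g : GL (Idx n) F) : ℂ := psi α g / psi α (1 : GL (Idx n) F)

variable {B : Matrix (Fin n) (Fin n) F}

theorem psi_theta (α : ℂ) (a b : groupH B)
    (hab : (QuotientGroup.rightRel (groupTheta B)) a b) :
    psi α (a : GL (Idx n) F) = psi α (b : GL (Idx n) F) := by
  rw [QuotientGroup.rightRel_apply] at hab
  have h1 : ePlus F n ᵥ* (((b * a⁻¹ : groupH B) : GL (Idx n) F) : Matrix (Idx n) (Idx n) F)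
      = ePlus F n := hab
  have h2 : eMinus F n ᵥ* (((b * a⁻¹ : groupH B) : GL (Idx n) F) : Matrix (Idx n) (Idx n) F)
      = eMinus F n := (b * a⁻¹ : groupH B).2.2
  have h3 : eVec F n ᵥ* (((b * a⁻¹ : groupH B) : GL (Idx n) F) : Matrix (Idx n) (Idx n) F)
      = eVec F n := by
    rw [eVec, Matrix.add_vecMul, h1, h2]
  have h4 : eVec F n ᵥ* ((b : GL (Idx n) F) : Matrix (Idx n) (Idx n) F)
      = eVec F n ᵥ* ((a : GL (Idx n) F) : Matrix (Idx n) (Idx n) F) := by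
    conv_rhs => rw [← h3]
    rw [Matrix.vecMul_vecMul, ← Units.val_mul, ← Subgroup.coe_mul, inv_mul_cancel_right]
  have h5 : ∀ t : F, (t • eVec F n) ᵥ* ((b : GL (Idx n) F) : Matrix (Idx n) (Idx n) F)
      = (t • eVec F n) ᵥ* ((a : GL (Idx n) F) : Matrix (Idx n) (Idx n) F) := by
    intro t
    rw [Matrix.smul_vecMul, Matrix.smul_vecMul, h4]
  simp only [psi, h5]

/-- `ψ` as a function on `Θ \ H` -/
def psiQuot (α : ℂ) : ThetaQuot B → ℂ :=
  Quotient.lift (fun h : groupH B => psi α (h : GL (Idx n) F)) (psi_theta α)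

/-- `φ_ω` as a function on `Θ \ H` -/
def phiQuot (α : ℂ) : ThetaQuot B → ℂ :=
  Quotient.lift (fun h : groupH B => phi α (h : GL (Idx n) F))
    (fun a b hab => by simp only [phi, psi_theta α a b hab])

/-- `f` is a left `Θ`-invariant function on `H` with `f(1) = 1` on which the parabolic subgroup
`Q` of `H` stabilizing the line of `x` acts by right translation through its unramified character
with parameter `β`: if `x q = x / λ`, then `q` acts as `|λ| ^ β`.  In particular `f = |λ| ^ β`
at `n_a m_λ`. -/
structure IsGenerator (β : ℂ) (f : ThetaQuot B → ℂ) : Prop where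
  map_one : f (ThetaQuot.mk 1) = 1
  map_act : ∀ (q : groupH B) (lam : Fˣ),
    xVec F n ᵥ* ((q : GL (Idx n) F) : Matrix (Idx n) (Idx n) F) = ((lam⁻¹ : Fˣ) : F) • xVec F n →
    ∀ y : ThetaQuot B, f (y.act q) = absPow (lam : F) β * f y

/-- The average of the right translates of `f` by `K^H`. -/
def sphericalMean (κ : Measure (groupK B)) (f : ThetaQuot B → ℂ) (y : ThetaQuot B) : ℂ :=
  ∫ k, f (y.act (k : groupH B)) ∂κ

end Vectors

end LocalPeriod

end

noncomputable section

set_option linter.unusedSectionVars false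

namespace LocalPeriod

/-! ### Local fields -/

section FieldLemmas

variable {F : Type*} [NontriviallyNormedField F] [IsUltrametricDist F]

attribute [local instance] NormedField.toValued

/-! A point of `ThetaQuot B` is the vector e₊h, with coordinates (a, u, v) on the quadric B(a) + 2uv
= 1. The group Q is transitive on the part u ≠ 0, so f equals |u|^β there (`IsGenerator.apply_eq`),
and u = 0 turns out to be a null set. On the other side ψ depends only on the size of e₊h: it is the
sum over i ≥ 0 of q^(-αi) times the indicator of the ball |e₊h| ≤ q^i (`psi_eq_geomWeight`). The
integral of ψf is therefore a series in i whose terms are integrals of |u|^β over balls.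

The unipotent radical and the torus of Q determine the invariant measure: on every shell |u| =
q^(-l) the coordinate a is distributed by one and the same multiple of Haar measure
(`measure_shell`). If |t| = q^(-i), the substitution a → ta turns the bounds that define ball i into
integrality of ta and a congruence between B(ta) and t². Hence the part of that ball with |u| =
q^(-l) has volume C q^(ni) X_{l+i}(t²) (`ballMass_eq`). Summation over l produces X(β; t²), and
summation over i produces Π(α-β-n, β).

Convergence and continuation rest on one equidistribution statement (`measure_translate_le`,
`exists_stable`). For y in the ball of radius q^N, the mass of the k in K^H with |u(yk)| = q^(-l) is
divided by exactly q when l grows by one, as soon as l ≥ 3N + c0. Indeed the quadric equation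
prevents u and aB from being small together, so small opposite unipotent elements of K^H can shift u
by any prescribed small amount. It follows that u = 0 is null and that the generating function of
these masses is rational in z = q^(-β), with z = q as its only possible pole on z ≠ 0 (`stableSum`)
and with exponential bounds in N (`IsStable.norm_stableSum_le`).

The spherical mean at y is this generating function. The coefficients of X(β; t²) are, up to scaling
and a shift, averages of the same masses over a ball, so X is rational in z too. On each ball the
relation between the two is an identity of finite sums (`setIntegral_stableSum`), so it holds for
the continued functions directly and no integral has to be continued. -/

theorem isDVR_integer [ProperSpace F] :
    IsDiscreteValuationRing (Valued.integer F) ∧ Finite (IsLocalRing.ResidueField (Valued.integer F)) := by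
  have : (Valued.v : Valuation F NNReal).RankOne :=
    inferInstanceAs (Valuation.RankOne (NormedField.valuation (K := F)))
  -- The ring of integers is a closed ball, compact by properness; its compactness gives both the
  -- discreteness of the valuation and the finiteness of the residue field.
  have hc : IsCompact (X := F) (Valued.integer F : Set F) := by
    have : (Valued.integer F : Set F) = Metric.closedBall (0 : F) 1 := by
      ext x
      simpa using! Valued.integer.mem_iff (K := F) (x := x)
    rw [this]
    exact isCompact_closedBall 0 1
  have : CompactSpace (Valued.integer F) := isCompact_iff_compactSpace.mp hc
  exact (Valued.integer.compactSpace_iff_completeSpace_and_isDiscreteValuationRing_and_finite_residueField.mp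
    this).2

theorem exists_uniformizer [ProperSpace F] (hF : IsNormalizedNorm F) :
    ∃ ϖ : Valued.integer F, Irreducible ϖ ∧ ‖(ϖ : F)‖ = (residueCard F : ℝ)⁻¹ := by
  have := (isDVR_integer (F := F)).1
  obtain ⟨ϖ, h⟩ := IsDiscreteValuationRing.exists_irreducible (Valued.integer F)
  exact ⟨ϖ, h, hF ϖ h⟩

theorem two_le_residueCard [ProperSpace F] : 2 ≤ residueCard F := by
  have := (isDVR_integer (F := F)).1
  have := (isDVR_integer (F := F)).2
  exact Finite.one_lt_card

theorem exists_norm_eq_zpow [ProperSpace F] (hF : IsNormalizedNorm F) {x : F} (hx : x ≠ 0) :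
    ∃ j : ℤ, ‖x‖ = (residueCard F : ℝ) ^ (-j) := by
  have := (isDVR_integer (F := F)).1
  obtain ⟨ϖ, hϖ, hn⟩ := exists_uniformizer hF
  have key : ∀ x : F, x ≠ 0 → ‖x‖ ≤ 1 → ∃ j : ℕ, ‖x‖ = ((residueCard F : ℝ)⁻¹) ^ j := by
    intro x hx h1
    have hx' : (⟨x, Valued.integer.mem_iff.mpr h1⟩ : Valued.integer F) ≠ 0 := by
      intro h
      exact hx (congrArg Subtype.val h)
    obtain ⟨j, u, hu⟩ := IsDiscreteValuationRing.eq_unit_mul_pow_irreducible hx' hϖ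
    refine ⟨j, ?_⟩
    have := congrArg (fun y : Valued.integer F => ‖(y : F)‖) hu
    simpa [hn] using this
  rcases le_total ‖x‖ 1 with h | h
  · obtain ⟨j, hj⟩ := key x hx h
    exact ⟨j, by rw [hj]; simp⟩
  · obtain ⟨j, hj⟩ := key x⁻¹ (inv_ne_zero hx) (by rw [norm_inv]; exact inv_le_one_of_one_le₀ h)
    refine ⟨-j, ?_⟩
    rw [norm_inv] at hj
    rw [← inv_inv ‖x‖, hj]; simp

/-- Representatives of the residue field. After scaling they cut a ball of `F` into `q` balls of the
next smaller radius, which is how both the Haar volumes and the masses of small values of `ucoord`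
are counted. -/
theorem exists_residue_system [ProperSpace F] (hF : IsNormalizedNorm F) :
    ∃ T : Finset F, T.card = residueCard F ∧ (∀ c ∈ T, ‖c‖ ≤ 1) ∧
      (∀ x : F, ‖x‖ ≤ 1 → ∃ c ∈ T, ‖x - c‖ ≤ (residueCard F : ℝ)⁻¹) ∧
      (∀ c ∈ T, ∀ d ∈ T, ‖c - d‖ ≤ (residueCard F : ℝ)⁻¹ → c = d) := by
  classical
  have := (isDVR_integer (F := F)).1
  have := (isDVR_integer (F := F)).2
  have : Fintype (IsLocalRing.ResidueField (Valued.integer F)) := Fintype.ofFinite _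
  obtain ⟨ϖ, hϖ, hn⟩ := exists_uniformizer hF
  have hs := IsLocalRing.residue_surjective (R := Valued.integer F)
  let s := Function.surjInv hs
  have hs' : ∀ r, IsLocalRing.residue _ (s r) = r := Function.surjInv_eq hs
  have hm : ∀ x y : Valued.integer F, IsLocalRing.residue _ x = IsLocalRing.residue _ y ↔
      ‖(x : F) - y‖ ≤ (residueCard F : ℝ)⁻¹ := by
    intro x y
    rw [← sub_eq_zero, ← map_sub, IsLocalRing.residue_eq_zero_iff, ← hn]
    have := Set.ext_iff.mp (Irreducible.maximalIdeal_eq_closedBall hϖ) (x - y)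
    simpa using! this
  have hinj : Function.Injective fun r => ((s r : Valued.integer F) : F) := by
    intro r r' h
    rw [← hs' r, ← hs' r', Subtype.ext h]
  refine ⟨Finset.univ.image fun r => ((s r : Valued.integer F) : F), ?_, ?_, ?_, ?_⟩
  · rw [Finset.card_image_of_injective _ hinj, Finset.card_univ, residueCard, Nat.card_eq_fintype_card]
  · intro c hc
    obtain ⟨r, -, rfl⟩ := Finset.mem_image.mp hc
    exact Valued.integer.norm_le_one (s r)
  · intro x hx
    let x' : Valued.integer F := ⟨x, Valued.integer.mem_iff.mpr hx⟩
    refine ⟨s (IsLocalRing.residue _ x'), Finset.mem_image_of_mem _ (Finset.mem_univ _), ?_⟩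
    exact (hm x' _).mp (hs' _).symm
  · intro c hc d hd h
    obtain ⟨r, -, rfl⟩ := Finset.mem_image.mp hc
    obtain ⟨r', -, rfl⟩ := Finset.mem_image.mp hd
    have := (hm (s r) (s r')).mpr h
    rw [hs', hs'] at this
    rw [this]

end FieldLemmas

/-! ### The valuation as an integer, and complex powers as integral powers of q^(-β) -/

section Ord

variable {F : Type*} [NontriviallyNormedField F] [IsUltrametricDist F]

variable (F) in
/-- The cardinality of the residue field as a real number. -/
abbrev qR : ℝ := (residueCard F : ℝ)

variable (F) in
/-- The complex parameter `z = q ^ (-β)`. -/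
def zpar (β : ℂ) : ℂ := (residueCard F : ℂ) ^ (-β)

/-- The normalized additive valuation (with a junk value at `0`). -/
def ord (x : F) : ℤ := by
  classical
  exact if h : ∃ j : ℤ, ‖x‖ = qR F ^ (-j) then h.choose else 0

variable [ProperSpace F]

theorem one_lt_qR : 1 < qR F := by
  have : 2 ≤ residueCard F := two_le_residueCard
  have : (2 : ℝ) ≤ qR F := by exact_mod_cast this
  linarith

theorem qR_pos : 0 < qR F := lt_trans one_pos one_lt_qR

theorem qR_zpow_pos (j : ℤ) : 0 < qR F ^ j := zpow_pos qR_pos j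

theorem qR_zpow_le {i j : ℤ} : qR F ^ i ≤ qR F ^ j ↔ i ≤ j := zpow_le_zpow_iff_right₀ one_lt_qR

theorem qR_zpow_lt {i j : ℤ} : qR F ^ i < qR F ^ j ↔ i < j := zpow_lt_zpow_iff_right₀ one_lt_qR

theorem norm_eq_ord (hF : IsNormalizedNorm F) {x : F} (hx : x ≠ 0) : ‖x‖ = qR F ^ (-ord x) := by
  classical
  have h := exists_norm_eq_zpow hF hx
  rw [ord, dif_pos h]
  exact h.choose_spec

theorem qR_zpow_inj {i j : ℤ} (h : qR F ^ i = qR F ^ j) : i = j :=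
  le_antisymm (qR_zpow_le.mp h.le) (qR_zpow_le.mp h.ge)

theorem ord_eq_iff (hF : IsNormalizedNorm F) {x : F} (hx : x ≠ 0) {j : ℤ} :
    ord x = j ↔ ‖x‖ = qR F ^ (-j) := by
  rw [norm_eq_ord hF hx]
  constructor
  · rintro rfl; rfl
  · intro h; have := qR_zpow_inj h; omega

theorem norm_lt_zpow_iff (hF : IsNormalizedNorm F) {x : F} {j : ℤ} :
    ‖x‖ < qR F ^ j ↔ ‖x‖ ≤ qR F ^ (j - 1) := by
  by_cases hx : x = 0
  · simp only [hx, norm_zero, qR_zpow_pos, (qR_zpow_pos _).le]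
  · rw [norm_eq_ord hF hx, qR_zpow_lt, qR_zpow_le]; omega

theorem exists_norm_eq (hF : IsNormalizedNorm F) (j : ℤ) : ∃ t : Fˣ, ‖(t : F)‖ = qR F ^ j := by
  obtain ⟨ϖ, hϖ, hn⟩ := exists_uniformizer hF
  have h0 : (ϖ : F) ≠ 0 := by
    intro h
    rw [h, norm_zero] at hn
    exact (inv_pos.mpr (qR_pos (F := F))).ne hn
  refine ⟨(Units.mk0 _ h0) ^ (-j), ?_⟩
  simp [hn]

theorem zpar_ne_zero (β : ℂ) : zpar F β ≠ 0 := by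
  have : (residueCard F : ℂ) ≠ 0 := by exact_mod_cast (qR_pos (F := F)).ne'
  simp [zpar, Complex.cpow_eq_zero_iff, this]

theorem norm_zpar (β : ℂ) : ‖zpar F β‖ = qR F ^ (-β.re) := by
  have := Complex.norm_cpow_eq_rpow_re_of_pos (qR_pos (F := F)) (-β)
  simpa [zpar] using this

/-- The base is a positive real, so its logarithm is real and the choice of branch is harmless. All
dependence on `β` passes through `zpar F β` from here on. -/
theorem qR_cpow (j : ℤ) (β : ℂ) : (((qR F ^ (-j) : ℝ)) : ℂ) ^ β = zpar F β ^ j := by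
  have hq : (residueCard F : ℂ) ≠ 0 := by exact_mod_cast (qR_pos (F := F)).ne'
  rw [zpar, ← Complex.cpow_mul_int]
  have : (((qR F ^ (-j) : ℝ)) : ℂ) = Complex.exp ((-(j : ℝ) * Real.log (qR F) : ℝ)) := by
    rw [← Complex.ofReal_exp]
    congr 1
    rw [mul_comm, Real.exp_mul, Real.exp_log qR_pos]
    rw [← Real.rpow_intCast]; simp
  rw [this, Complex.cpow_def_of_ne_zero (Complex.exp_ne_zero _), ← Complex.ofReal_exp, ← Complex.ofReal_log (Real.exp_pos _).le, Real.log_exp, Complex.cpow_def_of_ne_zero hq]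
  have : Complex.log (residueCard F : ℂ) = (Real.log (qR F) : ℂ) := by
    rw [Complex.ofReal_log qR_pos.le]; simp
  rw [this]
  congr 1
  push_cast
  ring

theorem absPow_eq (hF : IsNormalizedNorm F) {x : F} (hx : x ≠ 0) (β : ℂ) :
    absPow x β = zpar F β ^ ord x := by
  rw [absPow, norm_eq_ord hF hx, qR_cpow]

end Ord

/-! ### The bilinear form and explicit isometries -/

section Bilinear

variable {F : Type*} [NontriviallyNormedField F] {n : ℕ}

/-- The symmetric bilinear form on `F ^ (n + 3)`. -/
def bil (B : Matrix (Fin n) (Fin n) F) (v w : Idx n → F) : F := v ⬝ᵥ gram B *ᵥ w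

variable (F n) in
/-- The isotropic vector `x'`. -/
def xPrime : Idx n → F := Sum.elim 0 ![1, 0, 0]

/-- The inclusion of `F ^ n`. -/
def incl (a : Fin n → F) : Idx n → F := Sum.elim a 0

variable {B : Matrix (Fin n) (Fin n) F}

theorem bil_eq (v w : Idx n → F) :
    bil B v w = (fun i => v (.inl i)) ⬝ᵥ B *ᵥ (fun i => w (.inl i))
      + v (.inr 0) * w (.inr 1) + v (.inr 1) * w (.inr 0) - v (.inr 2) * w (.inr 2) := by
  rw [bil, gram, Matrix.fromBlocks_mulVec]
  simp [dotProduct, Fin.sum_univ_three, Function.comp_def, Matrix.mulVec]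
  ring

theorem bil_add_left (u v w : Idx n → F) : bil B (u + v) w = bil B u w + bil B v w := by
  simp [bil]

theorem bil_sub_left (u v w : Idx n → F) : bil B (u - v) w = bil B u w - bil B v w := by
  simp [bil]

theorem bil_neg_left (u w : Idx n → F) : bil B (-u) w = - bil B u w := by
  simp [bil]

theorem bil_smul_left (c : F) (v w : Idx n → F) : bil B (c • v) w = c * bil B v w := by
  simp [bil]

theorem bil_add_right (u v w : Idx n → F) : bil B w (u + v) = bil B w u + bil B w v := by
  simp [bil, Matrix.mulVec_add]

theorem bil_sub_right (u v w : Idx n → F) : bil B w (u - v) = bil B w u - bil B w v := by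
  simp [bil, Matrix.mulVec_sub]

theorem bil_neg_right (u w : Idx n → F) : bil B w (-u) = - bil B w u := by
  simp [bil, Matrix.mulVec_neg]

theorem bil_smul_right (c : F) (v w : Idx n → F) : bil B w (c • v) = c * bil B w v := by
  simp [bil, Matrix.mulVec_smul]

theorem gram_isSymm (hB : B.IsSymm) : (gram B).IsSymm := by
  rw [gram]
  refine Matrix.IsSymm.fromBlocks hB (by simp) ?_
  ext i j
  fin_cases i <;> fin_cases j <;> rfl

theorem bil_comm (hB : B.IsSymm) (v w : Idx n → F) : bil B v w = bil B w v := by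
  rw [bil, Matrix.dotProduct_mulVec, dotProduct_comm, ← Matrix.mulVec_transpose, gram_isSymm hB, bil]

theorem det_gram_ne_zero (hB : IsUnit B.det) : (gram B).det ≠ 0 := by
  rw [gram, Matrix.det_fromBlocks_zero₂₁]
  have : (!![0, 1, 0; 1, 0, 0; 0, 0, -1] : Matrix (Fin 3) (Fin 3) F).det = 1 := by
    simp [Matrix.det_fin_three]
  rw [this, mul_one]
  exact hB.ne_zero

theorem bil_vecMul (g : Matrix (Idx n) (Idx n) F) (v w : Idx n → F) :
    bil B (v ᵥ* g) (w ᵥ* g) = v ⬝ᵥ (g * gram B * gᵀ) *ᵥ w := by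
  rw [bil, ← Matrix.mulVec_transpose g w, ← Matrix.dotProduct_mulVec, Matrix.mulVec_mulVec,
    Matrix.mulVec_mulVec, Matrix.mul_assoc]

theorem eq_gram_of_isometry {g : Matrix (Idx n) (Idx n) F}
    (h : ∀ v w, bil B (v ᵥ* g) (w ᵥ* g) = bil B v w) : g * gram B * gᵀ = gram B := by
  ext i j
  have := h (Pi.single i 1) (Pi.single j 1)
  rw [bil_vecMul, bil] at this
  simpa using this

theorem bil_groupG {g : GL (Idx n) F} (hg : g ∈ groupG B) (v w : Idx n → F) :
    bil B (v ᵥ* (g : Matrix (Idx n) (Idx n) F)) (w ᵥ* (g : Matrix (Idx n) (Idx n) F))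
      = bil B v w := by
  have hg' : (g : Matrix (Idx n) (Idx n) F) * gram B * (g : Matrix (Idx n) (Idx n) F)ᵀ = gram B := hg
  rw [bil_vecMul, hg', bil]

/-- Taking determinants in `A * gram B * Aᵀ = gram B` shows that an isometry of a nondegenerate form
is invertible. Every explicit element of `H` below is produced in this way from a linear map. -/
theorem exists_ofIsometry (hB : IsUnit B.det) (T : (Idx n → F) →ₗ[F] (Idx n → F))
    (hT : ∀ v w, bil B (T v) (T w) = bil B v w) (he : T (eMinus F n) = eMinus F n) :
    ∃ g : groupH B, ∀ v, v ᵥ* ((g : GL (Idx n) F) : Matrix (Idx n) (Idx n) F) = T v := by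
  let A : Matrix (Idx n) (Idx n) F := (LinearMap.toMatrix' T)ᵀ
  have hA : ∀ v, v ᵥ* A = T v := fun v => by
    rw [Matrix.vecMul_transpose, LinearMap.toMatrix'_mulVec]
  have hG : A * gram B * Aᵀ = gram B := eq_gram_of_isometry fun v w => by rw [hA, hA, hT]
  have hdet : A.det ≠ 0 := by
    intro h0
    have := congrArg Matrix.det hG
    rw [Matrix.det_mul, Matrix.det_mul, h0, zero_mul, zero_mul] at this
    exact det_gram_ne_zero hB this.symm
  refine ⟨⟨Matrix.GeneralLinearGroup.mkOfDetNeZero A hdet, ?_, ?_⟩, hA⟩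
  · exact hG
  · exact (hA _).trans he

/-- `H`-elements act on row vectors from the right. -/
def rowAct (v : Idx n → F) (h : groupH B) : Idx n → F :=
  v ᵥ* ((h : GL (Idx n) F) : Matrix (Idx n) (Idx n) F)

theorem rowAct_one (v : Idx n → F) : rowAct v (1 : groupH B) = v := by simp [rowAct]

theorem rowAct_mul (v : Idx n → F) (g h : groupH B) :
    rowAct v (g * h) = rowAct (rowAct v g) h := by
  simp [rowAct, Matrix.vecMul_vecMul]

theorem rowAct_eMinus (h : groupH B) : rowAct (eMinus F n) h = eMinus F n := h.2.2

theorem bil_rowAct (v w : Idx n → F) (h : groupH B) :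
    bil B (rowAct v h) (rowAct w h) = bil B v w := bil_groupG h.2.1 v w

theorem rowAct_add (v w : Idx n → F) (h : groupH B) :
    rowAct (v + w) h = rowAct v h + rowAct w h := Matrix.add_vecMul _ _ _

theorem rowAct_smul (c : F) (v : Idx n → F) (h : groupH B) :
    rowAct (c • v) h = c • rowAct v h := Matrix.smul_vecMul _ _ _

theorem rowAct_apply (v : Idx n → F) (h : groupH B) (i : Idx n) :
    rowAct v h i = ∑ j, v j * ((h : GL (Idx n) F) : Matrix (Idx n) (Idx n) F) j i := rfl

theorem bil_xVec (v : Idx n → F) : bil B v (xVec F n) = v (.inr 0) := by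
  rw [bil_eq]; simp [xVec, dotProduct, Matrix.mulVec]

theorem bil_xPrime (v : Idx n → F) : bil B v (xPrime F n) = v (.inr 1) := by
  rw [bil_eq]; simp [xPrime, dotProduct, Matrix.mulVec]

theorem bil_xVec_xVec : bil B (xVec F n) (xVec F n) = 0 := by rw [bil_xVec]; simp [xVec]

theorem bil_xPrime_xPrime : bil B (xPrime F n) (xPrime F n) = 0 := by
  rw [bil_xPrime]; simp [xPrime]

theorem bil_eMinus (v : Idx n → F) : bil B v (eMinus F n) = - v (.inr 2) := by
  rw [bil_eq]; simp [eMinus, dotProduct, Matrix.mulVec]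

theorem bil_incl (v : Idx n → F) (a : Fin n → F) :
    bil B v (incl a) = (fun i => v (.inl i)) ⬝ᵥ B *ᵥ a := by
  rw [bil_eq]; simp [incl]

/-- The Eichler transformation attached to a vector `p` and a vector `b` orthogonal to it. -/
def eichler (B : Matrix (Fin n) (Fin n) F) (p b : Idx n → F) : (Idx n → F) →ₗ[F] (Idx n → F) where
  toFun v := v + bil B v p • b - bil B v b • p - (bil B b b / 2 * bil B v p) • p
  map_add' v w := by
    simp only [bil_add_left]; module
  map_smul' c v := by
    simp only [bil_smul_left, RingHom.id_apply]; module

theorem eichler_apply (p b v : Idx n → F) : eichler B p b v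
    = v + bil B v p • b - bil B v b • p - (bil B b b / 2 * bil B v p) • p := rfl

theorem bil_eichler [CharZero F] (hB : B.IsSymm) {p b : Idx n → F} (hp : bil B p p = 0) (hpb : bil B b p = 0)
    (v w : Idx n → F) : bil B (eichler B p b v) (eichler B p b w) = bil B v w := by
  have hpb' : bil B p b = 0 := by rw [bil_comm hB, hpb]
  simp only [eichler_apply, bil_add_left, bil_add_right, bil_sub_left, bil_sub_right, bil_smul_left,
    bil_smul_right, hp, hpb, hpb', bil_comm hB p w, bil_comm hB b w]
  ring

/-- The torus element that scales `x'` by `c` and `x` by `c⁻¹`. -/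
def torus (B : Matrix (Fin n) (Fin n) F) (c : F) : (Idx n → F) →ₗ[F] (Idx n → F) where
  toFun v := v + ((c - 1) * bil B v (xVec F n)) • xPrime F n
    + ((c⁻¹ - 1) * bil B v (xPrime F n)) • xVec F n
  map_add' v w := by
    simp only [bil_add_left]; module
  map_smul' c v := by
    simp only [bil_smul_left, RingHom.id_apply]; module

theorem torus_apply (c : F) (v : Idx n → F) : torus B c v
    = v + ((c - 1) * bil B v (xVec F n)) • xPrime F n
    + ((c⁻¹ - 1) * bil B v (xPrime F n)) • xVec F n := rfl

theorem bil_torus (hB : B.IsSymm) {c : F} (hc : c ≠ 0)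
    (v w : Idx n → F) : bil B (torus B c v) (torus B c w) = bil B v w := by
  have h1 : bil B (xVec F n) (xVec F n) = 0 := bil_xVec_xVec
  have h2 : bil B (xPrime F n) (xPrime F n) = 0 := bil_xPrime_xPrime
  have h3 : bil B (xPrime F n) (xVec F n) = 1 := by simp [bil_xVec, xPrime]
  have h4 : bil B (xVec F n) (xPrime F n) = 1 := by simp [bil_xPrime, xVec]
  simp only [torus_apply, bil_add_left, bil_add_right, bil_smul_left,
    bil_smul_right, h1, h2, h3, h4, bil_comm hB (xVec F n) w, bil_comm hB (xPrime F n) w]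
  field_simp
  ring

/-- The reflection in a vector `w` (not isotropic). -/
def reflect (B : Matrix (Fin n) (Fin n) F) (w : Idx n → F) : (Idx n → F) →ₗ[F] (Idx n → F) where
  toFun v := v - (2 * bil B v w / bil B w w) • w
  map_add' v w := by
    simp only [bil_add_left]; module
  map_smul' c v := by
    simp only [bil_smul_left, RingHom.id_apply]; module

theorem reflect_apply (w v : Idx n → F) :
    reflect B w v = v - (2 * bil B v w / bil B w w) • w := rfl

theorem bil_reflect (hB : B.IsSymm) {p : Idx n → F} (hp : bil B p p ≠ 0)
    (v w : Idx n → F) : bil B (reflect B p v) (reflect B p w) = bil B v w := by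
  simp only [reflect_apply, bil_sub_left, bil_sub_right, bil_smul_left,
    bil_smul_right, bil_comm hB p w]
  field_simp
  ring

/-- `-1` on the orthogonal complement of `e₋` -/
def negComplement (F : Type*) [NontriviallyNormedField F] (n : ℕ) :
    (Idx n → F) →ₗ[F] (Idx n → F) where
  toFun v := - v + (2 * v (.inr 2)) • eMinus F n
  map_add' v w := by
    simp only [Pi.add_apply]; module
  map_smul' c v := by
    simp only [Pi.smul_apply, smul_eq_mul, RingHom.id_apply]; module

theorem negComplement_apply (v : Idx n → F) :
    negComplement F n v = - v + (2 * v (.inr 2)) • eMinus F n := rfl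

theorem bil_negComplement (hB : B.IsSymm) (v w : Idx n → F) :
    bil B (negComplement F n v) (negComplement F n w) = bil B v w := by
  simp only [negComplement_apply, bil_add_left, bil_add_right, bil_neg_left, bil_neg_right, bil_smul_left,
    bil_smul_right, bil_comm hB (eMinus F n) w, bil_eMinus]
  simp [eMinus]
  ring

end Bilinear

/-! ### The homogeneous space as an orbit of vectors, and explicit elements moving its coordinates
-/

section Orbit

variable {F : Type*} [NontriviallyNormedField F] {n : ℕ} {B : Matrix (Fin n) (Fin n) F}

/-- `Θ` is the stabilizer of e₊ in `H`, so a coset is the same as the image of e₊. -/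
theorem rightRel_iff {a b : groupH B} :
    (QuotientGroup.rightRel (groupTheta B)) a b ↔
      rowAct (ePlus F n) a = rowAct (ePlus F n) b := by
  rw [QuotientGroup.rightRel_apply]
  have : (b * a⁻¹ ∈ groupTheta B) ↔ rowAct (ePlus F n) (b * a⁻¹) = ePlus F n := Iff.rfl
  rw [this, rowAct_mul]
  constructor
  · intro h
    have := congrArg (fun v => rowAct v a) h
    simpa [← rowAct_mul] using this.symm
  · intro h
    rw [← h, ← rowAct_mul, mul_inv_cancel, rowAct_one]

/-- The vector `e₊ h` attached to the coset `Θ h`. -/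
def vec : ThetaQuot B → Idx n → F :=
  Quotient.lift (fun h : groupH B => rowAct (ePlus F n) h) (fun _ _ h => rightRel_iff.mp h)

theorem vec_mk (h : groupH B) : vec (ThetaQuot.mk h) = rowAct (ePlus F n) h := rfl

theorem exists_mk (y : ThetaQuot B) : ∃ h, y = ThetaQuot.mk h := by
  obtain ⟨h, rfl⟩ := Quotient.exists_rep y
  exact ⟨h, rfl⟩

theorem vec_injective : Function.Injective (vec (B := B)) := by
  intro y y' h
  obtain ⟨g, rfl⟩ := exists_mk y
  obtain ⟨g', rfl⟩ := exists_mk y'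
  exact Quotient.sound (rightRel_iff.mpr h)

theorem act_mk (g h : groupH B) : (ThetaQuot.mk g).act h = ThetaQuot.mk (g * h) := rfl

theorem vec_act (y : ThetaQuot B) (h : groupH B) : vec (y.act h) = rowAct (vec y) h := by
  obtain ⟨g, rfl⟩ := exists_mk y
  rw [act_mk, vec_mk, vec_mk, rowAct_mul]

theorem act_act (y : ThetaQuot B) (g h : groupH B) : (y.act g).act h = y.act (g * h) :=
  vec_injective (by rw [vec_act, vec_act, vec_act, rowAct_mul])

theorem rowAct_apply_two {v : Idx n → F} (h : groupH B) (hv : v (.inr 2) = 0) :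
    rowAct v h (.inr 2) = 0 := by
  have := bil_rowAct v (eMinus F n) h
  rw [rowAct_eMinus, bil_eMinus, bil_eMinus, hv] at this
  simpa using this

theorem vec_two (y : ThetaQuot B) : vec y (.inr 2) = 0 := by
  obtain ⟨g, rfl⟩ := exists_mk y
  exact rowAct_apply_two g (by simp [ePlus])

theorem bil_vec [CharZero F] (y : ThetaQuot B) : bil B (vec y) (vec y) = 1 := by
  obtain ⟨g, rfl⟩ := exists_mk y
  rw [vec_mk, bil_rowAct, bil_eq]
  simp [ePlus, dotProduct, Matrix.mulVec]
  norm_num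

/-- The coordinates of `e₊ h` in `F ^ n`. -/
def acoord (y : ThetaQuot B) : Fin n → F := fun i => vec y (.inl i)

/-- The `x'`-coordinate of `e₊ h`. -/
def ucoord (y : ThetaQuot B) : F := vec y (.inr 0)

/-- The `x`-coordinate of `e₊ h`. -/
def vcoord (y : ThetaQuot B) : F := vec y (.inr 1)

/-- Isometries preserve ⟨e₊, e₊⟩ = 1. This quadric equation recovers v from (a, u) when u ≠ 0, and
on a bounded set it keeps a away from 0 when u is small. -/
theorem coord_eq [CharZero F] (y : ThetaQuot B) :
    acoord y ⬝ᵥ B *ᵥ acoord y + 2 * ucoord y * vcoord y = 1 := by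
  have := bil_vec y
  rw [bil_eq, vec_two] at this
  rw [← this]
  unfold acoord ucoord vcoord
  ring

theorem vec_ext {y y' : ThetaQuot B} (ha : acoord y = acoord y') (hu : ucoord y = ucoord y')
    (hv : vcoord y = vcoord y') : y = y' := by
  apply vec_injective
  ext i
  rcases i with i | i
  · exact congrFun ha i
  · fin_cases i
    · exact hu
    · exact hv
    · exact (vec_two y).trans (vec_two y').symm

/-- The Eichler transformations along x form the unipotent radical of Q. They translate a/u by `b`
and keep u. -/
theorem exists_unipotent [CharZero F] (hB : B.IsSymm) (hBdet : IsUnit B.det) (b : Fin n → F) :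
    ∃ g : groupH B, rowAct (xVec F n) g = xVec F n ∧ ∀ y : ThetaQuot B,
      acoord (y.act g) = acoord y + ucoord y • b ∧ ucoord (y.act g) = ucoord y := by
  obtain ⟨g, hg⟩ := exists_ofIsometry hBdet (eichler B (xVec F n) (incl b))
    (bil_eichler hB bil_xVec_xVec (by simp [bil_xVec, incl]))
    (by simp [eichler_apply, bil_xVec, bil_incl, eMinus, dotProduct])
  refine ⟨g, ?_, fun y => ?_⟩
  · rw [rowAct, hg]
    rw [eichler_apply, bil_xVec_xVec, bil_incl]
    simp [xVec]
  · have h : ∀ i, vec (y.act g) i = eichler B (xVec F n) (incl b) (vec y) i := fun i => by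
      rw [vec_act, rowAct, hg]
    constructor
    · ext i
      refine (h _).trans ?_
      simp only [eichler_apply, bil_xVec]
      simp [xVec, incl, acoord, ucoord]
    · simp only [ucoord, h, eichler_apply, bil_xVec]
      simp [xVec, incl]

/-- The Eichler transformations along x' lie outside Q in general and keep v. To first order in `b`
they move u by a linear form in a, which is what makes u equidistribute near 0. -/
theorem exists_opposite_unipotent [CharZero F] (hB : B.IsSymm) (hBdet : IsUnit B.det) (b : Fin n → F) :
    ∃ g : groupH B, (∀ v, rowAct v g = eichler B (xPrime F n) (incl b) v) ∧
      ∀ y : ThetaQuot B,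
      acoord (y.act g) = acoord y + vcoord y • b ∧
      ucoord (y.act g) = ucoord y - acoord y ⬝ᵥ B *ᵥ b - b ⬝ᵥ B *ᵥ b / 2 * vcoord y ∧
      vcoord (y.act g) = vcoord y := by
  obtain ⟨g, hg⟩ := exists_ofIsometry hBdet (eichler B (xPrime F n) (incl b))
    (bil_eichler hB bil_xPrime_xPrime (by simp [bil_xPrime, incl]))
    (by simp [eichler_apply, bil_xPrime, bil_incl, eMinus, dotProduct])
  refine ⟨g, hg, fun y => ?_⟩
  have h : ∀ i, vec (y.act g) i = eichler B (xPrime F n) (incl b) (vec y) i := fun i => by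
    rw [vec_act, rowAct, hg]
  refine ⟨?_, ?_, ?_⟩
  · ext i
    refine (h _).trans ?_
    simp only [eichler_apply, bil_xPrime]
    simp [xPrime, incl, acoord, vcoord]
  · simp only [ucoord, vcoord, h, eichler_apply, bil_xPrime, bil_incl]
    simp [xPrime, incl]
    rfl
  · simp only [vcoord, h, eichler_apply, bil_xPrime]
    simp [xPrime, incl]

theorem exists_torus [CharZero F] (hB : B.IsSymm) (hBdet : IsUnit B.det) (c : Fˣ) :
    ∃ g : groupH B, rowAct (xVec F n) g = ((c⁻¹ : Fˣ) : F) • xVec F n ∧ ∀ y : ThetaQuot B,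
      acoord (y.act g) = acoord y ∧ ucoord (y.act g) = c * ucoord y := by
  obtain ⟨g, hg⟩ := exists_ofIsometry hBdet (torus B (c : F)) (bil_torus hB c.ne_zero)
    (by simp [torus_apply, bil_xVec, bil_xPrime, eMinus])
  refine ⟨g, ?_, fun y => ?_⟩
  · rw [rowAct, hg, torus_apply, bil_xVec, bil_xPrime]
    ext i
    rcases i with i | i
    · simp [xVec, xPrime]
    · fin_cases i <;> simp [xVec, xPrime]
  · have h : ∀ i, vec (y.act g) i = torus B (c : F) (vec y) i := fun i => by
      rw [vec_act, rowAct, hg]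
    constructor
    · ext i
      simp only [acoord, h, torus_apply, bil_xVec, bil_xPrime]
      simp [xVec, xPrime]
    · simp only [ucoord, h, torus_apply, bil_xVec, bil_xPrime]
      simp [xVec, xPrime]
      ring

theorem acoord_base : acoord (ThetaQuot.mk (1 : groupH B)) = 0 := by
  ext i
  simp [acoord, vec_mk, rowAct_one, ePlus]

theorem ucoord_base : ucoord (ThetaQuot.mk (1 : groupH B)) = 1 := by
  simp [ucoord, vec_mk, rowAct_one, ePlus]

end Orbit

/-! ### The generator on the open orbit of Q -/

section Generator

variable {F : Type*} [NontriviallyNormedField F] {n : ℕ} {B : Matrix (Fin n) (Fin n) F}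

/-- Transitivity of Q on u ≠ 0: the base point is (a, u) = (0, 1); a unipotent element brings a to
its final value and a torus element then scales u, with the parameter λ equal to u. The values of
`f` on u = 0 stay undetermined, but that set will be null. -/
theorem IsGenerator.apply_eq [CharZero F] (hB : B.IsSymm) (hBdet : IsUnit B.det) {β : ℂ}
    {f : ThetaQuot B → ℂ} (hf : IsGenerator β f) {y : ThetaQuot B} (hy : ucoord y ≠ 0) :
    f y = absPow (ucoord y) β := by
  obtain ⟨g, hgx, hg⟩ := exists_unipotent hB hBdet (acoord y)
  obtain ⟨h, hhx, hh⟩ := exists_torus hB hBdet (Units.mk0 _ hy)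
  have hq : rowAct (xVec F n) (g * h) = (((Units.mk0 _ hy)⁻¹ : Fˣ) : F) • xVec F n := by
    rw [rowAct_mul, hgx, hhx]
  have hya : acoord ((ThetaQuot.mk (1 : groupH B)).act (g * h)) = acoord y := by
    rw [← act_act, (hh _).1, (hg _).1, acoord_base, ucoord_base]; simp
  have hyu : ucoord ((ThetaQuot.mk (1 : groupH B)).act (g * h)) = ucoord y := by
    rw [← act_act, (hh _).2, (hg _).2, ucoord_base]; simp
  have h2 : (2 : F) ≠ 0 := two_ne_zero
  have hye : (ThetaQuot.mk (1 : groupH B)).act (g * h) = y := by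
    -- Once a and u ≠ 0 agree, the quadric equation forces v to agree.
    refine vec_ext hya hyu ?_
    have e1 := coord_eq ((ThetaQuot.mk (1 : groupH B)).act (g * h))
    have e2 := coord_eq y
    rw [hya, hyu] at e1
    have e3 := e1.trans e2.symm
    have e4 := add_left_cancel e3
    exact mul_left_cancel₀ (mul_ne_zero h2 hy) e4
  have := hf.map_act (g * h) (Units.mk0 _ hy) hq (ThetaQuot.mk 1)
  rw [hye, hf.map_one, mul_one] at this
  exact this

end Generator

/-! ### Topology of the groups and of the homogeneous space -/

section Topology

variable {F : Type*} [NontriviallyNormedField F] {n : ℕ} {B : Matrix (Fin n) (Fin n) F}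

theorem continuous_coe_groupH :
    Continuous fun h : groupH B => ((h : GL (Idx n) F) : Matrix (Idx n) (Idx n) F) :=
  Units.continuous_val.comp continuous_subtype_val

theorem continuous_rowAct (v : Idx n → F) : Continuous fun h : groupH B => rowAct v h :=
  continuous_const.matrix_vecMul continuous_coe_groupH

theorem continuous_vec : Continuous (vec (B := B)) :=
  (continuous_rowAct (B := B) (ePlus F n)).quotient_lift _

theorem continuous_mk : Continuous (ThetaQuot.mk (B := B)) := continuous_quotient_mk'

theorem continuous_act (h : groupH B) : Continuous fun y : ThetaQuot B => y.act h :=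
  Continuous.quotient_map' (continuous_mul_const h) _

theorem continuous_act_left (y : ThetaQuot B) : Continuous fun h : groupH B => y.act h := by
  obtain ⟨g, rfl⟩ := exists_mk y
  exact continuous_mk.comp (continuous_const_mul g)

theorem continuous_ucoord : Continuous (ucoord (B := B)) :=
  (continuous_apply _).comp continuous_vec

theorem continuous_acoord : Continuous (acoord (B := B)) :=
  continuous_pi fun _ => (continuous_apply _).comp continuous_vec

theorem isClosed_groupH : IsClosed (groupH B : Set (GL (Idx n) F)) := by
  have h1 : IsClosed {g : GL (Idx n) F |
      (g : Matrix (Idx n) (Idx n) F) * gram B * (g : Matrix (Idx n) (Idx n) F)ᵀ = gram B} :=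
    isClosed_eq ((Units.continuous_val.matrix_mul continuous_const).matrix_mul
      Units.continuous_val.matrix_transpose) continuous_const
  have h2 : IsClosed {g : GL (Idx n) F |
      eMinus F n ᵥ* (g : Matrix (Idx n) (Idx n) F) = eMinus F n} :=
    isClosed_eq (continuous_const.matrix_vecMul Units.continuous_val) continuous_const
  exact h1.inter h2

/-- The topology of a unit group is induced from the pair of an element and its inverse, with closed
image; hence both have to be confined to compact sets. -/
theorem isCompact_setOf_mem_mem {S S' : Set (Matrix (Idx n) (Idx n) F)} (hS : IsCompact S)
    (hS' : IsCompact S') : IsCompact {h : groupH B |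
      ((h : GL (Idx n) F) : Matrix (Idx n) (Idx n) F) ∈ S ∧
      (((h : GL (Idx n) F)⁻¹ : GL (Idx n) F) : Matrix (Idx n) (Idx n) F) ∈ S'} := by
  have h1 : IsCompact ((Units.embedProduct (Matrix (Idx n) (Idx n) F)) ⁻¹'
      (S ×ˢ (MulOpposite.op '' S'))) :=
    Units.isClosedEmbedding_embedProduct.isCompact_preimage
      (hS.prod (hS'.image MulOpposite.continuous_op))
  have h2 := (isClosed_groupH (B := B)).isClosedEmbedding_subtypeVal.isCompact_preimage h1
  refine (congrArg IsCompact (Set.ext fun h => ?_)).mp h2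
  simp only [Units.embedProduct, MonoidHom.coe_mk, OneHom.coe_mk, Set.mem_preimage, Set.mem_prod,
    Set.mem_ofPred_eq, MulOpposite.op_injective.mem_set_image]


theorem isCompact_setOf_norm_le [ProperSpace F] (R : ℝ) :
    IsCompact {A : Matrix (Idx n) (Idx n) F | ∀ i j, ‖A i j‖ ≤ R} := by
  have h : IsCompact (Set.univ.pi fun _ : Idx n => Set.univ.pi fun _ : Idx n =>
      Metric.closedBall (0 : F) R) :=
    isCompact_univ_pi fun _ => isCompact_univ_pi fun _ => isCompact_closedBall _ _
  refine (congrArg IsCompact (Set.ext fun A => ?_)).mpr h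
  exact ⟨fun h i _ j _ => mem_closedBall_zero_iff.mpr (h i j),
    fun h i j => mem_closedBall_zero_iff.mp (h i trivial j trivial)⟩

end Topology

/-! ### The maximal compact group and the balls it preserves -/

section Integral

variable {F : Type*} [NontriviallyNormedField F] [IsUltrametricDist F] {n : ℕ}
  {B : Matrix (Fin n) (Fin n) F}

theorem norm_rowSum_le {ι κ : Type*} [Fintype ι] (v : ι → F) (A : Matrix ι κ F) {R : ℝ} (hR : 0 ≤ R)
    (hv : ∀ i, ‖v i‖ ≤ R) (hA : ∀ i j, ‖A i j‖ ≤ 1) (j : κ) : ‖(v ᵥ* A) j‖ ≤ R := by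
  refine IsUltrametricDist.norm_sum_le_of_forall_le_of_nonneg hR fun i _ => ?_
  rw [norm_mul]
  exact (mul_le_of_le_one_right (norm_nonneg _) (hA i j)).trans (hv i)

theorem mem_groupK_iff {h : groupH B} : h ∈ groupK B ↔
    (∀ i j, ‖((h : GL (Idx n) F) : Matrix (Idx n) (Idx n) F) i j‖ ≤ 1) ∧
    ∀ i j, ‖(((h : GL (Idx n) F)⁻¹ : GL (Idx n) F) : Matrix (Idx n) (Idx n) F) i j‖ ≤ 1 := by
  have hK : h ∈ groupK B ↔ ∀ v : Idx n → F, IntegralVec (rowAct v h) ↔ IntegralVec v := Iff.rfl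
  have hsingle : ∀ i, IntegralVec (Pi.single i 1 : Idx n → F) := by
    intro i j
    by_cases hij : j = i
    · subst hij; simp
    · simp [hij]
  have hinv : ∀ v : Idx n → F, rowAct (v ᵥ* (((h : GL (Idx n) F)⁻¹ : GL (Idx n) F) : Matrix (Idx n) (Idx n) F)) h = v := by
    intro v
    rw [rowAct, Matrix.vecMul_vecMul, ← Units.val_mul, inv_mul_cancel, Units.val_one, Matrix.vecMul_one]
  constructor
  · intro hk
    rw [hK] at hk
    constructor
    · intro i j
      have := (hk (Pi.single i 1)).mpr (hsingle i) j
      simpa [rowAct] using this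
    · intro i j
      have := (hk (Pi.single i 1 ᵥ* _)).mp (by rw [hinv]; exact hsingle i) j
      simpa using this
  · rintro ⟨h1, h2⟩
    rw [hK]
    intro v
    constructor
    · intro hv i
      have := norm_rowSum_le _ _ zero_le_one hv h2 i
      rwa [rowAct, Matrix.vecMul_vecMul, ← Units.val_mul, mul_inv_cancel, Units.val_one, Matrix.vecMul_one] at this
    · intro hv i
      exact norm_rowSum_le _ _ zero_le_one hv h1 i

theorem norm_rowAct_le_iff {R : ℝ} (hR : 0 ≤ R) {k : groupH B} (hk : k ∈ groupK B) (v : Idx n → F) :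
    (∀ i, ‖rowAct v k i‖ ≤ R) ↔ ∀ i, ‖v i‖ ≤ R := by
  obtain ⟨h1, h2⟩ := mem_groupK_iff.mp hk
  constructor
  · intro hv i
    have := norm_rowSum_le _ _ hR hv h2 i
    rwa [rowAct, Matrix.vecMul_vecMul, ← Units.val_mul, mul_inv_cancel, Units.val_one, Matrix.vecMul_one] at this
  · intro hv i
    exact norm_rowSum_le _ _ hR hv h1 i

instance [ProperSpace F] : CompactSpace (groupK B) := by
  refine (isCompact_iff_compactSpace (X := groupH B)).mp ?_
  have := isCompact_setOf_mem_mem (B := B) (isCompact_setOf_norm_le (F := F) (n := n) 1)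
    (isCompact_setOf_norm_le (F := F) (n := n) 1)
  exact (congrArg IsCompact (Set.ext fun h => mem_groupK_iff)).mpr this

/-- The coset space elements whose vector has entries of size at most `q ^ i`. -/
def ballSet (B : Matrix (Fin n) (Fin n) F) (i : ℤ) : Set (ThetaQuot B) :=
  {y | ∀ j, ‖vec y j‖ ≤ qR F ^ i}

theorem mem_ballSet_iff {i : ℤ} {y : ThetaQuot B} : y ∈ ballSet B i ↔
    (∀ j, ‖acoord y j‖ ≤ qR F ^ i) ∧ ‖ucoord y‖ ≤ qR F ^ i ∧ ‖vcoord y‖ ≤ qR F ^ i := by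
  have h0 : (0 : ℝ) ≤ qR F ^ i := zpow_nonneg (Nat.cast_nonneg _) _
  constructor
  · intro h
    exact ⟨fun j => h _, h _, h _⟩
  · rintro ⟨h1, h2, h3⟩ j
    rcases j with j | j
    · exact h1 j
    · fin_cases j
      · exact h2
      · exact h3
      · have : ‖vec y (.inr 2)‖ ≤ qR F ^ i := by rw [vec_two, norm_zero]; exact h0
        exact this

theorem isClosed_ballSet (i : ℤ) : IsClosed (ballSet B i) := by
  have : ballSet B i = ⋂ j, {y | ‖vec y j‖ ≤ qR F ^ i} := by
    ext y; simp [ballSet]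
  rw [this]
  exact isClosed_iInter fun j =>
    isClosed_le ((continuous_apply j).comp continuous_vec).norm continuous_const

theorem act_mem_ballSet_iff {i : ℤ} {y : ThetaQuot B} {k : groupH B} (hk : k ∈ groupK B) :
    y.act k ∈ ballSet B i ↔ y ∈ ballSet B i := by
  unfold ballSet
  simp only [Set.mem_ofPred_eq, vec_act]
  exact norm_rowAct_le_iff (zpow_nonneg (Nat.cast_nonneg _) _) hk _

theorem iUnion_ballSet [ProperSpace F] : ⋃ i : ℕ, ballSet B i = Set.univ := by
  refine Set.eq_univ_of_forall fun y => ?_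
  obtain ⟨N, hN⟩ := pow_unbounded_of_one_lt ‖vec y‖ (one_lt_qR (F := F))
  refine Set.mem_iUnion.mpr ⟨N, fun j => ?_⟩
  rw [zpow_natCast]
  exact (norm_le_pi_norm _ j).trans hN.le

theorem ballSet_mono [ProperSpace F] {i j : ℤ} (h : i ≤ j) : ballSet B i ⊆ ballSet B j :=
  fun _ hy l => (hy l).trans (qR_zpow_le.mpr h)

end Integral

/-! ### Balls have finite measure -/

section CompactBall

variable {F : Type*} [NontriviallyNormedField F] [IsUltrametricDist F] {n : ℕ}
  {B : Matrix (Fin n) (Fin n) F}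

theorem reflect_reflect {w : Idx n → F} (hw : bil B w w ≠ 0) (v : Idx n → F) :
    reflect B w (reflect B w v) = v := by
  simp only [reflect_apply, bil_sub_left, bil_smul_left]
  rw [sub_sub, ← add_smul]
  convert sub_zero v
  convert zero_smul F w
  field_simp
  ring

theorem continuous_bil : Continuous fun p : (Idx n → F) × (Idx n → F) => bil B p.1 p.2 := by
  unfold bil
  exact continuous_fst.dotProduct (continuous_const.matrix_mulVec continuous_snd)

/-- The lower bound on ⟨w, w⟩ keeps the denominator of the reflection away from zero, so the matrix
depends continuously on `w` over a compact set. -/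
theorem isCompact_reflect_image [ProperSpace F] (R : ℝ) {c : ℝ} (hc : 0 < c) :
    IsCompact ((fun w => Matrix.of fun i j => reflect B w (Pi.single i 1) j) ''
      {w : Idx n → F | ‖w‖ ≤ R ∧ c ≤ ‖bil B w w‖}) := by
  have hcont : Continuous fun w : Idx n → F => bil B w w :=
    continuous_bil.comp (continuous_id.prodMk continuous_id)
  have hW : IsCompact {w : Idx n → F | ‖w‖ ≤ R ∧ c ≤ ‖bil B w w‖} := by
    have h1 := (isCompact_closedBall (0 : Idx n → F) R).inter_right
      (isClosed_le continuous_const hcont.norm : IsClosed {w : Idx n → F | c ≤ ‖bil B w w‖})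
    refine (congrArg IsCompact (Set.ext fun w => ?_)).mpr h1
    simp
  refine hW.image_of_continuousOn ?_
  refine continuousOn_pi.mpr fun i => continuousOn_pi.mpr fun j => ?_
  simp only [Matrix.of_apply, reflect_apply, Pi.sub_apply, Pi.smul_apply, smul_eq_mul]
  refine continuousOn_const.sub (ContinuousOn.mul (ContinuousOn.div ?_ hcont.continuousOn ?_)
    (continuous_apply j).continuousOn)
  · exact (continuous_const.mul (continuous_bil.comp (continuous_const.prodMk continuous_id))).continuousOn
  · intro w hw h0
    have := hw.2
    rw [h0, norm_zero] at this
    linarith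

theorem coe_apply_eq_rowAct (h : groupH B) (i j : Idx n) :
    ((h : GL (Idx n) F) : Matrix (Idx n) (Idx n) F) i j = rowAct (Pi.single i 1) h j := by
  simp [rowAct]

/-- Since e₊ and `vec y` have the same norm, the reflection in their difference exchanges them.
Being its own inverse, it lies in a compact set of the group as soon as its matrix lies in a compact
set of matrices. -/
theorem exists_reflection [CharZero F] (hB : B.IsSymm) (hBdet : IsUnit B.det) {y : ThetaQuot B}
    (hy : bil B (vec y - ePlus F n) (vec y - ePlus F n) ≠ 0) :
    ∃ h : groupH B, y = ThetaQuot.mk h ∧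
      (∀ v, rowAct v h = reflect B (vec y - ePlus F n) v) ∧ h⁻¹ = h := by
  have he2 : bil B (vec y - ePlus F n) (eMinus F n) = 0 := by
    rw [bil_eMinus]; simp [vec_two, ePlus]
  obtain ⟨h, hh⟩ := exists_ofIsometry hBdet (reflect B (vec y - ePlus F n)) (bil_reflect hB hy)
    (by rw [reflect_apply, bil_comm hB, he2]; simp)
  have hee : bil B (ePlus F n) (ePlus F n) = 1 := by
    have := bil_vec (ThetaQuot.mk (1 : groupH B))
    rwa [vec_mk, rowAct_one] at this
  refine ⟨h, ?_, hh, ?_⟩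
  · apply vec_injective
    rw [vec_mk]
    change _ = _ ᵥ* _
    rw [hh, reflect_apply]
    have hr : 2 * bil B (ePlus F n) (vec y - ePlus F n)
        = - bil B (vec y - ePlus F n) (vec y - ePlus F n) := by
      simp only [bil_sub_left, bil_sub_right, bil_vec, hee, bil_comm hB (ePlus F n) (vec y)]
      ring
    rw [hr, neg_div, div_self hy]
    module
  · rw [inv_eq_iff_mul_eq_one]
    refine Subtype.ext (Units.ext (Matrix.ext fun i j => ?_))
    rw [coe_apply_eq_rowAct, coe_apply_eq_rowAct, rowAct_mul, rowAct_one]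
    change ((_ ᵥ* _) ᵥ* _) j = _
    rw [hh, hh, reflect_reflect hy]

/-- For w = `vec y`, the norms of w - e₊ and of -w - e₊ add up to 4, so by the ultrametric
inequality one of them has absolute value at least |4|. Thus w or -w is the image of e₊ under a
reflection from a compact family, and the ball is covered by two compact sets. No comparison of the
quotient topology with that of the quadric is needed. -/
theorem measure_ballSet_lt_top [ProperSpace F] [CharZero F] (hB : B.IsSymm) (hBdet : IsUnit B.det)
    (μ : Measure (ThetaQuot B)) [IsFiniteMeasureOnCompacts μ] (i : ℤ) : μ (ballSet B i) < ⊤ := by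
  set R : ℝ := qR F ^ i + ‖ePlus F n‖
  have h4 : (4 : F) ≠ 0 := by norm_num
  have h4' : 0 < ‖(4 : F)‖ := norm_pos_iff.mpr h4
  have hC := isCompact_reflect_image (B := B) R h4'
  have hK := (isCompact_setOf_mem_mem (B := B) hC hC).image continuous_mk
  obtain ⟨ν, hν⟩ := exists_ofIsometry (B := B) hBdet (negComplement F n) (bil_negComplement hB)
    (by rw [negComplement_apply]; simp only [eMinus, Sum.elim_inr]; simp; module)
  have hνvec : ∀ y : ThetaQuot B, vec (y.act ν) = - vec y := fun y => by
    rw [vec_act]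
    change _ ᵥ* _ = _
    rw [hν, negComplement_apply, vec_two]; simp
  have hK' := hK.image (continuous_act ν)
  have key : ∀ y ∈ ballSet B i, ‖(4 : F)‖ ≤ ‖bil B (vec y - ePlus F n) (vec y - ePlus F n)‖ →
      y ∈ ThetaQuot.mk '' {h : groupH B |
      ((h : GL (Idx n) F) : Matrix (Idx n) (Idx n) F) ∈ ((fun w => Matrix.of fun i j => reflect B w (Pi.single i 1) j) ''
      {w : Idx n → F | ‖w‖ ≤ R ∧ ‖(4 : F)‖ ≤ ‖bil B w w‖}) ∧
      (((h : GL (Idx n) F)⁻¹ : GL (Idx n) F) : Matrix (Idx n) (Idx n) F) ∈ ((fun w => Matrix.of fun i j => reflect B w (Pi.single i 1) j) ''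
      {w : Idx n → F | ‖w‖ ≤ R ∧ ‖(4 : F)‖ ≤ ‖bil B w w‖})} := by
    intro y hy h
    obtain ⟨g, hg1, hg2, hg3⟩ := exists_reflection hB hBdet (y := y) (by
      intro h0; rw [h0, norm_zero] at h; linarith)
    have hmem : ((g : GL (Idx n) F) : Matrix (Idx n) (Idx n) F) ∈ ((fun w => Matrix.of fun i j => reflect B w (Pi.single i 1) j) ''
      {w : Idx n → F | ‖w‖ ≤ R ∧ ‖(4 : F)‖ ≤ ‖bil B w w‖}) := by
      refine ⟨vec y - ePlus F n, ⟨?_, h⟩, ?_⟩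
      · refine (norm_sub_le _ _).trans (add_le_add ?_ le_rfl)
        exact (pi_norm_le_iff_of_nonneg (zpow_nonneg (Nat.cast_nonneg _) _)).mpr hy
      · ext i j
        rw [coe_apply_eq_rowAct, hg2]; rfl
    refine ⟨g, ⟨hmem, ?_⟩, hg1.symm⟩
    rw [← Subgroup.coe_inv, hg3]
    exact hmem
  refine lt_of_le_of_lt (measure_mono (fun y hy => ?_)) (hK.union hK').measure_lt_top
  have hee : bil B (ePlus F n) (ePlus F n) = 1 := by
    have := bil_vec (ThetaQuot.mk (1 : groupH B))
    rwa [vec_mk, rowAct_one] at this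
  have hyν : y.act ν ∈ ballSet B i := by
    intro j
    rw [hνvec, Pi.neg_apply, norm_neg]
    exact hy j
  have hsum : bil B (vec y - ePlus F n) (vec y - ePlus F n)
      + bil B (vec (y.act ν) - ePlus F n) (vec (y.act ν) - ePlus F n) = 4 := by
    rw [hνvec]
    simp only [bil_sub_left, bil_sub_right, bil_neg_left, bil_neg_right, bil_vec, hee]
    ring
  rcases le_total ‖bil B (vec y - ePlus F n) (vec y - ePlus F n)‖
      ‖bil B (vec (y.act ν) - ePlus F n) (vec (y.act ν) - ePlus F n)‖ with h | h
  · right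
    have := IsUltrametricDist.norm_add_le_max (bil B (vec y - ePlus F n) (vec y - ePlus F n))
      (bil B (vec (y.act ν) - ePlus F n) (vec (y.act ν) - ePlus F n))
    rw [hsum, max_eq_right h] at this
    refine ⟨y.act ν, key _ hyν this, ?_⟩
    apply vec_injective
    rw [hνvec, hνvec, neg_neg]
  · left
    have := IsUltrametricDist.norm_add_le_max (bil B (vec y - ePlus F n) (vec y - ePlus F n))
      (bil B (vec (y.act ν) - ePlus F n) (vec (y.act ν) - ePlus F n))
    rw [hsum, max_eq_left h] at this
    exact key y hy this

end CompactBall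

/-! ### Right invariance of κ, and invariance of μ on preimages -/

section Invariance

variable {F : Type*} [NontriviallyNormedField F] [IsUltrametricDist F] [ProperSpace F] {n : ℕ}
  {B : Matrix (Fin n) (Fin n) F}

/-- Compact groups are unimodular: a right translate of `κ` is again a left Haar probability
measure. The equidistribution argument multiplies on the right, because the extra element acts on y
after k. -/
theorem map_mul_right_eq (κ : Measure (groupK B)) [IsProbabilityMeasure κ] [κ.IsMulLeftInvariant]
    (g : groupK B) : κ.map (fun k => k * g) = κ := by
  have hm : Measurable fun k : groupK B => k * g := (continuous_mul_const g).measurable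
  have : IsProbabilityMeasure (κ.map (fun k => k * g)) := Measure.isProbabilityMeasure_map hm.aemeasurable
  have h1 : κ.IsHaarMeasure := Measure.isHaarMeasure_of_isCompact_nonempty_interior κ Set.univ
    isCompact_univ (by simp) (by simp) (by simp)
  have h2 : (κ.map (fun k => k * g)).IsHaarMeasure :=
    Measure.isHaarMeasure_of_isCompact_nonempty_interior _ Set.univ
      isCompact_univ (by simp) (by simp) (by simp)
  exact Measure.isHaarMeasure_eq_of_isProbabilityMeasure _ _

theorem measure_preimage_mul_right' (κ : Measure (groupK B)) [IsProbabilityMeasure κ]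
    [κ.IsMulLeftInvariant] (g : groupK B) {S : Set (groupK B)} (hS : MeasurableSet S) :
    κ ((fun k => k * g) ⁻¹' S) = κ S := by
  conv_rhs => rw [← map_mul_right_eq κ g]
  rw [Measure.map_apply (continuous_mul_const g).measurable hS]

theorem measure_preimage_act {μ : Measure (ThetaQuot B)}
    (hμ : ∀ h : groupH B, μ.map (fun y => y.act h) = μ) (h : groupH B) {S : Set (ThetaQuot B)}
    (hS : MeasurableSet S) : μ ((fun y => y.act h) ⁻¹' S) = μ S := by
  conv_rhs => rw [← hμ h]
  rw [Measure.map_apply (continuous_act h).measurable hS]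

end Invariance

/-! ### Equidistribution of the `x'`-coordinate near zero -/

section Norms

variable {F : Type*} [NontriviallyNormedField F] [IsUltrametricDist F] [ProperSpace F]

theorem norm_mul_le_zpow {x y : F} {i j : ℤ} (hx : ‖x‖ ≤ qR F ^ i) (hy : ‖y‖ ≤ qR F ^ j) :
    ‖x * y‖ ≤ qR F ^ (i + j) := by
  rw [norm_mul, zpow_add₀ (qR_pos (F := F)).ne']
  exact mul_le_mul hx hy (norm_nonneg _) (qR_zpow_pos _).le

theorem norm_le_zpow_of_le {x : F} {i j : ℤ} (hx : ‖x‖ ≤ qR F ^ i) (h : i ≤ j) : ‖x‖ ≤ qR F ^ j :=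
  hx.trans (qR_zpow_le.mpr h)

theorem norm_add_le_of_le' {x y : F} {R : ℝ} (hx : ‖x‖ ≤ R) (hy : ‖y‖ ≤ R) : ‖x + y‖ ≤ R :=
  (IsUltrametricDist.norm_add_le_max x y).trans (max_le hx hy)

theorem norm_sub_le_of_le' {x y : F} {R : ℝ} (hx : ‖x‖ ≤ R) (hy : ‖y‖ ≤ R) : ‖x - y‖ ≤ R := by
  rw [sub_eq_add_neg]
  exact norm_add_le_of_le' hx (by rwa [norm_neg])

theorem norm_dotProduct_le {ι : Type*} [Fintype ι] {v w : ι → F} {i j : ℤ}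
    (hv : ∀ l, ‖v l‖ ≤ qR F ^ i) (hw : ∀ l, ‖w l‖ ≤ qR F ^ j) : ‖v ⬝ᵥ w‖ ≤ qR F ^ (i + j) :=
  IsUltrametricDist.norm_sum_le_of_forall_le_of_nonneg (qR_zpow_pos _).le
    fun l _ => norm_mul_le_zpow (hv l) (hw l)

theorem norm_natCast_le_one' (m : ℕ) : ‖(m : F)‖ ≤ 1 := IsUltrametricDist.norm_natCast_le_one F m

theorem norm_two_le : ‖(2 : F)‖ ≤ qR F ^ (0 : ℤ) := by
  simpa using norm_natCast_le_one' (F := F) 2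

variable (F) in
theorem exists_norm_le_zpow {ι : Type*} [Finite ι] (x : ι → F) :
    ∃ b : ℤ, 0 ≤ b ∧ ∀ i, ‖x i‖ ≤ qR F ^ b := by
  have := Fintype.ofFinite ι
  obtain ⟨N, hN⟩ := pow_unbounded_of_one_lt ‖x‖ (one_lt_qR (F := F))
  refine ⟨N, by positivity, fun i => ?_⟩
  rw [zpow_natCast]
  exact (norm_le_pi_norm x i).trans hN.le

end Norms

/-! ### Shifting the x'-coordinate by small opposite unipotent elements -/

section Distribution

variable {F : Type*} [NontriviallyNormedField F] [IsUltrametricDist F] [ProperSpace F] {n : ℕ}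
  {B : Matrix (Fin n) (Fin n) F}

theorem eichler_neg_eichler [CharZero F] (hB : B.IsSymm) {p b : Idx n → F} (hp : bil B p p = 0)
    (hpb : bil B b p = 0) (v : Idx n → F) : eichler B p (-b) (eichler B p b v) = v := by
  have hpb' : bil B p b = 0 := by rw [bil_comm hB, hpb]
  simp only [eichler_apply, bil_add_left, bil_sub_left, bil_smul_left, bil_neg_left, bil_neg_right,
    hp, hpb, hpb']
  ext i
  simp only [Pi.add_apply, Pi.sub_apply, Pi.smul_apply, smul_eq_mul, Pi.neg_apply]
  field_simp
  ring

theorem norm_xPrime_le (j : Idx n) : ‖xPrime F n j‖ ≤ qR F ^ (0 : ℤ) := by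
  rcases j with j | j
  · simp [xPrime]
  · fin_cases j <;> simp [xPrime]

/-- The condition `b + e ≤ m` makes both `B *ᵥ a` and half of ⟨a, a⟩ integral; `e` pays for the
division by 2 in residue characteristic 2. -/
theorem norm_eichler_le {b e m : ℤ} (hb : ∀ i j, ‖B i j‖ ≤ qR F ^ b) (hb0 : 0 ≤ b) (he0 : 0 ≤ e)
    (he : ‖(2 : F)⁻¹‖ ≤ qR F ^ e) {a : Fin n → F} (ha : ∀ i, ‖a i‖ ≤ qR F ^ (-m)) (hm : b + e ≤ m)
    {v : Idx n → F} (hv : ∀ i, ‖v i‖ ≤ 1) (j : Idx n) :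
    ‖eichler B (xPrime F n) (incl a) v j‖ ≤ 1 := by
  have hv' : ∀ i, ‖v i‖ ≤ qR F ^ (0 : ℤ) := by simpa using hv
  have hBa : ∀ l, ‖(B *ᵥ a) l‖ ≤ qR F ^ (b + -m) := fun l => norm_dotProduct_le (hb l) ha
  have h1 : ‖bil B v (incl a)‖ ≤ qR F ^ (0 : ℤ) := by
    rw [bil_incl]
    exact norm_le_zpow_of_le (norm_dotProduct_le (fun l => hv' (.inl l)) hBa) (by omega)
  have h2 : ‖bil B (incl a) (incl a) / 2‖ ≤ qR F ^ (0 : ℤ) := by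
    rw [bil_incl, div_eq_mul_inv]
    exact norm_le_zpow_of_le (norm_mul_le_zpow (norm_dotProduct_le ha hBa) he) (by omega)
  have h3 : ‖incl a j‖ ≤ qR F ^ (0 : ℤ) := by
    rcases j with j | j
    · exact norm_le_zpow_of_le (ha j) (by omega)
    · simp [incl]
  rw [← zpow_zero (qR F)]
  simp only [eichler_apply, bil_xPrime, Pi.add_apply, Pi.sub_apply, Pi.smul_apply, smul_eq_mul]
  refine norm_sub_le_of_le' (norm_sub_le_of_le' (norm_add_le_of_le' (hv' j) ?_) ?_) ?_
  · exact norm_mul_le_zpow (hv' _) h3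
  · exact norm_mul_le_zpow h1 (norm_xPrime_le j)
  · exact norm_mul_le_zpow (norm_mul_le_zpow h2 (hv' _)) (norm_xPrime_le j)

theorem exists_small_opposite_unipotent [CharZero F] (hB : B.IsSymm) (hBdet : IsUnit B.det) {b e m : ℤ}
    (hb : ∀ i j, ‖B i j‖ ≤ qR F ^ b) (hb0 : 0 ≤ b) (he0 : 0 ≤ e)
    (he : ‖(2 : F)⁻¹‖ ≤ qR F ^ e) {a : Fin n → F} (ha : ∀ i, ‖a i‖ ≤ qR F ^ (-m)) (hm : b + e ≤ m) :
    ∃ g : groupK B, ∀ y : ThetaQuot B,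
      acoord (y.act g) = acoord y + vcoord y • a ∧
      ucoord (y.act g) = ucoord y - acoord y ⬝ᵥ B *ᵥ a - a ⬝ᵥ B *ᵥ a / 2 * vcoord y ∧
      vcoord (y.act g) = vcoord y := by
  obtain ⟨g, hg, hg'⟩ := exists_opposite_unipotent hB hBdet a
  refine ⟨⟨g, ?_⟩, hg'⟩
  intro v
  change IntegralVec (rowAct v g) ↔ IntegralVec v
  rw [hg]
  constructor
  · intro h j
    have h2 := norm_eichler_le hb hb0 he0 he (a := -a) (fun i => by simpa using ha i) hm h j
    have h3 : incl (-a) = -incl a := by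
      ext j; rcases j with j | j <;> simp [incl]
    rw [h3, eichler_neg_eichler hB bil_xPrime_xPrime (by simp [bil_xPrime, incl])] at h2
    exact h2
  · intro h j
    exact norm_eichler_le hb hb0 he0 he ha hm h j

/-- The lattice of the vectors with entries of size at most `q ^ m`. -/
def smallLattice (F : Type*) [NontriviallyNormedField F] [IsUltrametricDist F] [ProperSpace F]
    (n : ℕ) (m : ℤ) : AddSubgroup (Fin n → F) where
  carrier := {a | ∀ i, ‖a i‖ ≤ qR F ^ m}
  zero_mem' := fun i => by simpa using (qR_zpow_pos (F := F) m).le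
  add_mem' := fun ha hb i => norm_add_le_of_le' (ha i) (hb i)
  neg_mem' := fun ha i => by simpa using ha i

/-- The lattice is open, so the quotient is discrete, and a separable discrete space is countable.
Its classes will label approximate values of a in a countable partition of K^H. -/
theorem countable_quotient_smallLattice (m : ℤ) : Countable ((Fin n → F) ⧸ smallLattice F n m) ∧
    DiscreteTopology ((Fin n → F) ⧸ smallLattice F n m) := by
  have hopen : IsOpen (smallLattice F n m : Set (Fin n → F)) := by
    refine AddSubgroup.isOpen_of_mem_nhds (smallLattice F n m) (g := 0) ?_
    refine Filter.mem_of_superset (Metric.closedBall_mem_nhds (0 : Fin n → F) (qR_zpow_pos (F := F) m)) ?_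
    intro a ha i
    exact (norm_le_pi_norm a i).trans (by simpa using ha)
  have hd : DiscreteTopology ((Fin n → F) ⧸ smallLattice F n m) := QuotientAddGroup.discreteTopology hopen
  refine ⟨?_, hd⟩
  have : TopologicalSpace.SeparableSpace ((Fin n → F) ⧸ smallLattice F n m) :=
    (QuotientAddGroup.mk_surjective (s := smallLattice F n m)).denseRange.separableSpace
      continuous_quotient_mk'
  exact TopologicalSpace.separableSpace_iff_countable.mp this

/-- If every entry of aB were at most q^(-N-1), then B(a) and 2uv would both have size at most 1/q,
although their sum is 1. -/
theorem exists_large_entry [CharZero F] (hF : IsNormalizedNorm F) {N : ℤ} {y : ThetaQuot B}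
    (hy : y ∈ ballSet B N) (hu : ‖ucoord y‖ ≤ qR F ^ (-N - 1)) :
    ∃ i, qR F ^ (-N) ≤ ‖(acoord y ᵥ* B) i‖ := by
  obtain ⟨ha, -, hv⟩ := mem_ballSet_iff.mp hy
  by_contra! hcon
  have h1 : ‖acoord y ⬝ᵥ B *ᵥ acoord y‖ ≤ qR F ^ (-1 : ℤ) := by
    rw [Matrix.dotProduct_mulVec]
    refine norm_le_zpow_of_le (norm_dotProduct_le (i := -N - 1) (fun l => ?_) ha) (by omega)
    exact (norm_lt_zpow_iff hF).mp (hcon l)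
  have h2 : ‖2 * ucoord y * vcoord y‖ ≤ qR F ^ (-1 : ℤ) :=
    norm_le_zpow_of_le (norm_mul_le_zpow (norm_mul_le_zpow norm_two_le hu) hv) (by omega)
  have h3 := norm_add_le_of_le' h1 h2
  rw [coord_eq, norm_one, ← zpow_zero (qR F), qR_zpow_le] at h3
  omega

/-- Partition K^H by the class of the coordinate a of yk. On a class where u comes close to `c`, one
fixed small opposite unipotent element moves u close to `c'` and preserves the class. Right
invariance of `κ` then compares the masses class by class. -/
theorem measure_translate_le [CharZero F] (hF : IsNormalizedNorm F) (hB : B.IsSymm) (hBdet : IsUnit B.det)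
    (κ : Measure (groupK B)) [IsProbabilityMeasure κ] [κ.IsMulLeftInvariant] {b e : ℤ}
    (hb : ∀ i j, ‖B i j‖ ≤ qR F ^ b) (hb0 : 0 ≤ b) (he0 : 0 ≤ e) (he : ‖(2 : F)⁻¹‖ ≤ qR F ^ e)
    {N : ℤ} (hN : 0 ≤ N) {y : ThetaQuot B} (hy : y ∈ ballSet B N) {j : ℤ}
    (hj : 3 * N + (2 * b + e + 2) ≤ j) {c c' : F} (hc : ‖c‖ ≤ qR F ^ (-j)) (hc' : ‖c'‖ ≤ qR F ^ (-j)) :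
    κ {k | ‖ucoord (y.act (k : groupH B)) - c‖ ≤ qR F ^ (-(j + 1))} ≤
      κ {k | ‖ucoord (y.act (k : groupH B)) - c'‖ ≤ qR F ^ (-(j + 1))} := by
  -- At this precision, changing a inside a class changes aB by at most q^(-N-1).
  set L := smallLattice F n (-(N + b + 1))
  obtain ⟨hcount, hdisc⟩ := countable_quotient_smallLattice (F := F) (n := n) (-(N + b + 1))
  let lab : groupK B → (Fin n → F) ⧸ L := fun k => QuotientAddGroup.mk (acoord (y.act (k : groupH B)))
  have hlab : Continuous lab := continuous_quotient_mk'.comp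
    (continuous_acoord.comp ((continuous_act_left y).comp continuous_subtype_val))
  have hlabm : ∀ x, MeasurableSet (lab ⁻¹' {x}) := fun x => ((isOpen_discrete {x}).preimage hlab).measurableSet
  have hEm : ∀ c : F, MeasurableSet {k : groupK B | ‖ucoord (y.act (k : groupH B)) - c‖ ≤ qR F ^ (-(j + 1))} := by
    intro c
    refine (isClosed_le (Continuous.norm (Continuous.sub ?_ continuous_const)) continuous_const).measurableSet
    exact continuous_ucoord.comp ((continuous_act_left y).comp continuous_subtype_val)
  have hsplit : ∀ c : F, κ {k : groupK B | ‖ucoord (y.act (k : groupH B)) - c‖ ≤ qR F ^ (-(j + 1))}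
      = ∑' x, κ ({k : groupK B | ‖ucoord (y.act (k : groupH B)) - c‖ ≤ qR F ^ (-(j + 1))} ∩ lab ⁻¹' {x}) := by
    intro c
    rw [← measure_iUnion]
    · congr 1
      ext k; simp
    · intro x x' hxx
      refine Set.disjoint_left.mpr ?_
      rintro k ⟨-, h1⟩ ⟨-, h2⟩
      exact hxx ((Set.mem_singleton_iff.mp h1).symm.trans (Set.mem_singleton_iff.mp h2))
    · exact fun x => (hEm c).inter (hlabm x)
  rw [hsplit c, hsplit c']
  refine ENNReal.tsum_le_tsum fun x => ?_
  rcases Set.eq_empty_or_nonempty ({k : groupK B | ‖ucoord (y.act (k : groupH B)) - c‖ ≤ qR F ^ (-(j + 1))} ∩ lab ⁻¹' {x}) with h0 | ⟨k0, hk0, hk0x⟩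
  · rw [h0, measure_empty]; exact zero_le
  have hball : ∀ k : groupK B, y.act (k : groupH B) ∈ ballSet B N := fun k =>
    (act_mem_ballSet_iff k.2).mpr hy
  have hu : ∀ k : groupK B, ‖ucoord (y.act (k : groupH B)) - c‖ ≤ qR F ^ (-(j + 1)) →
      ‖ucoord (y.act (k : groupH B))‖ ≤ qR F ^ (-j) := by
    intro k hk
    have := norm_add_le_of_le' (norm_le_zpow_of_le hk (by omega)) hc
    rwa [sub_add_cancel] at this
  obtain ⟨i, hi⟩ := exists_large_entry hF (hball k0) (norm_le_zpow_of_le (hu k0 hk0) (by omega))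
  set a0 := acoord (y.act (k0 : groupH B)) with ha0
  set d := (a0 ᵥ* B) i with hd
  have hd0 : d ≠ 0 := by
    intro h
    rw [h, norm_zero] at hi
    exact absurd hi (not_le.mpr (qR_zpow_pos _))
  -- The shift along the i-th basis vector changes u by -(aB)_i s to first order; this `s` makes
  -- that equal to c' - c at the reference point. Since |d| ≥ q^(-N), it has size at most q^(N-j).
  set s := (c - c') / d with hs
  have hsn : ‖s‖ ≤ qR F ^ (-(j - N)) := by
    rw [hs, norm_div, div_le_iff₀ (norm_pos_iff.mpr hd0)]
    have h1 : ‖c - c'‖ ≤ qR F ^ (-j) := norm_sub_le_of_le' hc hc'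
    refine h1.trans ?_
    have h2 : qR F ^ (-j) = qR F ^ (-(j - N)) * qR F ^ (-N) := by
      rw [← zpow_add₀ (qR_pos (F := F)).ne']; congr 1; ring
    rw [h2]
    exact mul_le_mul_of_nonneg_left hi (qR_zpow_pos _).le
  have hsa : ∀ l, ‖(Pi.single i s : Fin n → F) l‖ ≤ qR F ^ (-(j - N)) := by
    intro l
    by_cases hl : l = i
    · subst hl; simpa using hsn
    · simpa [hl] using (qR_zpow_pos (F := F) _).le
  obtain ⟨g, hg⟩ := exists_small_opposite_unipotent hB hBdet hb hb0 he0 he hsa (by omega)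
  have hsub : {k : groupK B | ‖ucoord (y.act (k : groupH B)) - c‖ ≤ qR F ^ (-(j + 1))} ∩ lab ⁻¹' {x} ⊆
      (fun k => k * g) ⁻¹' ({k : groupK B | ‖ucoord (y.act (k : groupH B)) - c'‖ ≤ qR F ^ (-(j + 1))} ∩ lab ⁻¹' {x}) := by
    rintro k ⟨hk, hkx⟩
    have hmul : y.act ((k * g : groupK B) : groupH B) = (y.act (k : groupH B)).act (g : groupH B) := by
      rw [act_act]; rfl
    obtain ⟨hga, hgu, hgv⟩ := hg (y.act (k : groupH B))
    obtain ⟨-, -, hvk⟩ := mem_ballSet_iff.mp (hball k)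
    have hak : ∀ l, ‖(acoord (y.act (k : groupH B)) - a0) l‖ ≤ qR F ^ (-(N + b + 1)) := by
      have h1 : lab k0 = lab k := hk0x.trans hkx.symm
      have h2 := QuotientAddGroup.eq.mp h1
      intro l
      have := h2 l
      rwa [Pi.add_apply, Pi.neg_apply, neg_add_eq_sub] at this
    constructor
    · change ‖ucoord (y.act ((k * g : groupK B) : groupH B)) - c'‖ ≤ _
      rw [hmul, hgu]
      have e1 : acoord (y.act (k : groupH B)) ⬝ᵥ B *ᵥ Pi.single i s
          = (acoord (y.act (k : groupH B)) ᵥ* B) i * s := by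
        rw [Matrix.dotProduct_mulVec]; simp
      have e2 : (Pi.single i s : Fin n → F) ⬝ᵥ B *ᵥ Pi.single i s = s * s * B i i := by
        simp [mul_comm, mul_left_comm]
      have e3 : ((acoord (y.act (k : groupH B)) - a0) ᵥ* B) i = (acoord (y.act (k : groupH B)) ᵥ* B) i - d := by
        rw [Matrix.sub_vecMul]; rfl
      have e4 : ‖((acoord (y.act (k : groupH B)) - a0) ᵥ* B) i‖ ≤ qR F ^ (-(N + b + 1) + b) :=
        norm_dotProduct_le hak fun l => hb l i
      have e5 : d * s = c - c' := by rw [hs]; field_simp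
      -- Besides u - c two errors remain: the variation of aB inside the class times `s`, of size at
      -- most q^(-j-1), and a term quadratic in `s`, of size at most q^(3N+b+e-2j). The bound on `j`
      -- makes the second negligible as well.
      have e6 : ucoord (y.act (k : groupH B)) - acoord (y.act (k : groupH B)) ⬝ᵥ B *ᵥ Pi.single i s
          - (Pi.single i s : Fin n → F) ⬝ᵥ B *ᵥ Pi.single i s / 2 * vcoord (y.act (k : groupH B)) - c'
          = (ucoord (y.act (k : groupH B)) - c) - ((acoord (y.act (k : groupH B)) - a0) ᵥ* B) i * s
            - s * s * B i i * (2 : F)⁻¹ * vcoord (y.act (k : groupH B)) := by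
        rw [e1, e2, e3]
        linear_combination -e5
      rw [e6]
      refine norm_sub_le_of_le' (norm_sub_le_of_le' hk ?_) ?_
      · exact norm_le_zpow_of_le (norm_mul_le_zpow e4 hsn) (by omega)
      · exact norm_le_zpow_of_le (norm_mul_le_zpow (norm_mul_le_zpow (norm_mul_le_zpow
          (norm_mul_le_zpow hsn hsn) (hb i i)) he) hvk) (by omega)
    · change lab (k * g) = x
      rw [← Set.mem_singleton_iff.mp hkx]
      refine (QuotientAddGroup.eq.mpr ?_).symm
      -- The element moves a by vs, of size at most q^(2N-j), which is inside the lattice; so the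
      -- label is unchanged.
      rw [hmul, hga]
      intro l
      rw [neg_add_cancel_left, Pi.smul_apply, smul_eq_mul]
      exact norm_le_zpow_of_le (norm_mul_le_zpow hvk (hsa l)) (by omega)
  refine (measure_mono hsub).trans ?_
  rw [measure_preimage_mul_right' κ g ((hEm c').inter (hlabm x))]

/-- The ball of radius q^(-j) around 0 is the disjoint union of `q` balls of radius q^(-j-1). The
translation inequality, used in both directions, gives their preimages equal mass. -/
theorem measure_ball_eq [CharZero F] (hF : IsNormalizedNorm F) (hB : B.IsSymm) (hBdet : IsUnit B.det)
    (κ : Measure (groupK B)) [IsProbabilityMeasure κ] [κ.IsMulLeftInvariant] {b e : ℤ}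
    (hb : ∀ i j, ‖B i j‖ ≤ qR F ^ b) (hb0 : 0 ≤ b) (he0 : 0 ≤ e) (he : ‖(2 : F)⁻¹‖ ≤ qR F ^ e)
    {N : ℤ} (hN : 0 ≤ N) {y : ThetaQuot B} (hy : y ∈ ballSet B N) {j : ℤ}
    (hj : 3 * N + (2 * b + e + 2) ≤ j) :
    κ {k | ‖ucoord (y.act (k : groupH B))‖ ≤ qR F ^ (-j)} =
      residueCard F * κ {k | ‖ucoord (y.act (k : groupH B))‖ ≤ qR F ^ (-(j + 1))} := by
  obtain ⟨T, hT1, hT2, hT3, hT4⟩ := exists_residue_system hF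
  obtain ⟨t, ht⟩ := exists_norm_eq hF (-j)
  have hct : ∀ c ∈ T, ‖(t : F) * c‖ ≤ qR F ^ (-j) := fun c hc => by
    rw [norm_mul, ht]
    exact mul_le_of_le_one_right (qR_zpow_pos _).le (hT2 c hc)
  have hq : qR F ^ (-(j + 1)) = ‖(t : F)‖ * (qR F)⁻¹ := by
    rw [ht, ← _root_.zpow_neg_one, ← zpow_add₀ (qR_pos (F := F)).ne']; congr 1; ring
  have hunion : {k : groupK B | ‖ucoord (y.act (k : groupH B))‖ ≤ qR F ^ (-j)} =
      ⋃ c ∈ T, {k : groupK B | ‖ucoord (y.act (k : groupH B)) - t * c‖ ≤ qR F ^ (-(j + 1))} := by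
    ext k
    simp only [Set.mem_ofPred_eq, Set.mem_iUnion, exists_prop]
    constructor
    · intro hk
      obtain ⟨c, hc, hcx⟩ := hT3 ((t : F)⁻¹ * ucoord (y.act (k : groupH B))) (by
        rw [norm_mul, norm_inv, ht, inv_mul_le_iff₀ (qR_zpow_pos _), mul_one]; exact hk)
      refine ⟨c, hc, ?_⟩
      have : ucoord (y.act (k : groupH B)) - t * c = t * ((t : F)⁻¹ * ucoord (y.act (k : groupH B)) - c) := by
        have := t.ne_zero
        field_simp
      rw [this, norm_mul, hq]
      exact mul_le_mul_of_nonneg_left hcx (norm_nonneg _)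
    · rintro ⟨c, hc, hk⟩
      have := norm_add_le_of_le' (norm_le_zpow_of_le hk (by omega)) (hct c hc)
      rwa [sub_add_cancel] at this
  rw [hunion, measure_biUnion_finset]
  · rw [Finset.sum_congr rfl (g := fun _ => κ {k | ‖ucoord (y.act (k : groupH B))‖ ≤ qR F ^ (-(j + 1))})]
    · rw [Finset.sum_const, hT1, nsmul_eq_mul]
    · intro c hc
      have h0 : ‖(0 : F)‖ ≤ qR F ^ (-j) := by rw [norm_zero]; exact (qR_zpow_pos _).le
      have h1 := measure_translate_le hF hB hBdet κ hb hb0 he0 he hN hy hj (hct c hc) h0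
      have h2 := measure_translate_le hF hB hBdet κ hb hb0 he0 he hN hy hj h0 (hct c hc)
      simp only [sub_zero] at h1 h2
      exact le_antisymm h1 h2
  · intro c hc c' hc' hne
    refine Set.disjoint_left.mpr fun k hk hk' => hne (hT4 c hc c' hc' ?_)
    have := norm_sub_le_of_le' hk' hk
    have e : ucoord (y.act (k : groupH B)) - t * c' - (ucoord (y.act (k : groupH B)) - t * c) = t * (c - c') := by ring
    rw [e, norm_mul, hq] at this
    exact le_of_mul_le_mul_left this (norm_pos_iff.mpr t.ne_zero)
  · intro c _
    refine (isClosed_le (Continuous.norm (Continuous.sub ?_ continuous_const)) continuous_const).measurableSet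
    exact continuous_ucoord.comp ((continuous_act_left y).comp continuous_subtype_val)

end Distribution

/-! ### Masses of the levels of u are eventually geometric -/

section Levels

variable {F : Type*} [NontriviallyNormedField F] [IsUltrametricDist F] [ProperSpace F] {n : ℕ}
  {B : Matrix (Fin n) (Fin n) F}

/-- The mass of the `k` that bring the `x'`-coordinate of `y` to size `q ^ (-l)`. -/
def levelMass (κ : Measure (groupK B)) (y : ThetaQuot B) (l : ℤ) : ℝ :=
  κ.real {k | ‖ucoord (y.act (k : groupH B))‖ = qR F ^ (-l)}

theorem continuous_ucoord_act (y : ThetaQuot B) :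
    Continuous fun k : groupK B => ucoord (y.act (k : groupH B)) :=
  continuous_ucoord.comp ((continuous_act_left y).comp continuous_subtype_val)

theorem levelMass_eq_zero (κ : Measure (groupK B)) {N l : ℤ} {y : ThetaQuot B} (hy : y ∈ ballSet B N)
    (hl : l < -N) : levelMass κ y l = 0 := by
  have : {k : groupK B | ‖ucoord (y.act (k : groupH B))‖ = qR F ^ (-l)} = ∅ := by
    refine Set.eq_empty_of_forall_notMem fun k hk => ?_
    have h1 := (mem_ballSet_iff.mp ((act_mem_ballSet_iff k.2).mpr hy)).2.1
    rw [Set.mem_ofPred_eq.mp hk, qR_zpow_le] at h1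
    omega
  rw [levelMass, this, measureReal_empty]

theorem levelMass_nonneg (κ : Measure (groupK B)) (y : ThetaQuot B) (l : ℤ) : 0 ≤ levelMass κ y l :=
  measureReal_nonneg

theorem levelMass_le_one (κ : Measure (groupK B)) [IsProbabilityMeasure κ] (y : ThetaQuot B) (l : ℤ) :
    levelMass κ y l ≤ 1 := measureReal_le_one

theorem levelMass_eq_sub (hF : IsNormalizedNorm F) (κ : Measure (groupK B)) [IsProbabilityMeasure κ]
    (y : ThetaQuot B) (l : ℤ) : levelMass κ y l
      = κ.real {k | ‖ucoord (y.act (k : groupH B))‖ ≤ qR F ^ (-l)}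
        - κ.real {k | ‖ucoord (y.act (k : groupH B))‖ ≤ qR F ^ (-(l + 1))} := by
  rw [levelMass, ← measureReal_sdiff]
  · congr 1
    ext k
    simp only [Set.mem_ofPred_eq, Set.mem_sdiff, not_le]
    have h := norm_lt_zpow_iff hF (x := ucoord (y.act (k : groupH B))) (j := -l)
    rw [show -(l + 1) = -l - 1 by ring]
    constructor
    · intro h1
      refine ⟨h1.le, ?_⟩
      by_contra h2
      exact absurd (h.mpr (not_lt.mp h2)) (by rw [h1]; exact lt_irrefl _)
    · rintro ⟨h1, h2⟩
      refine le_antisymm h1 ?_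
      by_contra h3
      exact absurd (h.mp (not_le.mp h3)) (not_le.mpr h2)
  · intro k hk
    exact norm_le_zpow_of_le hk (by omega)
  · exact (isClosed_le (continuous_ucoord_act y).norm continuous_const).measurableSet

/-- A level is a difference of two consecutive balls, so it inherits their exact ratio; iterating
the ratio shows that u = 0 has mass zero. The constant depends only on bounds for the entries of `B`
and for 1/2, not on `N` or `y`; this uniformity gives the exponential estimates later. -/
theorem exists_stable [CharZero F] (hF : IsNormalizedNorm F) (hB : B.IsSymm) (hBdet : IsUnit B.det)
    (κ : Measure (groupK B)) [IsProbabilityMeasure κ] [κ.IsMulLeftInvariant] :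
    ∃ c0 : ℤ, 0 ≤ c0 ∧ ∀ N : ℤ, 0 ≤ N → ∀ y ∈ ballSet B N,
      (∀ j, 3 * N + c0 ≤ j → levelMass κ y (j + 1) = levelMass κ y j / qR F) ∧
      κ {k | ucoord (y.act (k : groupH B)) = 0} = 0 := by
  obtain ⟨b, hb0, hb⟩ := exists_norm_le_zpow F (fun p : Fin n × Fin n => B p.1 p.2)
  obtain ⟨e, he0, he⟩ := exists_norm_le_zpow F (fun _ : Unit => (2 : F)⁻¹)
  refine ⟨2 * b + e + 2, by omega, fun N hN y hy => ?_⟩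
  have key : ∀ j, 3 * N + (2 * b + e + 2) ≤ j →
      κ.real {k | ‖ucoord (y.act (k : groupH B))‖ ≤ qR F ^ (-j)}
        = qR F * κ.real {k | ‖ucoord (y.act (k : groupH B))‖ ≤ qR F ^ (-(j + 1))} := by
    intro j hj
    have := measure_ball_eq hF hB hBdet κ (fun i j => hb (i, j)) hb0 he0 (he ()) hN hy hj
    rw [measureReal_def, this, ENNReal.toReal_mul]
    simp [measureReal_def]
  have hq := (qR_pos (F := F)).ne'
  constructor
  · intro j hj
    rw [levelMass_eq_sub hF, levelMass_eq_sub hF, key j hj, key (j + 1) (by omega)]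
    field_simp
  · set J := 3 * N + (2 * b + e + 2)
    have hpow : ∀ m : ℕ, κ.real {k | ‖ucoord (y.act (k : groupH B))‖ ≤ qR F ^ (-(J + m))}
        ≤ ((qR F)⁻¹) ^ m := by
      intro m
      induction m with
      | zero => simp
      | succ m ih =>
        have h := key (J + m) (by omega)
        rw [show J + ((m + 1 : ℕ) : ℤ) = J + m + 1 by push_cast; ring, pow_succ]
        rw [h] at ih
        rw [← div_eq_mul_inv, le_div_iff₀ qR_pos, mul_comm]
        exact ih
    have h0 : κ.real {k | ucoord (y.act (k : groupH B)) = 0} ≤ 0 := by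
      refine ge_of_tendsto' (tendsto_pow_atTop_nhds_zero_of_lt_one (inv_pos.mpr qR_pos).le
        (inv_lt_one_of_one_lt₀ (one_lt_qR (F := F)))) fun m => le_trans (measureReal_mono ?_) (hpow m)
      intro k hk
      rw [Set.mem_ofPred_eq] at hk ⊢
      rw [hk, norm_zero]
      exact (qR_zpow_pos _).le
    have h1 := le_antisymm h0 measureReal_nonneg
    rwa [measureReal_eq_zero_iff] at h1

end Levels

/-! ### Averaging over the maximal compact group -/

section Fubini

variable {F : Type*} [NontriviallyNormedField F] [IsUltrametricDist F] [ProperSpace F]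
  [MeasurableSpace F] [BorelSpace F] {n : ℕ} {B : Matrix (Fin n) (Fin n) F}

theorem measurable_ucoord : Measurable (ucoord (B := B)) := continuous_ucoord.measurable

/-- Expanding the action into a finite sum of products of functions of one variable gives
measurability for the product σ-algebra directly, without any continuity on the product. -/
theorem measurable_ucoord_act :
    Measurable fun p : ThetaQuot B × groupK B => ucoord (p.1.act (p.2 : groupH B)) := by
  have h : (fun p : ThetaQuot B × groupK B => ucoord (p.1.act (p.2 : groupH B)))
      = fun p => ∑ j, vec p.1 j * (((p.2 : groupH B) : GL (Idx n) F) : Matrix (Idx n) (Idx n) F) j (.inr 0) := by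
    ext p
    rw [ucoord, vec_act, rowAct_apply]
  rw [h]
  refine Finset.measurable_sum _ fun j _ => Measurable.mul ?_ ?_
  · exact ((continuous_apply j).comp continuous_vec).measurable.comp measurable_fst
  · have : Continuous fun k : groupK B => (((k : groupH B) : GL (Idx n) F) : Matrix (Idx n) (Idx n) F) j (.inr 0) :=
      (continuous_apply_apply j (Sum.inr 0)).comp (continuous_coe_groupH.comp continuous_subtype_val)
    exact this.measurable.comp measurable_snd

theorem measurable_measure_act (κ : Measure (groupK B)) [IsProbabilityMeasure κ] {S : Set F}
    (hS : MeasurableSet S) :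
    Measurable fun y : ThetaQuot B => κ {k | ucoord (y.act (k : groupH B)) ∈ S} :=
  measurable_measure_prodMk_left (measurable_ucoord_act hS)

theorem measurable_levelMass (κ : Measure (groupK B)) [IsProbabilityMeasure κ] (l : ℤ) :
    Measurable fun y : ThetaQuot B => levelMass κ y l :=
  (measurable_measure_act κ (S := {x | ‖x‖ = qR F ^ (-l)})
    (isClosed_eq continuous_norm continuous_const).measurableSet).ennreal_toReal

/-- Exchange the two integrations. For fixed k, invariance of `μ` and stability of the ball under
K^H make the inner measure independent of k, and `κ` has total mass 1. -/
theorem lintegral_measure_act [CharZero F] (hB : B.IsSymm) (hBdet : IsUnit B.det)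
    {μ : Measure (ThetaQuot B)} [IsFiniteMeasureOnCompacts μ]
    (hμ : ∀ h : groupH B, μ.map (fun y => y.act h) = μ)
    (κ : Measure (groupK B)) [IsProbabilityMeasure κ] {S : Set F}
    (hS : MeasurableSet S) (i : ℤ) :
    ∫⁻ y in ballSet B i, κ {k | ucoord (y.act (k : groupH B)) ∈ S} ∂μ
      = μ (ballSet B i ∩ ucoord ⁻¹' S) := by
  have : IsFiniteMeasure (μ.restrict (ballSet B i)) :=
    ⟨by rw [Measure.restrict_apply_univ]; exact measure_ballSet_lt_top hB hBdet μ i⟩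
  have hE := measurable_ucoord_act (B := B) hS
  have h1 := Measure.prod_apply (μ := μ.restrict (ballSet B i)) (ν := κ) hE
  have h2 := Measure.prod_apply_symm (μ := μ.restrict (ballSet B i)) (ν := κ) hE
  refine h1.symm.trans (h2.trans ?_)
  have h3 : ∀ k : groupK B, (μ.restrict (ballSet B i)) ((fun y => (y, k)) ⁻¹'
      ((fun p : ThetaQuot B × groupK B => ucoord (p.1.act (p.2 : groupH B))) ⁻¹' S))
      = μ (ballSet B i ∩ ucoord ⁻¹' S) := by
    intro k
    rw [← measure_preimage_act hμ (k : groupH B)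
      ((isClosed_ballSet i).measurableSet.inter (measurable_ucoord hS)),
      Measure.restrict_apply' (isClosed_ballSet i).measurableSet]
    congr 1
    ext y
    simp only [Set.mem_inter_iff, Set.mem_preimage, act_mem_ballSet_iff k.2]
    exact and_comm
  simp only [h3, lintegral_const, measure_univ, mul_one]

theorem measure_ucoord_eq_zero [CharZero F] (hF : IsNormalizedNorm F) (hB : B.IsSymm) (hBdet : IsUnit B.det)
    {μ : Measure (ThetaQuot B)} [IsFiniteMeasureOnCompacts μ]
    (hμ : ∀ h : groupH B, μ.map (fun y => y.act h) = μ)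
    (κ : Measure (groupK B)) [IsProbabilityMeasure κ] [κ.IsMulLeftInvariant] :
    μ {y | ucoord y = 0} = 0 := by
  obtain ⟨c0, -, hc⟩ := exists_stable hF hB hBdet κ
  have h1 : ∀ i : ℕ, μ (ballSet B i ∩ ucoord ⁻¹' {0}) = 0 := by
    intro i
    rw [← lintegral_measure_act hB hBdet hμ κ (measurableSet_singleton 0)]
    refine setLIntegral_eq_zero (isClosed_ballSet _).measurableSet fun y hy => ?_
    exact (hc i (by positivity) y hy).2
  have h2 : {y : ThetaQuot B | ucoord y = 0} = ⋃ i : ℕ, ballSet B i ∩ ucoord ⁻¹' {0} := by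
    rw [← Set.iUnion_inter, iUnion_ballSet, Set.univ_inter]; rfl
  rw [h2]
  exact measure_iUnion_null h1

/-- The measure of the part of a ball where the `x'`-coordinate has size `q ^ (-l)`. -/
def ballMass (μ : Measure (ThetaQuot B)) (i l : ℤ) : ℝ :=
  μ.real (ballSet B i ∩ {y | ‖ucoord y‖ = qR F ^ (-l)})

theorem integrableOn_levelMass [CharZero F] (hB : B.IsSymm) (hBdet : IsUnit B.det)
    {μ : Measure (ThetaQuot B)} [IsFiniteMeasureOnCompacts μ]
    (κ : Measure (groupK B)) [IsProbabilityMeasure κ] (i l : ℤ) :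
    IntegrableOn (fun y => levelMass κ y l) (ballSet B i) μ := by
  refine Measure.integrableOn_of_bounded (M := 1) (measure_ballSet_lt_top hB hBdet μ i).ne
    (measurable_levelMass κ l).aestronglyMeasurable (Filter.Eventually.of_forall fun y => ?_)
  rw [Real.norm_of_nonneg (levelMass_nonneg κ y l)]
  exact levelMass_le_one κ y l

theorem setIntegral_levelMass [CharZero F] (hB : B.IsSymm) (hBdet : IsUnit B.det)
    {μ : Measure (ThetaQuot B)} [IsFiniteMeasureOnCompacts μ]
    (hμ : ∀ h : groupH B, μ.map (fun y => y.act h) = μ)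
    (κ : Measure (groupK B)) [IsProbabilityMeasure κ] (i l : ℤ) :
    ∫ y in ballSet B i, levelMass κ y l ∂μ = ballMass μ i l := by
  have hS : MeasurableSet {x : F | ‖x‖ = qR F ^ (-l)} :=
    (isClosed_eq continuous_norm continuous_const).measurableSet
  have h := lintegral_measure_act hB hBdet hμ κ hS i
  rw [integral_eq_lintegral_of_nonneg_ae (Filter.Eventually.of_forall fun y => levelMass_nonneg κ y l)
    (measurable_levelMass κ l).aestronglyMeasurable, ballMass, measureReal_def]
  congr 1
  refine Eq.trans (lintegral_congr fun y => ?_) h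
  rw [levelMass, measureReal_def, ENNReal.ofReal_toReal (measure_ne_top _ _)]
  rfl

end Fubini

/-! ### The invariant measure in the chart given by the open orbit of the parabolic subgroup -/

section Scaling

variable {F : Type*} [NontriviallyNormedField F] [IsUltrametricDist F] [ProperSpace F]
  [MeasurableSpace F] [BorelSpace F] {n : ℕ}

variable (F n) in
/-- The Haar measure on `F ^ n`. -/
abbrev volN : Measure (Fin n → F) := Measure.addHaar

theorem isClosed_smallLattice (m : ℤ) : IsClosed (smallLattice F n m : Set (Fin n → F)) := by
  have : (smallLattice F n m : Set (Fin n → F)) = Metric.closedBall 0 (qR F ^ m) := by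
    ext a
    rw [mem_closedBall_zero_iff, pi_norm_le_iff_of_nonneg (qR_zpow_pos _).le]
    rfl
  rw [this]
  exact Metric.isClosed_closedBall

/-- The larger lattice is the disjoint union of translates of the smaller one indexed by n-tuples of
residue representatives. -/
theorem volN_smallLattice_succ (hF : IsNormalizedNorm F) (m : ℤ) :
    volN F n (smallLattice F n (m + 1)) = (residueCard F : ENNReal) ^ n * volN F n (smallLattice F n m) := by
  classical
  obtain ⟨T, hT1, hT2, hT3, hT4⟩ := exists_residue_system hF
  obtain ⟨t, ht⟩ := exists_norm_eq hF (m + 1)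
  have hq : qR F ^ m = ‖(t : F)‖ * (qR F)⁻¹ := by
    rw [ht, ← _root_.zpow_neg_one, ← zpow_add₀ (qR_pos (F := F)).ne']; congr 1; ring
  have hunion : (smallLattice F n (m + 1) : Set (Fin n → F)) =
      ⋃ w ∈ Fintype.piFinset fun _ : Fin n => T,
        (fun a => a - (t : F) • w) ⁻¹' (smallLattice F n m : Set (Fin n → F)) := by
    ext a
    simp only [Set.mem_iUnion, exists_prop, Fintype.mem_piFinset]
    constructor
    · intro ha
      have h1 : ∀ i, ∃ c ∈ T, ‖(t : F)⁻¹ * a i - c‖ ≤ (residueCard F : ℝ)⁻¹ := fun i => hT3 _ (by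
        rw [norm_mul, norm_inv, ht, inv_mul_le_iff₀ (qR_zpow_pos _), mul_one]; exact ha i)
      choose w hw hw' using h1
      refine ⟨w, hw, fun i => ?_⟩
      have : a i - t * w i = t * ((t : F)⁻¹ * a i - w i) := by
        have := t.ne_zero
        field_simp
      change ‖a i - t * w i‖ ≤ _
      rw [this, norm_mul, hq]
      exact mul_le_mul_of_nonneg_left (hw' i) (norm_nonneg _)
    · rintro ⟨w, hw, ha⟩ i
      have h1 : ‖(t : F) * w i‖ ≤ qR F ^ (m + 1) := by
        rw [norm_mul, ht]
        exact mul_le_of_le_one_right (qR_zpow_pos _).le (hT2 _ (hw i))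
      have h2 := norm_add_le_of_le' (norm_le_zpow_of_le (ha i) (by omega)) h1
      simpa using h2
  rw [hunion, measure_biUnion_finset]
  · rw [Finset.sum_congr rfl (g := fun _ => volN F n (smallLattice F n m))]
    · rw [Finset.sum_const, Fintype.card_piFinset, nsmul_eq_mul]
      simp [hT1]
    · intro w _
      simp only [sub_eq_add_neg]
      exact measure_preimage_add_right _ _ _
  · intro w hw w' hw' hne
    rw [Finset.mem_coe, Fintype.mem_piFinset] at hw hw'
    refine Set.disjoint_left.mpr fun a ha ha' => hne (funext fun i => hT4 _ (hw i) _ (hw' i) ?_)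
    have := norm_sub_le_of_le' (ha' i) (ha i)
    have e : (a - (t : F) • w') i - (a - (t : F) • w) i = t * (w i - w' i) := by
      simp only [Pi.sub_apply, Pi.smul_apply, smul_eq_mul]; ring
    rw [e, norm_mul, hq] at this
    exact le_of_mul_le_mul_left this (norm_pos_iff.mpr t.ne_zero)
  · intro w _
    exact (isClosed_smallLattice m).measurableSet.preimage (measurable_id.sub_const _)

theorem volN_smallLattice_ne_top (m : ℤ) : volN F n (smallLattice F n m) ≠ ⊤ := by
  have : (smallLattice F n m : Set (Fin n → F)) = Metric.closedBall 0 (qR F ^ m) := by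
    ext a
    rw [mem_closedBall_zero_iff, pi_norm_le_iff_of_nonneg (qR_zpow_pos _).le]
    rfl
  rw [this]
  exact (isCompact_closedBall _ _).measure_lt_top.ne

theorem volN_smallLattice_ne_zero (m : ℤ) : volN F n (smallLattice F n m) ≠ 0 := by
  have : (smallLattice F n m : Set (Fin n → F)) = Metric.closedBall 0 (qR F ^ m) := by
    ext a
    rw [mem_closedBall_zero_iff, pi_norm_le_iff_of_nonneg (qR_zpow_pos _).le]
    rfl
  rw [this]
  exact (Metric.measure_closedBall_pos _ _ (qR_zpow_pos _)).ne'

theorem volN_smallLattice_real (hF : IsNormalizedNorm F) (m : ℤ) :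
    (volN F n).real (smallLattice F n m) = qR F ^ (n * m) * (volN F n).real (smallLattice F n 0) := by
  have hs : ∀ m, (volN F n).real (smallLattice F n (m + 1)) = qR F ^ (n : ℤ) * (volN F n).real (smallLattice F n m) := by
    intro m
    rw [measureReal_def, volN_smallLattice_succ hF, ENNReal.toReal_mul]
    simp [measureReal_def]
  have hq := (qR_pos (F := F)).ne'
  induction m using Int.induction_on with
  | zero => simp
  | succ m ih => rw [hs, ih, ← mul_assoc, ← zpow_add₀ hq]; congr 2; ring
  | pred m ih =>
    have h := hs (-(m : ℤ) - 1)
    rw [sub_add_cancel, ih] at h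
    rw [← mul_right_inj' (zpow_ne_zero (n : ℤ) hq), ← h, ← mul_assoc, ← zpow_add₀ hq]
    congr 2; ring

-- The modulus of a scaling does not depend on the set, so it is read off from the unit lattice.
open scoped Pointwise in
theorem volN_smul (hF : IsNormalizedNorm F) {t : Fˣ} {m : ℤ} (ht : ‖(t : F)‖ = qR F ^ m)
    (A : Set (Fin n → F)) :
    volN F n ((fun a => (t : F) • a) ⁻¹' A) = ENNReal.ofReal (qR F ^ (-(n * m))) * volN F n A := by
  have h1 : ∀ (s : Fˣ) (A : Set (Fin n → F)), (fun a => (s : F) • a) ⁻¹' A = s⁻¹ • A := by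
    intro s A
    ext a
    rw [Set.mem_inv_smul_set_iff]; rfl
  have h2 : t⁻¹ • (smallLattice F n 0 : Set (Fin n → F)) = smallLattice F n (-m) := by
    rw [← h1]
    ext a
    refine forall_congr' fun i => ?_
    change ‖(t : F) * a i‖ ≤ _ ↔ _
    rw [norm_mul, ht, _root_.zpow_neg, zpow_zero,
      ← one_div, le_div_iff₀' (qR_zpow_pos _)]
  have h3 : volN F n (t⁻¹ • (smallLattice F n 0 : Set (Fin n → F)))
      = (Real.toNNReal (qR F ^ (-(n * m))) : NNReal) * volN F n (smallLattice F n 0) := by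
    rw [h2, ← ENNReal.ofReal_toReal (volN_smallLattice_ne_top (F := F) (n := n) (-m)),
      ← ENNReal.ofReal_toReal (volN_smallLattice_ne_top (F := F) (n := n) 0)]
    have := volN_smallLattice_real (n := n) hF (-m)
    rw [measureReal_def, measureReal_def] at this
    rw [this, ENNReal.ofReal_mul (qR_zpow_pos _).le]
    congr 2
    rw [mul_neg]
  have h4 := distribHaarChar_eq_of_measure_smul_eq_mul (μ := volN F n) (volN_smallLattice_ne_zero 0)
    (volN_smallLattice_ne_top 0) h3
  rw [h1, ← distribHaarChar_mul (volN F n) t⁻¹ A, h4]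
  rfl

end Scaling

/-! ### The invariant measure on the shells of constant |u| -/

section Chart

variable {F : Type*} [NontriviallyNormedField F] [IsUltrametricDist F] [ProperSpace F]
  [MeasurableSpace F] [BorelSpace F] {n : ℕ} {B : Matrix (Fin n) (Fin n) F}

theorem measurable_acoord : Measurable (acoord (B := B)) := continuous_acoord.measurable

theorem measurableSet_norm_eq (r : ℝ) : MeasurableSet {y : ThetaQuot B | ‖ucoord y‖ = r} :=
  (isClosed_eq continuous_ucoord.norm continuous_const).measurableSet

/-- The fibre coordinate of the chart. -/
def slope (y : ThetaQuot B) : Fin n → F := (ucoord y)⁻¹ • acoord y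

theorem measurable_slope : Measurable (slope (B := B)) :=
  measurable_ucoord.inv.smul measurable_acoord

theorem vcoord_eq [CharZero F] {y : ThetaQuot B} (hy : ucoord y ≠ 0) :
    vcoord y = (1 - acoord y ⬝ᵥ B *ᵥ acoord y) / (2 * ucoord y) := by
  rw [eq_div_iff (mul_ne_zero two_ne_zero hy), ← coord_eq y]
  ring

/-- The distribution of the fibre coordinate on a part of the unit shell. -/
def slopeMeasure (μ : Measure (ThetaQuot B)) (t : Set F) : Measure (Fin n → F) :=
  (μ.restrict ({y | ‖ucoord y‖ = 1} ∩ ucoord ⁻¹' t)).map slope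

theorem slopeMeasure_apply (μ : Measure (ThetaQuot B)) {t : Set F} (ht : MeasurableSet t)
    {s : Set (Fin n → F)} (hs : MeasurableSet s) :
    slopeMeasure μ t s = μ (slope ⁻¹' s ∩ ({y | ‖ucoord y‖ = 1} ∩ ucoord ⁻¹' t)) := by
  rw [slopeMeasure, Measure.map_apply measurable_slope hs, Measure.restrict_apply' ((measurableSet_norm_eq _).inter (measurable_ucoord ht))]

theorem slope_act_unipotent {g : groupH B} {b : Fin n → F} {y : ThetaQuot B}
    (hg : acoord (y.act g) = acoord y + ucoord y • b ∧ ucoord (y.act g) = ucoord y)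
    (hy : ucoord y ≠ 0) : slope (y.act g) = b + slope y := by
  rw [slope, slope, hg.1, hg.2, smul_add, smul_smul, inv_mul_cancel₀ hy, one_smul, add_comm]

/-- A unipotent element of Q moves a by ub, which varies with u, but moves a/u by the constant `b`.
That is why the fibre coordinate is a/u; u is fixed, so one may restrict to any set `t` of values of
u. -/
theorem slopeMeasure_invariant [CharZero F] (hB : B.IsSymm) (hBdet : IsUnit B.det)
    {μ : Measure (ThetaQuot B)} (hμ : ∀ h : groupH B, μ.map (fun y => y.act h) = μ)
    {t : Set F} (ht : MeasurableSet t) : (slopeMeasure μ t).IsAddLeftInvariant := by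
  constructor
  intro b
  ext s hs
  rw [Measure.map_apply (measurable_const_add b) hs, slopeMeasure_apply μ ht hs,
    slopeMeasure_apply μ ht (measurable_const_add b hs)]
  obtain ⟨g, -, hg⟩ := exists_unipotent hB hBdet b
  rw [← measure_preimage_act hμ g ((measurable_slope hs).inter ((measurableSet_norm_eq _).inter (measurable_ucoord ht)))]
  congr 1
  ext y
  simp only [Set.mem_inter_iff, Set.mem_preimage, Set.mem_ofPred_eq, (hg y).2]
  refine and_congr_left fun h => ?_
  rw [slope_act_unipotent (hg y) (by rintro h0; simp [h0] at h)]

/-- On the unit shell v = (1 - B(a))/(2u), so v is bounded along with a. This transfers the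
finiteness of balls to the fibre measures. -/
theorem norm_slope_le [CharZero F] (hb : ∃ b : ℤ, 0 ≤ b ∧ ∀ i j, ‖B i j‖ ≤ qR F ^ b) (m : ℤ) :
    ∃ N : ℤ, ∀ y : ThetaQuot B, ‖ucoord y‖ = 1 → slope y ∈ smallLattice F n m → y ∈ ballSet B N := by
  obtain ⟨b, hb0, hb⟩ := hb
  obtain ⟨e, he0, he⟩ := exists_norm_le_zpow F (fun _ : Unit => (2 : F)⁻¹)
  refine ⟨2 * max m 0 + b + e, fun y hy hs => ?_⟩
  have hu : ucoord y ≠ 0 := by rintro h0; simp [h0] at hy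
  have ha : ∀ j, ‖acoord y j‖ ≤ qR F ^ (max m 0) := by
    intro j
    have h1 := hs j
    rw [slope, Pi.smul_apply, smul_eq_mul, norm_mul, norm_inv, hy, inv_one, one_mul] at h1
    exact norm_le_zpow_of_le h1 (le_max_left _ _)
  refine mem_ballSet_iff.mpr ⟨fun j => norm_le_zpow_of_le (ha j) (by omega), ?_, ?_⟩
  · rw [hy, ← zpow_zero (qR F), qR_zpow_le]; omega
  · rw [vcoord_eq hu, norm_div, norm_mul, hy, mul_one, ← norm_div, div_eq_mul_inv]
    have h1 : ‖acoord y ⬝ᵥ B *ᵥ acoord y‖ ≤ qR F ^ (max m 0 + (b + max m 0)) :=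
      norm_dotProduct_le ha fun l => norm_dotProduct_le (hb l) ha
    have h2 : ‖(1 : F) - acoord y ⬝ᵥ B *ᵥ acoord y‖ ≤ qR F ^ (max m 0 + (b + max m 0)) := by
      refine norm_sub_le_of_le' ?_ h1
      rw [norm_one, ← zpow_zero (qR F), qR_zpow_le]; omega
    exact norm_le_zpow_of_le (norm_mul_le_zpow h2 (he ())) (by omega)

theorem measure_slope_lt_top [CharZero F] (hB : B.IsSymm) (hBdet : IsUnit B.det)
    (μ : Measure (ThetaQuot B)) [IsFiniteMeasureOnCompacts μ] (m : ℤ) :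
    μ (slope ⁻¹' (smallLattice F n m) ∩ {y | ‖ucoord y‖ = 1}) < ⊤ := by
  obtain ⟨b, hb0, hb⟩ := exists_norm_le_zpow F (fun p : Fin n × Fin n => B p.1 p.2)
  obtain ⟨N, hN⟩ := norm_slope_le ⟨b, hb0, fun i j => hb (i, j)⟩ m
  exact lt_of_le_of_lt (measure_mono fun y hy => hN y hy.2 hy.1) (measure_ballSet_lt_top hB hBdet μ N)

theorem slopeMeasure_eq [CharZero F] (hB : B.IsSymm) (hBdet : IsUnit B.det)
    {μ : Measure (ThetaQuot B)} [IsFiniteMeasureOnCompacts μ]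
    (hμ : ∀ h : groupH B, μ.map (fun y => y.act h) = μ)
    {t : Set F} (ht : MeasurableSet t) (s : Set (Fin n → F)) :
    slopeMeasure μ t s = slopeMeasure μ t (smallLattice F n 0) / volN F n (smallLattice F n 0) * volN F n s := by
  have hinv := slopeMeasure_invariant hB hBdet hμ ht
  have hfin : IsFiniteMeasureOnCompacts (slopeMeasure μ t) := by
    constructor
    intro K hK
    obtain ⟨R, hR⟩ := hK.isBounded.exists_norm_le
    obtain ⟨m, hm⟩ := pow_unbounded_of_one_lt R (one_lt_qR (F := F))
    have hKm : K ⊆ smallLattice F n m := fun a ha i => by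
      rw [zpow_natCast]
      exact (norm_le_pi_norm a i).trans ((hR a ha).trans hm.le)
    refine lt_of_le_of_lt (measure_mono hKm) ?_
    rw [slopeMeasure_apply μ ht (isClosed_smallLattice _).measurableSet]
    refine lt_of_le_of_lt (measure_mono ?_) (measure_slope_lt_top hB hBdet μ m)
    exact fun y hy => ⟨hy.1, hy.2.1⟩
  have h := Measure.isAddLeftInvariant_eq_smul (slopeMeasure μ t) (volN F n)
  have h0 := congrArg (fun ν : Measure (Fin n → F) => ν (smallLattice F n 0)) h
  have h1 := congrArg (fun ν : Measure (Fin n → F) => ν s) h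
  simp only [Measure.smul_apply, ENNReal.smul_def, smul_eq_mul] at h0 h1
  rw [h0, h1, ENNReal.mul_div_cancel_right (volN_smallLattice_ne_zero 0) (volN_smallLattice_ne_top 0)]

/-- Uniqueness of Haar measure makes the joint distribution of (a/u, u) a product of Haar measure
with a finite measure in u. Passing from a/u back to a scales each fibre by a unit, which preserves
Haar measure. -/
theorem measure_unit_shell [CharZero F] (hF : IsNormalizedNorm F) (hB : B.IsSymm) (hBdet : IsUnit B.det)
    {μ : Measure (ThetaQuot B)} [IsFiniteMeasureOnCompacts μ]
    (hμ : ∀ h : groupH B, μ.map (fun y => y.act h) = μ)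
    {A : Set (Fin n → F)} (hA : MeasurableSet A) :
    μ ({y | ‖ucoord y‖ = 1} ∩ acoord ⁻¹' A)
      = μ ({y | ‖ucoord y‖ = 1} ∩ acoord ⁻¹' (smallLattice F n 0))
        / volN F n (smallLattice F n 0) * volN F n A := by
  let L : Set (Fin n → F) := (smallLattice F n 0 : Set (Fin n → F))
  have hL : MeasurableSet L := (isClosed_smallLattice 0).measurableSet
  have hL0 := volN_smallLattice_ne_zero (F := F) (n := n) 0
  have hLt := volN_smallLattice_ne_top (F := F) (n := n) 0
  let E : Set (ThetaQuot B) := {y | ‖ucoord y‖ = 1}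
  have hE : MeasurableSet E := measurableSet_norm_eq 1
  let ρ : Measure ((Fin n → F) × F) := (μ.restrict E).map fun y => (slope y, ucoord y)
  let c : Measure F := (volN F n L)⁻¹ • (μ.restrict (slope ⁻¹' L ∩ E)).map ucoord
  have hpair : Measurable fun y : ThetaQuot B => (slope y, ucoord y) := measurable_slope.prodMk measurable_ucoord
  have hfin : IsFiniteMeasure ((μ.restrict (slope ⁻¹' L ∩ E)).map ucoord) := by
    constructor
    rw [Measure.map_apply measurable_ucoord MeasurableSet.univ, Set.preimage_univ, Measure.restrict_apply_univ]
    exact measure_slope_lt_top hB hBdet μ 0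
  have hc : ∀ t, MeasurableSet t → c t = slopeMeasure μ t L / volN F n L := by
    intro t ht
    rw [Measure.smul_apply, smul_eq_mul, Measure.map_apply measurable_ucoord ht, Measure.restrict_apply (measurable_ucoord ht),
      slopeMeasure_apply μ ht hL, ENNReal.div_eq_inv_mul]
    congr 2
    ext y
    simp only [Set.mem_inter_iff]
    tauto
  have hcfin : IsFiniteMeasure c := by
    constructor
    rw [Measure.smul_apply, smul_eq_mul]
    exact ENNReal.mul_lt_top (ENNReal.inv_lt_top.mpr (pos_iff_ne_zero.mpr hL0)) (measure_lt_top _ _)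
  -- It suffices to compare rectangles, where the claim is `slopeMeasure_eq`.
  have hρ : (volN F n).prod c = ρ := by
    refine Measure.prod_eq fun s t hs ht => ?_
    rw [Measure.map_apply hpair (hs.prod ht), Measure.restrict_apply (hpair (hs.prod ht)), hc t ht, mul_comm,
      ← slopeMeasure_eq hB hBdet hμ ht s, slopeMeasure_apply μ ht hs]
    congr 1
    ext y
    simp only [Set.mem_inter_iff, Set.mem_preimage, Set.mem_prod]
    tauto
  have hS : MeasurableSet {p : (Fin n → F) × F | p.2 • p.1 ∈ A} :=
    (measurable_snd.smul measurable_fst) hA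
  have h1 : μ (E ∩ acoord ⁻¹' A) = ρ {p | p.2 • p.1 ∈ A} := by
    rw [Measure.map_apply hpair hS, Measure.restrict_apply (hpair hS)]
    congr 1
    ext y
    simp only [Set.mem_inter_iff, Set.mem_preimage, Set.mem_ofPred_eq]
    rw [and_comm]
    refine and_congr_left fun h => ?_
    have hu : ucoord y ≠ 0 := by
      rintro h0
      have h' : ‖ucoord y‖ = 1 := h
      simp [h0] at h'
    rw [slope, smul_smul, mul_inv_cancel₀ hu, one_smul]
  have hae : ∀ᵐ u ∂c, volN F n ((fun a => (a, u)) ⁻¹' {p : (Fin n → F) × F | p.2 • p.1 ∈ A}) = volN F n A := by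
    have hT : MeasurableSet {u : F | ‖u‖ = 1} := (isClosed_eq continuous_norm continuous_const).measurableSet
    have : ∀ᵐ u ∂c, ‖u‖ = 1 := by
      rw [ae_iff, show {a : F | ¬‖a‖ = 1} = {u : F | ‖u‖ = 1}ᶜ from rfl, hc _ hT.compl,
        slopeMeasure_apply μ hT.compl hL]
      have : (slope ⁻¹' L ∩ ({y : ThetaQuot B | ‖ucoord y‖ = 1} ∩ ucoord ⁻¹' {u : F | ‖u‖ = 1}ᶜ)) = ∅ := by
        ext y
        simp
      rw [this, measure_empty, ENNReal.zero_div]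
    filter_upwards [this] with u hu
    have hu0 : u ≠ 0 := by rintro rfl; simp at hu
    have := volN_smul (n := n) hF (t := Units.mk0 u hu0) (m := 0) (by simpa using hu) A
    simp only [Units.val_mk0, mul_zero, neg_zero, zpow_zero, ENNReal.ofReal_one, one_mul] at this
    exact this
  have h2 : ρ {p | p.2 • p.1 ∈ A} = volN F n A * c Set.univ := by
    rw [← hρ, Measure.prod_apply_symm hS, lintegral_congr_ae hae, lintegral_const]
  have h3 : E ∩ acoord ⁻¹' L = slope ⁻¹' L ∩ (E ∩ ucoord ⁻¹' Set.univ) := by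
    ext y
    simp only [Set.mem_inter_iff, Set.mem_preimage, Set.mem_univ, and_true]
    rw [and_comm]
    refine and_congr_left fun h => forall_congr' fun i => ?_
    have h' : ‖ucoord y‖ = 1 := h
    rw [slope, Pi.smul_apply, smul_eq_mul, norm_mul, norm_inv, h', inv_one, one_mul]
  change μ (E ∩ acoord ⁻¹' A) = μ (E ∩ acoord ⁻¹' L) / volN F n L * volN F n A
  rw [h1, h2, hc _ MeasurableSet.univ, slopeMeasure_apply μ MeasurableSet.univ hL, h3, mul_comm]

/-- A torus element with |t| = q^(-l) carries the unit shell onto this shell and leaves a alone, so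
the constant is the same for all `l`. -/
theorem measure_shell [CharZero F] (hF : IsNormalizedNorm F) (hB : B.IsSymm) (hBdet : IsUnit B.det)
    {μ : Measure (ThetaQuot B)} [IsFiniteMeasureOnCompacts μ]
    (hμ : ∀ h : groupH B, μ.map (fun y => y.act h) = μ)
    {A : Set (Fin n → F)} (hA : MeasurableSet A) (l : ℤ) :
    μ ({y | ‖ucoord y‖ = qR F ^ (-l)} ∩ acoord ⁻¹' A)
      = μ ({y | ‖ucoord y‖ = 1} ∩ acoord ⁻¹' (smallLattice F n 0))
        / volN F n (smallLattice F n 0) * volN F n A := by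
  rw [← measure_unit_shell hF hB hBdet hμ hA]
  obtain ⟨t, ht⟩ := exists_norm_eq hF (-l)
  obtain ⟨g, -, hg⟩ := exists_torus hB hBdet t
  rw [← measure_preimage_act hμ g ((measurableSet_norm_eq _).inter (measurable_acoord hA))]
  congr 1
  ext y
  simp only [Set.mem_inter_iff, Set.mem_preimage, Set.mem_ofPred_eq, (hg y).1, (hg y).2, norm_mul, ht]
  refine and_congr_left fun _ => ?_
  rw [mul_eq_left₀ (qR_zpow_pos _).ne']

/-- The normalizing constant of the invariant measure. -/
def chartConst (μ : Measure (ThetaQuot B)) : ℝ :=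
  μ.real ({y | ‖ucoord y‖ = 1} ∩ acoord ⁻¹' (smallLattice F n 0))

theorem chartSet_lt_top [CharZero F] (hB : B.IsSymm) (hBdet : IsUnit B.det)
    (μ : Measure (ThetaQuot B)) [IsFiniteMeasureOnCompacts μ] :
    μ ({y | ‖ucoord y‖ = 1} ∩ acoord ⁻¹' (smallLattice F n 0)) < ⊤ := by
  refine lt_of_le_of_lt (measure_mono ?_) (measure_slope_lt_top hB hBdet μ 0)
  intro y hy
  refine ⟨fun i => ?_, hy.1⟩
  have h' : ‖ucoord y‖ = 1 := hy.1
  rw [slope, Pi.smul_apply, smul_eq_mul, norm_mul, norm_inv, h', inv_one, one_mul]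
  exact hy.2 i

/-- If the constant vanished, all shells would be null; together with the null set u = 0 these
countably many sets cover the space. -/
theorem chartConst_pos [CharZero F] (hF : IsNormalizedNorm F) (hB : B.IsSymm) (hBdet : IsUnit B.det)
    {μ : Measure (ThetaQuot B)} [IsFiniteMeasureOnCompacts μ] (hμ0 : μ ≠ 0)
    (hμ : ∀ h : groupH B, μ.map (fun y => y.act h) = μ) (h0 : μ {y | ucoord y = 0} = 0) :
    0 < chartConst μ := by
  refine lt_of_le_of_ne measureReal_nonneg fun h => hμ0 ?_
  have h1 : μ ({y | ‖ucoord y‖ = 1} ∩ acoord ⁻¹' (smallLattice F n 0)) = 0 := by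
    rw [chartConst, eq_comm, measureReal_eq_zero_iff (chartSet_lt_top hB hBdet μ).ne] at h
    exact h
  have h2 : ∀ l : ℤ, μ {y : ThetaQuot B | ‖ucoord y‖ = qR F ^ (-l)} = 0 := by
    intro l
    have := measure_shell hF hB hBdet hμ MeasurableSet.univ l
    rwa [h1, ENNReal.zero_div, zero_mul, Set.preimage_univ, Set.inter_univ] at this
  rw [← Measure.measure_univ_eq_zero]
  refine measure_mono_null (t := {y | ucoord y = 0} ∪ ⋃ l : ℤ, {y : ThetaQuot B | ‖ucoord y‖ = qR F ^ (-l)}) ?_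
    (measure_union_null h0 (measure_iUnion_null h2))
  intro y _
  by_cases hy : ucoord y = 0
  · exact Or.inl hy
  · exact Or.inr (Set.mem_iUnion.mpr ⟨_, norm_eq_ord hF hy⟩)

end Chart

/-! ### Masses of shells in a ball as coefficients of X -/

section BallMass

variable {F : Type*} [NontriviallyNormedField F] [IsUltrametricDist F] [ProperSpace F]
  [MeasurableSpace F] [BorelSpace F] {n : ℕ} {B : Matrix (Fin n) (Fin n) F}

/-- The coefficients `X_l(ρ)`, extended by zero to negative `l`. -/
def xCoeffInt (B : Matrix (Fin n) (Fin n) F) (ρ : F) (l : ℤ) : ℝ :=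
  if 0 ≤ l then XCoeff B l.toNat ρ else 0

theorem continuous_quadratic (B : Matrix (Fin n) (Fin n) F) :
    Continuous fun a : Fin n → F => a ⬝ᵥ B *ᵥ a :=
  continuous_id.dotProduct (continuous_const.matrix_mulVec continuous_id)

/-- The bound on a says that ta is integral. By the quadric equation (B(ta) - t²)/2 = -t²uv, of size
q^(-2i-l)|v|, so |v| ≤ q^i becomes the congruence modulo the power l + i. The bound on u reads l + i
≥ 0; when it fails, both sides vanish. The scaling a → ta contributes q^(ni). -/
theorem ballMass_eq [CharZero F] (hF : IsNormalizedNorm F) (hB : B.IsSymm) (hBdet : IsUnit B.det)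
    {μ : Measure (ThetaQuot B)} [IsFiniteMeasureOnCompacts μ]
    (hμ : ∀ h : groupH B, μ.map (fun y => y.act h) = μ) {t : Fˣ} {i : ℤ}
    (ht : ‖(t : F)‖ = qR F ^ (-i)) (l : ℤ) :
    ballMass μ i l = chartConst μ * qR F ^ (n * i) * xCoeffInt B ((t : F) ^ 2) (l + i) := by
  have hqp := qR_pos (F := F)
  rw [xCoeffInt]
  split_ifs with hl
  · let A' : Set (Fin n → F) := {a | IntegralVec a ∧
      ‖(a ⬝ᵥ B *ᵥ a - (t : F) ^ 2) / 2‖ ≤ ((residueCard F : ℝ)⁻¹) ^ (l + i).toNat}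
    have hI : {a : Fin n → F | IntegralVec a} = (smallLattice F n 0 : Set (Fin n → F)) := by
      ext a
      simp [IntegralVec, smallLattice]
    have hA' : MeasurableSet A' := by
      have h1 : MeasurableSet {a : Fin n → F | IntegralVec a} := by
        rw [hI]; exact (isClosed_smallLattice 0).measurableSet
      exact h1.inter (isClosed_le (((continuous_quadratic B).sub continuous_const).div_const 2).norm
          continuous_const).measurableSet
    have hset : ballSet B i ∩ {y | ‖ucoord y‖ = qR F ^ (-l)}
        = {y | ‖ucoord y‖ = qR F ^ (-l)} ∩ acoord ⁻¹' ((fun a => (t : F) • a) ⁻¹' A') := by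
      rw [Set.inter_comm]
      ext y
      simp only [Set.mem_inter_iff, Set.mem_ofPred_eq, Set.mem_preimage]
      refine and_congr_right fun hy => ?_
      have hu : ucoord y ≠ 0 := by
        intro h0
        rw [h0, norm_zero] at hy
        exact (qR_zpow_pos (F := F) _).ne hy
      have h2 : 0 < ‖(2 : F)‖ := norm_pos_iff.mpr two_ne_zero
      have e1 : IntegralVec ((t : F) • acoord y) ↔ ∀ j, ‖acoord y j‖ ≤ qR F ^ i := by
        refine forall_congr' fun j => ?_
        rw [Pi.smul_apply, smul_eq_mul, norm_mul, ht, _root_.zpow_neg, inv_mul_le_iff₀ (qR_zpow_pos _), mul_one]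
      have e2 : ‖ucoord y‖ ≤ qR F ^ i := by rw [hy, qR_zpow_le]; omega
      have e3 : ‖vcoord y‖ ≤ qR F ^ i ↔
          ‖(((t : F) • acoord y) ⬝ᵥ B *ᵥ ((t : F) • acoord y) - (t : F) ^ 2) / 2‖ ≤ ((residueCard F : ℝ)⁻¹) ^ (l + i).toNat := by
        have e4 : (((t : F) • acoord y) ⬝ᵥ B *ᵥ ((t : F) • acoord y) - (t : F) ^ 2) / 2
            = - ((t : F) * t * ucoord y * vcoord y) := by
          rw [vcoord_eq hu, Matrix.mulVec_smul, smul_dotProduct, dotProduct_smul, smul_eq_mul, smul_eq_mul]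
          field_simp
          ring
        have e5 : ((residueCard F : ℝ)⁻¹) ^ (l + i).toNat = qR F ^ (-i + -i + -l) * qR F ^ i := by
          rw [inv_pow, ← zpow_natCast, Int.toNat_of_nonneg hl, ← _root_.zpow_neg, ← zpow_add₀ hqp.ne']
          congr 1; ring
        rw [e4, norm_neg, norm_mul, norm_mul, norm_mul, ht, hy, e5, zpow_add₀ hqp.ne', zpow_add₀ hqp.ne',
          mul_le_mul_iff_right₀ (by positivity)]
      rw [mem_ballSet_iff, ← e1, e3]
      exact ⟨fun h => ⟨h.1, h.2.2⟩, fun h => ⟨h.1, e2, h.2⟩⟩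
    have hm : MeasurableSet ((fun a : Fin n → F => (t : F) • a) ⁻¹' A') :=
      (measurable_const_smul (t : F)) hA'
    rw [ballMass, measureReal_def, hset, measure_shell hF hB hBdet hμ hm l, volN_smul hF ht, chartConst,
      XCoeff, meas, measureReal_def, ENNReal.toReal_mul, ENNReal.toReal_div, ENNReal.toReal_mul,
      ENNReal.toReal_div, ENNReal.toReal_ofReal (qR_zpow_pos _).le]
    rw [hI, show -((n : ℤ) * -i) = n * i by ring]
    ring
  · rw [mul_zero, ballMass]
    have : ballSet B i ∩ {y | ‖ucoord y‖ = qR F ^ (-l)} = ∅ := by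
      refine Set.eq_empty_of_forall_notMem fun y hy => ?_
      have h1 := (mem_ballSet_iff.mp hy.1).2.1
      rw [Set.mem_ofPred_eq.mp hy.2, qR_zpow_le] at h1
      omega
    rw [this, measureReal_empty]

end BallMass

/-! ### Eventually geometric sequences and their generating functions -/

section Stable

/-- A sequence that vanishes far to the left and is eventually geometric with ratio `1 / q`. -/
structure IsStable (q : ℝ) (c : ℤ → ℝ) (N J : ℤ) : Prop where
  zero : ∀ j, j < -N → c j = 0
  step : ∀ j, J ≤ j → c (j + 1) = c j / q

/-- The rational function of `z` that continues the sum of `c j * z ^ j`. -/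
def stableSum (q : ℝ) (c : ℤ → ℝ) (z : ℂ) : ℂ :=
  (1 - z / q)⁻¹ * ∑' j : ℤ, ((c j - c (j - 1) / q : ℝ) : ℂ) * z ^ j

variable {q : ℝ} {c : ℤ → ℝ} {N J : ℤ}

/-- Multiplication of the generating series by 1 - z/q leaves only finitely many terms, so
`stableSum` is defined by a finite sum for every `z`, whether or not the series converges. -/
theorem IsStable.diff_eq_zero (h : IsStable q c N J) {j : ℤ} (hj : j ∉ Finset.Icc (-N) J) :
    c j - c (j - 1) / q = 0 := by
  rw [Finset.mem_Icc, not_and_or, not_le, not_le] at hj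
  rcases hj with hj | hj
  · rw [h.zero j hj, h.zero (j - 1) (by omega), zero_div, sub_zero]
  · have := h.step (j - 1) (by omega)
    rw [sub_add_cancel] at this
    rw [this, sub_self]

theorem IsStable.stableSum_eq (h : IsStable q c N J) (z : ℂ) :
    stableSum q c z = (1 - z / q)⁻¹ * ∑ j ∈ Finset.Icc (-N) J, ((c j - c (j - 1) / q : ℝ) : ℂ) * z ^ j := by
  rw [stableSum, tsum_eq_sum]
  intro j hj
  rw [h.diff_eq_zero hj, Complex.ofReal_zero, zero_mul]

theorem IsStable.apply_add (h : IsStable q c N J) (m : ℕ) : c (m + J) = c J * (q⁻¹) ^ m := by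
  induction m with
  | zero => simp
  | succ m ih =>
    rw [show ((m + 1 : ℕ) : ℤ) + J = m + J + 1 by push_cast; ring, h.step _ (by omega), ih, pow_succ]
    ring

theorem IsStable.summable (h : IsStable q c N J) {z : ℂ} (hz : z ≠ 0) (hq : 0 < q) (hzq : ‖z‖ < q) :
    Summable fun j : ℤ => (c j : ℂ) * z ^ j := by
  have hinj : Function.Injective fun m : ℕ => (m : ℤ) + J := fun a b hab => by
    have : (a : ℤ) + J = b + J := hab
    omega
  have hg : Summable fun m : ℕ => (c J : ℂ) * z ^ J * (z / q) ^ m := by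
    have h1 : ‖z / (q : ℂ)‖ < 1 := by
      rw [norm_div, Complex.norm_real, Real.norm_of_nonneg hq.le, div_lt_one hq]
      exact hzq
    have h2 : Summable fun m : ℕ => (z / (q : ℂ)) ^ m := summable_geometric_of_norm_lt_one h1
    exact h2.mul_left _
  have hg' : ∀ m : ℕ, (c (m + J) : ℂ) * z ^ ((m : ℤ) + J) = (c J : ℂ) * z ^ J * (z / q) ^ m := by
    intro m
    rw [h.apply_add, zpow_add₀ hz, zpow_natCast, div_pow]
    push_cast
    rw [inv_pow, div_eq_mul_inv]
    ring
  have h1 : Summable fun j : ℤ => Set.indicator (Set.Ici J) (fun j => (c j : ℂ) * z ^ j) j := by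
    rw [← hinj.summable_iff]
    · refine hg.congr fun m => ?_
      rw [← hg' m, Function.comp_apply, Set.indicator_of_mem]
      exact Set.mem_Ici.mpr (by omega)
    · intro j hj
      refine Set.indicator_of_notMem (fun hJ => hj ⟨(j - J).toNat, ?_⟩) _
      have := Set.mem_Ici.mp hJ
      change ((j - J).toNat : ℤ) + J = j
      omega
  have h2 : Summable fun j : ℤ => Set.indicator (Set.Ici J)ᶜ (fun j => (c j : ℂ) * z ^ j) j := by
    refine summable_of_ne_finset_zero (s := Finset.Icc (-N) J) fun j hj => ?_
    rw [Set.indicator_apply]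
    split_ifs with hJ
    · rw [Set.mem_compl_iff, Set.mem_Ici] at hJ
      rw [Finset.mem_Icc] at hj
      rw [h.zero j (by omega), Complex.ofReal_zero, zero_mul]
    · rfl
  refine (h1.add h2).congr fun j => ?_
  exact congrFun (Set.indicator_self_add_compl _ _) j

theorem IsStable.hasSum (h : IsStable q c N J) {z : ℂ} (hz : z ≠ 0) (hq : 0 < q) (hzq : ‖z‖ < q) :
    HasSum (fun j : ℤ => (c j : ℂ) * z ^ j) (stableSum q c z) := by
  obtain ⟨S, hs⟩ := h.summable hz hq hzq
  have hq' : (q : ℂ) ≠ 0 := by exact_mod_cast hq.ne'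
  have hne : (1 - z / q : ℂ) ≠ 0 := by
    intro h0
    have h1 : z = q := by
      rw [sub_eq_zero, eq_comm, div_eq_one_iff_eq hq'] at h0
      exact h0
    rw [h1, Complex.norm_real, Real.norm_of_nonneg hq.le] at hzq
    exact lt_irrefl _ hzq
  have h1 : HasSum (fun j : ℤ => (c (j - 1) : ℂ) * z ^ (j - 1)) S := by
    have h0 := (Equiv.subRight (1 : ℤ)).hasSum_iff.mpr hs
    simpa only [Function.comp_def, Equiv.subRight_apply] using h0
  have h2 := hs.sub (h1.mul_left (z / q))
  have h3 : (fun j : ℤ => ((c j - c (j - 1) / q : ℝ) : ℂ) * z ^ j)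
      = fun j : ℤ => (c j : ℂ) * z ^ j - z / q * ((c (j - 1) : ℂ) * z ^ (j - 1)) := by
    ext j
    rw [zpow_sub_one₀ hz]
    push_cast
    field_simp
  have h4 : stableSum q c z = S := by
    rw [stableSum, h3, h2.tsum_eq, show S - z / q * S = (1 - z / q) * S by ring, inv_mul_cancel_left₀ hne]
  rw [h4]
  exact hs

theorem norm_zpow_le_pow {z : ℂ} (hz : z ≠ 0) {j : ℤ} {m : ℕ} (h1 : j ≤ m) (h2 : -(m : ℤ) ≤ j) :
    ‖z ^ j‖ ≤ (max ‖z‖ ‖z‖⁻¹) ^ m := by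
  have hz' := norm_pos_iff.mpr hz
  have hR : 1 ≤ max ‖z‖ ‖z‖⁻¹ := by
    rcases le_total 1 ‖z‖ with h | h
    · exact le_max_of_le_left h
    · exact le_max_of_le_right ((one_le_inv₀ hz').mpr h)
  rw [norm_zpow]
  rcases le_total 0 j with h | h
  · obtain ⟨k, rfl⟩ := Int.eq_ofNat_of_zero_le h
    rw [zpow_natCast]
    exact (pow_le_pow_left₀ hz'.le (le_max_left _ _) k).trans (pow_le_pow_right₀ hR (by omega))
  · obtain ⟨k, hk⟩ := Int.eq_ofNat_of_zero_le (neg_nonneg.mpr h)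
    rw [show j = -(k : ℤ) by omega, _root_.zpow_neg, zpow_natCast, ← inv_pow]
    exact (pow_le_pow_left₀ (inv_pos.mpr hz').le (le_max_right _ _) k).trans (pow_le_pow_right₀ hR (by omega))

/-- For fixed z the estimate is a constant times `M` times a fixed base to the power `N`.
Exponential growth in the ball index is what a large real part of α can absorb. -/
theorem IsStable.norm_stableSum_le (hq : 1 ≤ q) {c0 : ℕ} {N : ℕ} (h : IsStable q c N (3 * N + c0)) {M : ℝ}
    (hM : ∀ j, |c j| ≤ M) {z : ℂ} (hz : z ≠ 0) :
    ‖stableSum q c z‖ ≤ ‖(1 - z / q)⁻¹‖ * ((c0 + 4) * (2 * (max ‖z‖ ‖z‖⁻¹) ^ c0))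
      * M * (2 * (max ‖z‖ ‖z‖⁻¹) ^ 3) ^ N := by
  set R := max ‖z‖ ‖z‖⁻¹
  have hR0 : 0 ≤ R := le_max_of_le_left (norm_nonneg _)
  have hM0 : 0 ≤ M := (abs_nonneg _).trans (hM 0)
  have hd : ∀ j ∈ Finset.Icc (-(N : ℤ)) (3 * N + c0),
      ‖((c j - c (j - 1) / q : ℝ) : ℂ) * z ^ j‖ ≤ 2 * M * R ^ (3 * N + c0) := by
    intro j hj
    rw [Finset.mem_Icc] at hj
    rw [norm_mul, Complex.norm_real, Real.norm_eq_abs]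
    refine mul_le_mul ?_ (norm_zpow_le_pow hz (by push_cast; omega) (by push_cast; omega)) (norm_nonneg _) (by positivity)
    refine (abs_sub _ _).trans ?_
    have : |c (j - 1) / q| ≤ M := by
      rw [abs_div, abs_of_pos (a := q) (by linarith)]
      exact (div_le_self (abs_nonneg _) hq).trans (hM _)
    linarith [hM j]
  rw [h.stableSum_eq, norm_mul]
  have hsum := (norm_sum_le _ _).trans (Finset.sum_le_card_nsmul _ _ _ hd)
  rw [Int.card_Icc, nsmul_eq_mul] at hsum
  -- The number of terms grows only linearly; it is bounded by a power of 2 so that the final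
  -- estimate is a single exponential.
  have hcard : (((3 * N + c0 + 1 - -(N : ℤ)).toNat : ℕ) : ℝ) ≤ (c0 + 4) * 2 ^ N := by
    have h1 : (3 * (N : ℤ) + c0 + 1 - -(N : ℤ)).toNat = 4 * N + c0 + 1 := by omega
    have h2 : N + 1 ≤ 2 ^ N := Nat.lt_two_pow_self
    have h3 : 4 * N + c0 + 1 ≤ (c0 + 4) * 2 ^ N := by nlinarith
    rw [h1]
    exact_mod_cast h3
  calc ‖(1 - z / q)⁻¹‖ * ‖∑ j ∈ Finset.Icc (-(N : ℤ)) (3 * N + c0), ((c j - c (j - 1) / q : ℝ) : ℂ) * z ^ j‖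
      ≤ ‖(1 - z / q)⁻¹‖ * (((c0 + 4) * 2 ^ N) * (2 * M * R ^ (3 * N + c0))) := by
        refine mul_le_mul_of_nonneg_left (hsum.trans ?_) (norm_nonneg _)
        exact mul_le_mul_of_nonneg_right hcard (by positivity)
    _ = _ := by rw [mul_pow, pow_add, pow_mul]; ring

theorem stableSum_smul_shift {q : ℝ} (c : ℤ → ℝ) (a : ℝ) (i : ℤ) {z : ℂ} (hz : z ≠ 0) :
    stableSum q (fun l => a * c (l + i)) z = a * z ^ (-i) * stableSum q c z := by
  have hshift := (Equiv.addRight i).tsum_eq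
    (fun j : ℤ => ((c j - c (j - 1) / q : ℝ) : ℂ) * z ^ j : ℤ → ℂ)
  have hmul : ∑' j : ℤ, ((a * c (j + i) - a * c (j - 1 + i) / q : ℝ) : ℂ) * z ^ j
      = a * z ^ (-i) * ∑' j : ℤ, ((c j - c (j - 1) / q : ℝ) : ℂ) * z ^ j := by
    rw [← hshift, ← tsum_mul_left]
    refine tsum_congr fun j => ?_
    simp only [Equiv.coe_addRight]
    rw [show j - 1 + i = j + i - 1 by ring, show z ^ j = z ^ (-i) * z ^ (j + i) by
      rw [← zpow_add₀ hz]; congr 1; ring]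
    push_cast
    ring
  rw [stableSum, stableSum, hmul]
  ring

end Stable

/-! ### Meromorphic continuation through z = q^(-β) -/

section Continuation

variable {F : Type*} [NontriviallyNormedField F] [IsUltrametricDist F] [ProperSpace F]

theorem zpar_div_eq (β : ℂ) : zpar F β / (qR F : ℝ) = (residueCard F : ℂ) ^ (-β - 1) := by
  have : (residueCard F : ℂ) ≠ 0 := by exact_mod_cast (qR_pos (F := F)).ne'
  rw [Complex.cpow_sub _ _ this, Complex.cpow_one]
  simp [zpar]

theorem norm_zpar_lt {β : ℂ} (hβ : -1 < β.re) : ‖zpar F β‖ < qR F := by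
  rw [norm_zpar]
  conv_rhs => rw [← Real.rpow_one (qR F)]
  exact Real.rpow_lt_rpow_of_exponent_lt one_lt_qR (by linarith)

theorem zpar_div_ne_one {β : ℂ} (hβ : -1 < β.re) : zpar F β / (qR F : ℝ) ≠ 1 := by
  intro h
  have hq : ((qR F : ℝ) : ℂ) ≠ 0 := by exact_mod_cast (qR_pos (F := F)).ne'
  rw [div_eq_one_iff_eq hq] at h
  have := norm_zpar_lt (F := F) hβ
  rw [h, Complex.norm_real, Real.norm_of_nonneg qR_pos.le] at this
  exact lt_irrefl _ this

theorem analyticAt_zpar (β : ℂ) : AnalyticAt ℂ (zpar F) β := by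
  have hd : Differentiable ℂ (zpar F) := by
    have : (residueCard F : ℂ) ≠ 0 := by exact_mod_cast (qR_pos (F := F)).ne'
    intro β
    exact DifferentiableAt.const_cpow differentiableAt_id.neg (Or.inl this)
  exact hd.analyticAt β

/-- The numerator is a Laurent polynomial in the nowhere vanishing entire function `zpar F`, and the
denominator is nonzero on Re β > -1 because |z| < q there. -/
theorem IsStable.exists_continuation {c : ℤ → ℝ} {N J : ℤ} (h : IsStable (qR F) c N J) {g : ℂ → ℂ}
    (hg : ∀ β : ℂ, -1 < β.re → g β = stableSum (qR F) c (zpar F β)) :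
    ∃ g', IsContinuation g g' ∧
      ∀ β, zpar F β / (qR F : ℝ) ≠ 1 → g' β = stableSum (qR F) c (zpar F β) := by
  set G : ℂ → ℂ := fun β => stableSum (qR F) c (zpar F β)
  have hGeq : G = fun β => (1 - zpar F β / (qR F : ℝ))⁻¹ *
      ∑ j ∈ Finset.Icc (-N) J, ((c j - c (j - 1) / qR F : ℝ) : ℂ) * zpar F β ^ j :=
    funext fun β => h.stableSum_eq _
  have hnum : ∀ β, AnalyticAt ℂ (fun β => ∑ j ∈ Finset.Icc (-N) J,
      ((c j - c (j - 1) / qR F : ℝ) : ℂ) * zpar F β ^ j) β := fun β =>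
    Finset.analyticAt_fun_sum _ fun j _ =>
      analyticAt_const.mul ((analyticAt_zpar β).zpow (zpar_ne_zero β))
  have hden : ∀ β, AnalyticAt ℂ (fun β => 1 - zpar F β / (qR F : ℝ)) β := fun β =>
    analyticAt_const.sub ((analyticAt_zpar β).div_const)
  have hmer : MeromorphicOn G Set.univ := by
    intro β _
    rw [hGeq]
    exact (hden β).meromorphicAt.inv.mul (hnum β).meromorphicAt
  have han : ∀ β, zpar F β / (qR F : ℝ) ≠ 1 → AnalyticAt ℂ G β := by
    intro β hβ
    rw [hGeq]
    exact ((hden β).inv (sub_ne_zero.mpr hβ.symm)).mul (hnum β)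
  -- Passing to normal form can only change values where z = q, the points at which `stableSum` has
  -- a default value; elsewhere the function is analytic.
  have hval : ∀ β, zpar F β / (qR F : ℝ) ≠ 1 → toMeromorphicNFOn G Set.univ β = G β := by
    intro β hβ
    rw [toMeromorphicNFOn_eq_toMeromorphicNFAt hmer (Set.mem_univ β),
      toMeromorphicNFAt_eq_self.mpr (han β hβ).meromorphicNFAt]
  refine ⟨toMeromorphicNFOn G Set.univ, ⟨meromorphicNFOn_toMeromorphicNFOn _ _, fun β hβ => ?_⟩, hval⟩
  rw [hval β (zpar_div_ne_one hβ), hg β hβ]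

end Continuation

/-! ### Integrals of functions of an integral level -/

section LevelSums

variable {Ω : Type*} [MeasurableSpace Ω] {ν : Measure Ω}

theorem integrable_level_iff {E : Type*} [NormedAddCommGroup E] {o : Ω → ℤ} (ho : Measurable o)
    (hfin : ∀ j, ν (o ⁻¹' {j}) ≠ ⊤) (G : ℤ → E) :
    Integrable (fun x => G (o x)) ν ↔ Summable fun j => ν.real (o ⁻¹' {j}) * ‖G j‖ := by
  have hG : StronglyMeasurable G := StronglyMeasurable.of_discrete
  have hm : AEStronglyMeasurable (fun x => G (o x)) ν := (hG.comp_measurable ho).aestronglyMeasurable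
  have hl : ∫⁻ x, ‖G (o x)‖ₑ ∂ν = ∑' j, ENNReal.ofReal (ν.real (o ⁻¹' {j}) * ‖G j‖) := by
    rw [← lintegral_map (f := fun j => ‖G j‖ₑ) (measurable_of_countable _) ho, lintegral_countable']
    refine tsum_congr fun j => ?_
    rw [Measure.map_apply ho (measurableSet_singleton j), ENNReal.ofReal_mul measureReal_nonneg,
      measureReal_def, ENNReal.ofReal_toReal (hfin j), ofReal_norm, mul_comm]
  have hnn : ∀ j, 0 ≤ ν.real (o ⁻¹' {j}) * ‖G j‖ := fun j => mul_nonneg measureReal_nonneg (norm_nonneg _)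
  constructor
  · intro h
    have h1 := h.2
    rw [hasFiniteIntegral_iff_enorm, hl] at h1
    have h2 := ENNReal.summable_toReal h1.ne
    exact h2.congr fun j => ENNReal.toReal_ofReal (hnn j)
  · intro h
    refine ⟨hm, ?_⟩
    rw [hasFiniteIntegral_iff_enorm, hl]
    exact lt_top_iff_ne_top.mpr h.tsum_ofReal_ne_top

theorem hasSum_level {E : Type*} [NormedAddCommGroup E] [NormedSpace ℝ E] [CompleteSpace E] {o : Ω → ℤ}
    (ho : Measurable o) (G : ℤ → E) (hint : Integrable (fun x => G (o x)) ν) :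
    HasSum (fun j => ν.real (o ⁻¹' {j}) • G j) (∫ x, G (o x) ∂ν) := by
  have hU : ⋃ j, o ⁻¹' {j} = Set.univ := by
    ext x; simp
  have h := hasSum_integral_iUnion (μ := ν) (f := fun x => G (o x)) (s := fun j => o ⁻¹' {j})
    (fun j => ho (measurableSet_singleton j))
    (fun i j hij => Set.disjoint_left.mpr fun x hx hx' => hij (hx.symm.trans hx'))
    (by rw [hU]; exact hint.integrableOn)
  rw [hU, setIntegral_univ] at h
  refine h.congr_fun fun j => ?_
  rw [setIntegral_congr_fun (g := fun _ => G j) (ho (measurableSet_singleton j))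
    (fun x hx => congrArg G hx), setIntegral_const]

end LevelSums

/-! ### Integrals against geometric weights on an increasing exhaustion -/

section GeometricWeights

variable {Ω : Type*} [MeasurableSpace Ω] {ν : Measure Ω} {D : ℕ → Set Ω}

/-- The sum of `w ^ i` over all `i` with `y ∈ D i`. -/
def geomWeight (D : ℕ → Set Ω) (w : ℂ) (y : Ω) : ℂ := ∑' i, w ^ i * Set.indicator (D i) 1 y

theorem hasSum_tail {𝕜 : Type*} [NormedField 𝕜] {w : 𝕜} (hw : ‖w‖ < 1) (i0 : ℕ) :
    HasSum (fun i : ℕ => if i0 ≤ i then w ^ i else 0) (w ^ i0 * (1 - w)⁻¹) := by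
  have h1 : HasSum (fun i : ℕ => w ^ i0 * w ^ i) (w ^ i0 * (1 - w)⁻¹) :=
    (hasSum_geometric_of_norm_lt_one hw).mul_left _
  have hinj : Function.Injective fun i : ℕ => i + i0 := fun a b h => by
    have : a + i0 = b + i0 := h
    omega
  rw [← hinj.hasSum_iff]
  · refine h1.congr_fun fun i => ?_
    simp [pow_add, mul_comm]
  · intro i hi
    refine if_neg fun h => hi ⟨i - i0, ?_⟩
    change i - i0 + i0 = i
    omega

theorem exists_first (hmono : Monotone D) (hU : ⋃ i, D i = Set.univ) (y : Ω) :
    ∃ i0 : ℕ, ∀ i, y ∈ D i ↔ i0 ≤ i := by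
  classical
  have h : ∃ i, y ∈ D i := Set.mem_iUnion.mp (hU ▸ Set.mem_univ y)
  refine ⟨Nat.find h, fun i => ⟨fun hi => Nat.find_min' h hi, fun hi => hmono hi (Nat.find_spec h)⟩⟩

theorem geomWeight_eq {w : ℂ} (hw : ‖w‖ < 1) {y : Ω} {i0 : ℕ} (h : ∀ i, y ∈ D i ↔ i0 ≤ i) :
    geomWeight D w y = w ^ i0 * (1 - w)⁻¹ := by
  classical
  refine ((hasSum_tail hw i0).congr_fun fun i => ?_).tsum_eq
  rw [Set.indicator_apply]
  simp only [h i]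
  split_ifs <;> simp

theorem measurable_geomWeight (hD : ∀ i, MeasurableSet (D i)) (hmono : Monotone D)
    (hU : ⋃ i, D i = Set.univ) {w : ℂ} (hw : ‖w‖ < 1) : Measurable (geomWeight D w) := by
  classical
  refine measurable_of_tendsto_metrizable (f := fun m y => ∑ i ∈ Finset.range m, w ^ i * Set.indicator (D i) 1 y) (fun m => ?_) ?_
  · refine Finset.measurable_sum _ fun i _ => ?_
    exact (measurable_one.indicator (hD i)).const_mul _
  · refine tendsto_pi_nhds.mpr fun y => ?_
    obtain ⟨i0, hi0⟩ := exists_first hmono hU y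
    refine HasSum.tendsto_sum_nat ?_
    rw [geomWeight_eq hw hi0]
    refine (hasSum_tail hw i0).congr_fun fun i => ?_
    rw [Set.indicator_apply]
    simp only [hi0 i]
    split_ifs <;> simp

/-- The sum over `i` is the tail of a geometric series, so the sum of absolute values and the
absolute value of the sum differ by a factor independent of the point. Hence integrability of the
product is equivalent to absolute convergence of the series of integrals. -/
theorem tsum_enorm_geom (hmono : Monotone D) (hU : ⋃ i, D i = Set.univ) {w : ℂ} (hw : ‖w‖ < 1)
    (f : Ω → ℂ) (y : Ω) :
    ∑' i, ‖w ^ i * Set.indicator (D i) f y‖ₑ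
      = ENNReal.ofReal (‖1 - w‖ / (1 - ‖w‖)) * ‖geomWeight D w y * f y‖ₑ := by
  classical
  obtain ⟨i0, hi0⟩ := exists_first hmono hU y
  have h1w : (1 - w) ≠ 0 := by
    intro h
    rw [← sub_eq_zero.mp h, norm_one] at hw
    exact lt_irrefl _ hw
  have hs : HasSum (fun i => ‖w ^ i * Set.indicator (D i) f y‖) (‖w‖ ^ i0 * (1 - ‖w‖)⁻¹ * ‖f y‖) := by
    have := (hasSum_tail (w := ‖w‖) (by rwa [norm_norm]) i0).mul_right ‖f y‖
    refine this.congr_fun fun i => ?_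
    rw [Set.indicator_apply]
    simp only [hi0 i]
    split_ifs <;> simp
  simp only [← ofReal_norm]
  rw [← ENNReal.ofReal_tsum_of_nonneg (fun i => norm_nonneg _) hs.summable, hs.tsum_eq,
    ← ENNReal.ofReal_mul (div_nonneg (norm_nonneg _) (by linarith)), geomWeight_eq hw hi0]
  congr 1
  rw [norm_mul, norm_mul, norm_inv, norm_pow]
  have := norm_pos_iff.mpr h1w
  field_simp

theorem integrable_geomWeight_iff (hD : ∀ i, MeasurableSet (D i)) (hmono : Monotone D)
    (hU : ⋃ i, D i = Set.univ) {w : ℂ} (hw0 : w ≠ 0) (hw : ‖w‖ < 1) {f : Ω → ℂ} (hf : AEStronglyMeasurable f ν) :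
    Integrable (fun y => geomWeight D w y * f y) ν ↔
      (∀ i, IntegrableOn f (D i) ν) ∧ Summable fun i => ‖w‖ ^ i * ∫ y in D i, ‖f y‖ ∂ν := by
  classical
  have h1w : (1 - w) ≠ 0 := by
    intro h
    rw [← sub_eq_zero.mp h, norm_one] at hw
    exact lt_irrefl _ hw
  have hm : AEStronglyMeasurable (fun y => geomWeight D w y * f y) ν :=
    (measurable_geomWeight hD hmono hU hw).aestronglyMeasurable.mul hf
  have hFm : ∀ i, AEStronglyMeasurable (fun y => w ^ i * Set.indicator (D i) f y) ν := fun i =>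
    (hf.indicator (hD i)).const_mul _
  have hK : 0 < ‖1 - w‖ / (1 - ‖w‖) := div_pos (norm_pos_iff.mpr h1w) (by linarith)
  have hl : ∑' i, ∫⁻ y, ‖w ^ i * Set.indicator (D i) f y‖ₑ ∂ν
      = ENNReal.ofReal (‖1 - w‖ / (1 - ‖w‖)) * ∫⁻ y, ‖geomWeight D w y * f y‖ₑ ∂ν := by
    rw [← lintegral_tsum fun i => (hFm i).enorm, ← lintegral_const_mul'' _ hm.enorm]
    exact lintegral_congr fun y => tsum_enorm_geom hmono hU hw f y
  have hterm : ∀ i, ∫⁻ y, ‖w ^ i * Set.indicator (D i) f y‖ₑ ∂ν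
      = ENNReal.ofReal (‖w‖ ^ i) * ∫⁻ y in D i, ‖f y‖ₑ ∂ν := by
    intro i
    rw [← lintegral_indicator (hD i), ← lintegral_const_mul' _ _ ENNReal.ofReal_ne_top]
    refine lintegral_congr fun y => ?_
    rw [enorm_mul, ← norm_pow, ofReal_norm]
    congr 1
    rw [Set.indicator_apply, Set.indicator_apply]
    split_ifs <;> simp
  constructor
  · intro h
    have h1 : ∑' i, ∫⁻ y, ‖w ^ i * Set.indicator (D i) f y‖ₑ ∂ν ≠ ⊤ := by
      rw [hl]
      exact ENNReal.mul_ne_top ENNReal.ofReal_ne_top (hasFiniteIntegral_iff_enorm.mp h.2).ne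
    have h2 : ∀ i, IntegrableOn f (D i) ν := by
      intro i
      refine ⟨hf.restrict, ?_⟩
      rw [hasFiniteIntegral_iff_enorm, lt_top_iff_ne_top]
      intro h3
      have h4 := ENNReal.ne_top_of_tsum_ne_top h1 i
      rw [hterm, h3, ENNReal.mul_top] at h4
      · exact h4 rfl
      · exact (ENNReal.ofReal_pos.mpr (pow_pos (norm_pos_iff.mpr hw0) i)).ne'
    refine ⟨h2, ?_⟩
    refine (ENNReal.summable_toReal h1).congr fun i => ?_
    rw [hterm, ENNReal.toReal_mul, ENNReal.toReal_ofReal (by positivity),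
      integral_norm_eq_lintegral_enorm (h2 i).1]
  · rintro ⟨h1, h2⟩
    refine ⟨hm, ?_⟩
    rw [hasFiniteIntegral_iff_enorm, lt_top_iff_ne_top]
    have h3 : ∑' i, ∫⁻ y, ‖w ^ i * Set.indicator (D i) f y‖ₑ ∂ν ≠ ⊤ := by
      have := h2.tsum_ofReal_ne_top
      convert this using 3 with i
      rw [hterm, ENNReal.ofReal_mul (by positivity), ofReal_integral_norm_eq_lintegral_enorm (h1 i)]
    intro h4
    rw [hl, h4, ENNReal.mul_top (ENNReal.ofReal_pos.mpr hK).ne'] at h3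
    exact h3 rfl

theorem hasSum_geomWeight (hD : ∀ i, MeasurableSet (D i)) (hmono : Monotone D)
    (hU : ⋃ i, D i = Set.univ) {w : ℂ} (hw0 : w ≠ 0) (hw : ‖w‖ < 1) {f : Ω → ℂ} (hf : AEStronglyMeasurable f ν)
    (hint : Integrable (fun y => geomWeight D w y * f y) ν) :
    HasSum (fun i => w ^ i * ∫ y in D i, f y ∂ν) (∫ y, geomWeight D w y * f y ∂ν) := by
  classical
  obtain ⟨h1, h2⟩ := (integrable_geomWeight_iff hD hmono hU hw0 hw hf).mp hint
  have h3 := hasSum_integral_of_summable_integral_norm (μ := ν)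
    (F := fun i y => w ^ i * Set.indicator (D i) f y)
    (fun i => ((h1 i).integrable_indicator (hD i)).const_mul _) (by
      refine h2.congr fun i => ?_
      simp only [norm_mul, norm_pow, norm_indicator_eq_indicator_norm]
      rw [integral_const_mul, integral_indicator (hD i)])
  have h4 : ∀ y, ∑' i, w ^ i * Set.indicator (D i) f y = geomWeight D w y * f y := by
    intro y
    rw [geomWeight, ← tsum_mul_right]
    refine tsum_congr fun i => ?_
    rw [Set.indicator_apply, Set.indicator_apply]
    split_ifs <;> simp
  simp only [h4] at h3
  refine h3.congr_fun fun i => ?_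
  rw [integral_const_mul, integral_indicator (hD i)]

end GeometricWeights

/-! ### The multiplicative measure and the function `ψ` -/

section MulMeasure

variable {F : Type*} [NontriviallyNormedField F] [IsUltrametricDist F] [ProperSpace F]
  [MeasurableSpace F] [BorelSpace F]

theorem measurable_ord (hF : IsNormalizedNorm F) : Measurable (ord : F → ℤ) := by
  refine measurable_to_countable' fun j => ?_
  have h1 : MeasurableSet {x : F | ‖x‖ = qR F ^ (-j)} :=
    (isClosed_eq continuous_norm continuous_const).measurableSet
  -- The second set accounts for the default value of `ord` at 0.
  have h2 : (ord : F → ℤ) ⁻¹' {j} = {x : F | ‖x‖ = qR F ^ (-j)} ∪ ({0} ∩ {_x : F | ord (0 : F) = j}) := by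
    ext x
    by_cases hx : x = 0
    · subst hx
      simp [(qR_zpow_pos (F := F) j).ne]
    · simp [hx, ord_eq_iff hF hx]
  rw [h2]
  exact h1.union ((measurableSet_singleton 0).inter (MeasurableSet.const _))

theorem isCompact_unitSphere : IsCompact {u : Fˣ | ‖(u : F)‖ = 1} := by
  have h1 : IsCompact ((Units.embedProduct F) ⁻¹'
      (Metric.sphere 0 1 ×ˢ (MulOpposite.op '' Metric.sphere 0 1))) :=
    Units.isClosedEmbedding_embedProduct.isCompact_preimage
      ((isCompact_sphere 0 1).prod ((isCompact_sphere 0 1).image MulOpposite.continuous_op))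
  refine (congrArg IsCompact (Set.ext fun u => ?_)).mpr h1
  simp only [Units.embedProduct, MonoidHom.coe_mk, OneHom.coe_mk, Set.mem_preimage, Set.mem_prod,
    Set.mem_ofPred_eq, MulOpposite.op_injective.mem_set_image, mem_sphere_zero_iff_norm, Units.val_inv_eq_inv_val, norm_inv]
  constructor
  · intro h; rw [h]; simp
  · exact fun h => h.1

theorem isOpen_unitSphere : IsOpen {u : Fˣ | ‖(u : F)‖ = 1} := by
  have : {u : Fˣ | ‖(u : F)‖ = 1} = Units.val ⁻¹' (Metric.sphere (0 : F) 1) := by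
    ext u; simp
  rw [this]
  exact (IsUltrametricDist.isOpen_sphere (0 : F) one_ne_zero).preimage Units.continuous_val

theorem haar_unitSphere_ne_zero : (Measure.haar {u : Fˣ | ‖(u : F)‖ = 1} : ENNReal) ≠ 0 :=
  (isOpen_unitSphere.measure_pos _ ⟨1, by simp⟩).ne'

theorem haar_unitSphere_ne_top : (Measure.haar {u : Fˣ | ‖(u : F)‖ = 1} : ENNReal) ≠ ⊤ :=
  isCompact_unitSphere.measure_lt_top.ne

/-- Each shell is a translate of the unit group, so integrals over `Fˣ` of functions of the
valuation are plain sums over the integers. -/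
theorem mulMeasure_shell (hF : IsNormalizedNorm F) (j : ℤ) :
    mulMeasure F {t : Fˣ | ‖(t : F)‖ = qR F ^ j} = 1 := by
  obtain ⟨s, hs⟩ := exists_norm_eq hF j
  have h : {t : Fˣ | ‖(t : F)‖ = qR F ^ j} = (fun t => s⁻¹ * t) ⁻¹' {u : Fˣ | ‖(u : F)‖ = 1} := by
    ext t
    simp only [Set.mem_ofPred_eq, Set.mem_preimage, Units.val_mul, norm_mul, Units.val_inv_eq_inv_val, norm_inv, hs]
    rw [inv_mul_eq_one₀ (qR_zpow_pos _).ne', eq_comm]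
  rw [h, mulMeasure, Measure.smul_apply, measure_preimage_mul, smul_eq_mul,
    ENNReal.inv_mul_cancel haar_unitSphere_ne_zero haar_unitSphere_ne_top]

theorem measurable_ord_units (hF : IsNormalizedNorm F) : Measurable fun t : Fˣ => ord (t : F) :=
  (measurable_ord hF).comp Units.continuous_val.measurable

theorem ord_preimage_units (hF : IsNormalizedNorm F) (j : ℤ) :
    (fun t : Fˣ => ord (t : F)) ⁻¹' {j} = {t : Fˣ | ‖(t : F)‖ = qR F ^ (-j)} := by
  ext t
  exact ord_eq_iff hF t.ne_zero

theorem mulMeasure_ord (hF : IsNormalizedNorm F) (j : ℤ) :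
    mulMeasure F ((fun t : Fˣ => ord (t : F)) ⁻¹' {j}) = 1 := by
  rw [ord_preimage_units hF, mulMeasure_shell hF]

theorem integrable_mulMeasure_iff (hF : IsNormalizedNorm F) (G : ℤ → ℂ) :
    Integrable (fun t : Fˣ => G (ord (t : F))) (mulMeasure F) ↔ Summable fun j => ‖G j‖ := by
  rw [integrable_level_iff (measurable_ord_units hF) (fun j => by rw [mulMeasure_ord hF]; simp)]
  simp [measureReal_def, mulMeasure_ord hF]

theorem hasSum_mulMeasure (hF : IsNormalizedNorm F) {G : ℤ → ℂ}
    (h : Integrable (fun t : Fˣ => G (ord (t : F))) (mulMeasure F)) :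
    HasSum G (∫ t : Fˣ, G (ord (t : F)) ∂(mulMeasure F)) := by
  have := hasSum_level (measurable_ord_units hF) G h
  simpa [measureReal_def, mulMeasure_ord hF] using this

instance : (mulMeasure F).IsMulLeftInvariant := by
  unfold mulMeasure; infer_instance

theorem norm_zpar_lt_one {α : ℂ} (hα : 0 < α.re) : ‖zpar F α‖ < 1 := by
  rw [norm_zpar]
  exact Real.rpow_lt_one_of_one_lt_of_neg one_lt_qR (by linarith)

theorem absPow_mul (s t : F) (α : ℂ) : absPow (s * t) α = absPow s α * absPow t α := by
  simp only [absPow, norm_mul, Complex.ofReal_mul]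
  exact Complex.mul_cpow_ofReal_nonneg (norm_nonneg _) (norm_nonneg _) α

end MulMeasure

/-! ### The function ψ as a geometric weight on balls -/

section Psi

variable {F : Type*} [NontriviallyNormedField F] [IsUltrametricDist F] [ProperSpace F]
  [MeasurableSpace F] [BorelSpace F] {n : ℕ} {B : Matrix (Fin n) (Fin n) F}

theorem psi_mul (α : ℂ) {p g : GL (Idx n) F} {t : Fˣ}
    (hp : eVec F n ᵥ* (p : Matrix (Idx n) (Idx n) F) = ((t⁻¹ : Fˣ) : F) • eVec F n) :
    psi α (p * g) = absPow (t : F) α * psi α g := by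
  have h : ∀ s : Fˣ, ((s : F) • eVec F n) ᵥ* ((p * g : GL (Idx n) F) : Matrix (Idx n) (Idx n) F)
      = (((t⁻¹ * s : Fˣ) : F) • eVec F n) ᵥ* (g : Matrix (Idx n) (Idx n) F) := by
    intro s
    rw [Units.val_mul, ← Matrix.vecMul_vecMul, Matrix.smul_vecMul, hp, smul_smul, Units.val_mul, mul_comm (s : F)]
  have h2 : ∀ s : Fˣ, absPow (s : F) α = absPow (t : F) α * absPow ((t⁻¹ * s : Fˣ) : F) α := by
    intro s
    rw [← absPow_mul, ← Units.val_mul, mul_inv_cancel_left]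
  rw [psi, psi, ← integral_const_mul]
  refine Eq.trans ?_ (integral_mul_left_eq_self (μ := mulMeasure F) (fun s : Fˣ => absPow (t : F) α *
    (absPow (s : F) α * Set.indicator {v : Idx n → F | IntegralVec v} 1
      (((s : F) • eVec F n) ᵥ* (g : Matrix (Idx n) (Idx n) F)))) t⁻¹)
  refine integral_congr_ae (Filter.Eventually.of_forall fun s => ?_)
  simp only
  rw [h, h2, mul_assoc]

/-- Since `H` fixes e₋, the vector eh has e₋-coordinate 1, which forces t to be integral; the other
coordinates are those of e₊h. -/
theorem integralVec_smul_eVec_iff (hF : IsNormalizedNorm F) (t : Fˣ) (h : groupH B) :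
    IntegralVec (((t : F) • eVec F n) ᵥ* ((h : GL (Idx n) F) : Matrix (Idx n) (Idx n) F)) ↔
      0 ≤ ord (t : F) ∧ ThetaQuot.mk h ∈ ballSet B (ord (t : F)) := by
  have h1 : ((t : F) • eVec F n) ᵥ* ((h : GL (Idx n) F) : Matrix (Idx n) (Idx n) F)
      = (t : F) • (vec (ThetaQuot.mk h) + eMinus F n) := by
    change rowAct _ h = _
    rw [rowAct_smul, eVec, rowAct_add, rowAct_eMinus, vec_mk]
  have ht := norm_eq_ord hF t.ne_zero
  have hmul : ∀ x : F, ‖(t : F) * x‖ ≤ 1 ↔ ‖x‖ ≤ qR F ^ (ord (t : F)) := by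
    intro x
    rw [norm_mul, ht, _root_.zpow_neg, inv_mul_le_iff₀ (qR_zpow_pos _), mul_one]
  have h2 := vec_two (ThetaQuot.mk h)
  rw [h1]
  constructor
  · intro hi
    have h3 : 0 ≤ ord (t : F) := by
      have := hi (.inr 2)
      rw [Pi.smul_apply, smul_eq_mul, hmul, Pi.add_apply, h2] at this
      simpa [eMinus, ← qR_zpow_le (F := F)] using this
    refine ⟨h3, fun j => ?_⟩
    have := hi j
    rw [Pi.smul_apply, smul_eq_mul, hmul, Pi.add_apply] at this
    rcases j with j | j
    · simpa [eMinus] using this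
    · fin_cases j
      · simpa [eMinus] using this
      · simpa [eMinus] using this
      · change ‖vec (ThetaQuot.mk h) (.inr 2)‖ ≤ _
        rw [h2, norm_zero]; exact (qR_zpow_pos _).le
  · rintro ⟨h3, h4⟩ j
    rw [Pi.smul_apply, smul_eq_mul, hmul, Pi.add_apply]
    refine norm_add_le_of_le' (h4 j) ?_
    have h5 : (1 : ℝ) ≤ qR F ^ (ord (t : F)) := by
      rw [← zpow_zero (qR F), qR_zpow_le]; exact h3
    rcases j with j | j
    · simpa [eMinus] using (qR_zpow_pos (F := F) _).le
    · fin_cases j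
      · simpa [eMinus] using (qR_zpow_pos (F := F) _).le
      · simpa [eMinus] using (qR_zpow_pos (F := F) _).le
      · simpa [eMinus] using h5

theorem monotone_ballSet : Monotone fun i : ℕ => ballSet B (i : ℤ) :=
  fun _ _ h => ballSet_mono (by exact_mod_cast h)

theorem psi_eq_geomWeight (hF : IsNormalizedNorm F) {α : ℂ} (hα : 0 < α.re) (h : groupH B) :
    psi α (h : GL (Idx n) F)
      = geomWeight (fun i : ℕ => ballSet B (i : ℤ)) (zpar F α) (ThetaQuot.mk h) := by
  classical
  obtain ⟨i0, hi0⟩ := exists_first (monotone_ballSet (B := B)) iUnion_ballSet (ThetaQuot.mk h)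
  let G : ℤ → ℂ := fun j => if (i0 : ℤ) ≤ j then zpar F α ^ j else 0
  have hmem : ∀ j : ℤ, (0 ≤ j ∧ ThetaQuot.mk h ∈ ballSet B j) ↔ (i0 : ℤ) ≤ j := by
    intro j
    constructor
    · rintro ⟨h1, h2⟩
      obtain ⟨k, rfl⟩ := Int.eq_ofNat_of_zero_le h1
      exact_mod_cast (hi0 k).mp h2
    · intro h1
      obtain ⟨k, rfl⟩ := Int.eq_ofNat_of_zero_le ((Int.natCast_nonneg i0).trans h1)
      exact ⟨Int.natCast_nonneg k, (hi0 k).mpr (by exact_mod_cast h1)⟩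
  have hG : ∀ t : Fˣ, absPow (t : F) α * Set.indicator {v : Idx n → F | IntegralVec v} 1
      (((t : F) • eVec F n) ᵥ* ((h : GL (Idx n) F) : Matrix (Idx n) (Idx n) F)) = G (ord (t : F)) := by
    intro t
    rw [Set.indicator_apply]
    simp only [Set.mem_ofPred_eq, integralVec_smul_eVec_iff hF t h, hmem, G]
    split_ifs
    · rw [absPow_eq hF t.ne_zero]; simp
    · simp
  have hinj : Function.Injective fun i : ℕ => (i : ℤ) := Nat.cast_injective
  have hz : ∀ j : ℤ, j ∉ Set.range (fun i : ℕ => (i : ℤ)) → G j = 0 := by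
    intro j hj
    refine if_neg fun h1 => hj ?_
    obtain ⟨k, rfl⟩ := Int.eq_ofNat_of_zero_le ((Int.natCast_nonneg i0).trans h1)
    exact ⟨k, rfl⟩
  have hGk : ∀ k : ℕ, (if i0 ≤ k then zpar F α ^ k else 0) = G k := by
    intro k
    simp [G]
  have hlt := norm_zpar_lt_one (F := F) hα
  have hint : Integrable (fun t : Fˣ => G (ord (t : F))) (mulMeasure F) := by
    rw [integrable_mulMeasure_iff hF]
    rw [← hinj.summable_iff (fun j hj => by rw [hz j hj, norm_zero])]
    have := (hasSum_tail (w := ‖zpar F α‖) (by rwa [norm_norm]) i0).summable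
    refine this.congr fun k => ?_
    rw [Function.comp_apply, ← hGk]
    split_ifs <;> simp
  have h1 : HasSum (fun k : ℕ => if i0 ≤ k then zpar F α ^ k else 0) (∫ t : Fˣ, G (ord (t : F)) ∂(mulMeasure F)) := by
    have := (hinj.hasSum_iff hz).mpr (hasSum_mulMeasure hF hint)
    exact this.congr_fun fun k => hGk k
  rw [psi, integral_congr_ae (Filter.Eventually.of_forall hG), h1.unique (hasSum_tail hlt i0), geomWeight_eq hlt hi0]

theorem psiQuot_eq (hF : IsNormalizedNorm F) {α : ℂ} (hα : 0 < α.re) (y : ThetaQuot B) :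
    psiQuot α y = geomWeight (fun i : ℕ => ballSet B (i : ℤ)) (zpar F α) y := by
  obtain ⟨h, rfl⟩ := exists_mk y
  exact psi_eq_geomWeight hF hα h

theorem phiQuot_eq (α : ℂ) (y : ThetaQuot B) :
    phiQuot α y = psiQuot α y / psi α (1 : GL (Idx n) F) := by
  obtain ⟨h, rfl⟩ := exists_mk y
  rfl

/-- The x-coordinate of e₊ is 1/2, so the base point enters the balls exactly at index `ord 2`; the
tail of the geometric series from there produces the factor |2|^α. -/
theorem psi_one [CharZero F] (hF : IsNormalizedNorm F) (B : Matrix (Fin n) (Fin n) F) {α : ℂ} (hα : 0 < α.re) :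
    psi α (1 : GL (Idx n) F) = absPow (2 : F) α * zetaFactor F α := by
  have h2 : (2 : F) ≠ 0 := two_ne_zero
  have h2' := norm_eq_ord hF h2
  have h20 : 0 ≤ ord (2 : F) := by
    have := norm_two_le (F := F)
    rw [h2', qR_zpow_le] at this
    omega
  obtain ⟨e, he⟩ := Int.eq_ofNat_of_zero_le h20
  have hmem : ∀ i : ℕ, ThetaQuot.mk (1 : groupH B) ∈ ballSet B (i : ℤ) ↔ e ≤ i := by
    intro i
    have hv : vcoord (ThetaQuot.mk (1 : groupH B)) = 2⁻¹ := by
      simp [vcoord, vec_mk, rowAct_one, ePlus]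
    rw [mem_ballSet_iff, acoord_base, ucoord_base, hv, norm_inv, h2', he, ← _root_.zpow_neg, qR_zpow_le, neg_neg]
    constructor
    · intro h; exact_mod_cast h.2.2
    · intro h
      refine ⟨fun j => by simp, ?_, by exact_mod_cast h⟩
      rw [norm_one, ← zpow_zero (qR F), qR_zpow_le]; omega
  have h := psi_eq_geomWeight hF hα (1 : groupH B)
  rw [geomWeight_eq (norm_zpar_lt_one hα) hmem] at h
  rw [absPow_eq hF h2, he, zpow_natCast]
  exact h

theorem psi_one_ne_zero [CharZero F] (hF : IsNormalizedNorm F) (B : Matrix (Fin n) (Fin n) F) {α : ℂ} (hα : 0 < α.re) :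
    psi α (1 : GL (Idx n) F) ≠ 0 := by
  rw [psi_one hF B hα, absPow_eq hF two_ne_zero]
  refine mul_ne_zero (zpow_ne_zero _ (zpar_ne_zero _)) (inv_ne_zero fun h => ?_)
  have h1 : zpar F α = 1 := (sub_eq_zero.mp h).symm
  have := norm_zpar_lt_one (F := F) hα
  rw [h1, norm_one] at this
  exact lt_irrefl _ this

end Psi

/-! ### Unfolding the local factor -/

section Unfolding

variable {F : Type*} [NontriviallyNormedField F] [IsUltrametricDist F] [ProperSpace F]
  [MeasurableSpace F] [BorelSpace F] {n : ℕ} {B : Matrix (Fin n) (Fin n) F}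

/-- The origin of the argument α - β - n: ψ contributes q^(-α) per step, the scaling of Haar measure
q^n, and the index shift from l to l + i contributes q^β. -/
theorem zpar_sub_sub (α β : ℂ) (n : ℕ) :
    zpar F (α - β - n) = zpar F α * (zpar F β)⁻¹ * (qR F : ℂ) ^ n := by
  have hq : (residueCard F : ℂ) ≠ 0 := by exact_mod_cast (qR_pos (F := F)).ne'
  rw [zpar, zpar, zpar, ← Complex.cpow_neg, neg_neg, show -(α - β - n) = -α + β + n by ring,
    Complex.cpow_add _ _ hq, Complex.cpow_add _ _ hq, Complex.cpow_natCast]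
  simp

theorem measurableSet_integralUnits : MeasurableSet (integralUnits F) :=
  (isClosed_le (Units.continuous_val.norm) continuous_const).measurableSet

theorem mem_integralUnits_iff (hF : IsNormalizedNorm F) {t : Fˣ} :
    t ∈ integralUnits F ↔ 0 ≤ ord (t : F) := by
  rw [integralUnits, Set.mem_ofPred_eq, norm_eq_ord hF t.ne_zero, ← zpow_zero (qR F), qR_zpow_le]
  omega

/-- If the integrals of `f` over the balls are proportional to the values of `X`, then the integral
of `ψ f` is proportional to the integral of `X` that defines `Π`. -/
theorem integral_psiQuot_mul [CharZero F] (hF : IsNormalizedNorm F) {μ : Measure (ThetaQuot B)}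
    {α β C : ℂ} (hα : 0 < α.re) (hC : C ≠ 0) {f : ThetaQuot B → ℂ} {X : F → ℂ}
    (hf : AEStronglyMeasurable f μ)
    (hX : (∀ i : ℕ, IntegrableOn f (ballSet B i) μ) → ∀ (t : Fˣ) (i : ℕ), ‖(t : F)‖ = qR F ^ (-(i : ℤ)) →
      ∫ y in ballSet B i, f y ∂μ = C * (qR F : ℂ) ^ (n * i) * (zpar F β ^ i)⁻¹ * X ((t : F) ^ 2))
    (hint : Integrable (fun y => psiQuot α y * f y) μ) :
    IntegrableOn (PiIntegrand X (α - β - n)) (integralUnits F) (mulMeasure F) ∧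
      ∫ y, psiQuot α y * f y ∂μ = C * PiOf X (α - β - n) := by
  classical
  have hlt := norm_zpar_lt_one (F := F) hα
  have hD : ∀ i : ℕ, MeasurableSet (ballSet B (i : ℤ)) := fun i => (isClosed_ballSet i).measurableSet
  simp only [psiQuot_eq hF hα] at hint ⊢
  obtain ⟨hI, hS⟩ := (integrable_geomWeight_iff hD monotone_ballSet iUnion_ballSet (zpar_ne_zero α) hlt hf).mp hint
  have hsum := hasSum_geomWeight hD monotone_ballSet iUnion_ballSet (zpar_ne_zero α) hlt hf hint
  set c : ℕ → ℂ := fun i => zpar F α ^ i * ∫ y in ballSet B i, f y ∂μ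
  let G : ℤ → ℂ := fun j => if 0 ≤ j then C⁻¹ * c j.toNat else 0
  have hG : ∀ t : Fˣ, Set.indicator (integralUnits F) (PiIntegrand X (α - β - n)) t = G (ord (t : F)) := by
    intro t
    rw [Set.indicator_apply]
    simp only [mem_integralUnits_iff hF, G]
    split_ifs with h
    · obtain ⟨i, hi⟩ := Int.eq_ofNat_of_zero_le h
      have ht := norm_eq_ord hF t.ne_zero
      rw [hi] at ht
      simp only [hi, Int.toNat_natCast, c]
      -- The shell ord t = i of the multiplicative integral matches the i-th ball of the weighted
      -- series term by term.
      rw [hX hI t i ht, PiIntegrand, absPow_eq hF t.ne_zero, hi, zpow_natCast, zpar_sub_sub, mul_pow,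
        mul_pow, inv_pow, ← pow_mul]
      field_simp
    · rfl
  have hinj : Function.Injective fun i : ℕ => (i : ℤ) := Nat.cast_injective
  have hz : ∀ j : ℤ, j ∉ Set.range (fun i : ℕ => (i : ℤ)) → G j = 0 := by
    intro j hj
    refine if_neg fun h1 => hj ?_
    obtain ⟨k, rfl⟩ := Int.eq_ofNat_of_zero_le h1
    exact ⟨k, rfl⟩
  have hGk : ∀ k : ℕ, G k = C⁻¹ * c k := by
    intro k
    simp [G]
  have hintG : Integrable (fun t : Fˣ => G (ord (t : F))) (mulMeasure F) := by
    rw [integrable_mulMeasure_iff hF, ← hinj.summable_iff (fun j hj => by rw [hz j hj, norm_zero])]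
    refine Summable.of_nonneg_of_le (fun k => norm_nonneg _) (fun k => ?_) (hS.mul_left ‖C⁻¹‖)
    rw [Function.comp_apply, hGk, norm_mul, norm_mul, norm_pow]
    exact mul_le_mul_of_nonneg_left (mul_le_mul_of_nonneg_left (norm_integral_le_integral_norm _)
      (by positivity)) (norm_nonneg _)
  have hPi : PiOf X (α - β - n) = ∫ t : Fˣ, G (ord (t : F)) ∂(mulMeasure F) := by
    rw [PiOf, ← integral_indicator measurableSet_integralUnits]
    exact integral_congr_ae (Filter.Eventually.of_forall hG)
  constructor
  · rw [← integrable_indicator_iff measurableSet_integralUnits]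
    exact hintG.congr (Filter.Eventually.of_forall fun t => (hG t).symm)
  · have h1 := (hinj.hasSum_iff hz).mpr (hasSum_mulMeasure hF hintG)
    have h2 : HasSum (fun k => C⁻¹ * c k) (∫ t : Fˣ, G (ord (t : F)) ∂(mulMeasure F)) :=
      h1.congr_fun fun k => (hGk k).symm
    rw [hPi, h2.unique (hsum.mul_left C⁻¹), mul_inv_cancel_left₀ hC]

theorem integral_phiQuot_mul [CharZero F] (hF : IsNormalizedNorm F) {μ : Measure (ThetaQuot B)}
    {α β C : ℂ} (hα : 0 < α.re) (hC : C ≠ 0) {f : ThetaQuot B → ℂ} {X : F → ℂ}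
    (hf : AEStronglyMeasurable f μ)
    (hX : (∀ i : ℕ, IntegrableOn f (ballSet B i) μ) → ∀ (t : Fˣ) (i : ℕ), ‖(t : F)‖ = qR F ^ (-(i : ℤ)) →
      ∫ y in ballSet B i, f y ∂μ = C * (qR F : ℂ) ^ (n * i) * (zpar F β ^ i)⁻¹ * X ((t : F) ^ 2))
    (hint : Integrable (fun y => phiQuot α y * f y) μ) :
    IntegrableOn (PiIntegrand X (α - β - n)) (integralUnits F) (mulMeasure F) ∧
      ∫ y, phiQuot α y * f y ∂μ = 1 / psi α (1 : GL (Idx n) F) * ∫ y, psiQuot α y * f y ∂μ ∧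
      1 / psi α (1 : GL (Idx n) F) * ∫ y, psiQuot α y * f y ∂μ
        = C * (PiOf X (α - β - n) / (absPow (2 : F) α * zetaFactor F α)) := by
  have h1 := psi_one_ne_zero hF B hα
  have hpsi : ∀ y, psiQuot α y * f y = psi α (1 : GL (Idx n) F) * (phiQuot α y * f y) := by
    intro y
    rw [phiQuot_eq]
    field_simp
  have hint' : Integrable (fun y => psiQuot α y * f y) μ := by
    simp only [hpsi]
    exact hint.const_mul _
  obtain ⟨h2, h3⟩ := integral_psiQuot_mul hF hα hC hf hX hint'
  refine ⟨h2, ?_, ?_⟩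
  · simp only [hpsi]
    rw [integral_const_mul, ← mul_assoc, one_div, inv_mul_cancel₀ h1, one_mul]
  · rw [h3, psi_one hF B hα]
    ring

theorem integrableOn_of_phiQuot [CharZero F] (hF : IsNormalizedNorm F) {μ : Measure (ThetaQuot B)}
    {α : ℂ} (hα : 0 < α.re) {f : ThetaQuot B → ℂ} (hf : AEStronglyMeasurable f μ)
    (hint : Integrable (fun y => phiQuot α y * f y) μ) (i : ℕ) : IntegrableOn f (ballSet B i) μ := by
  have h1 := psi_one_ne_zero hF B hα
  have h2 : Integrable (fun y => geomWeight (fun i : ℕ => ballSet B (i : ℤ)) (zpar F α) y * f y) μ := by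
    refine (hint.const_mul (psi α (1 : GL (Idx n) F))).congr (Filter.Eventually.of_forall fun y => ?_)
    simp only [phiQuot_eq, psiQuot_eq hF hα]
    field_simp
  exact ((integrable_geomWeight_iff (fun i => (isClosed_ballSet i).measurableSet) monotone_ballSet
    iUnion_ballSet (zpar_ne_zero α) (norm_zpar_lt_one hα) hf).mp h2).1 i

/-- Convergence of the local factor for functions whose integrals over balls grow at most
exponentially. -/
theorem integrable_phiQuot_mul [CharZero F] (hF : IsNormalizedNorm F) {μ : Measure (ThetaQuot B)}
    {α : ℂ} (hα : 0 < α.re) {f : ThetaQuot B → ℂ} (hf : AEStronglyMeasurable f μ)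
    (hfi : ∀ i : ℕ, IntegrableOn f (ballSet B i) μ) {K A : ℝ}
    (hfK : ∀ i : ℕ, ∫ y in ballSet B i, ‖f y‖ ∂μ ≤ K * A ^ i) (hA : 0 ≤ A) (hαA : ‖zpar F α‖ * A < 1) :
    Integrable (fun y => phiQuot α y * f y) μ := by
  have hlt := norm_zpar_lt_one (F := F) hα
  have hD : ∀ i : ℕ, MeasurableSet (ballSet B (i : ℤ)) := fun i => (isClosed_ballSet i).measurableSet
  have h : Integrable (fun y => psiQuot α y * f y) μ := by
    simp only [psiQuot_eq hF hα]
    refine (integrable_geomWeight_iff hD monotone_ballSet iUnion_ballSet (zpar_ne_zero α) hlt hf).mpr ⟨hfi, ?_⟩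
    have hs : Summable fun i : ℕ => K * (‖zpar F α‖ * A) ^ i :=
      (summable_geometric_of_lt_one (by positivity) hαA).mul_left K
    refine Summable.of_nonneg_of_le (fun i => by positivity) (fun i => ?_) hs
    rw [mul_pow, mul_left_comm]
    exact mul_le_mul_of_nonneg_left (hfK i) (by positivity)
  refine (h.const_mul (psi α (1 : GL (Idx n) F))⁻¹).congr (Filter.Eventually.of_forall fun y => ?_)
  simp only [phiQuot_eq]
  ring

theorem exists_norm_zpar_mul_lt (A : ℝ) :
    ∃ σ : ℝ, 0 ≤ σ ∧ ∀ α : ℂ, σ < α.re → ‖zpar F α‖ * A < 1 := by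
  obtain ⟨m, hm⟩ := pow_unbounded_of_one_lt A (one_lt_qR (F := F))
  refine ⟨m, Nat.cast_nonneg m, fun α hα => ?_⟩
  have h1 : ‖zpar F α‖ ≤ (qR F ^ m)⁻¹ := by
    rw [norm_zpar, ← Real.rpow_natCast, ← Real.rpow_neg qR_pos.le]
    exact Real.rpow_le_rpow_of_exponent_le one_lt_qR.le (by linarith)
  have h2 : 0 < qR F ^ m := pow_pos qR_pos m
  have h3 : 0 < ‖zpar F α‖ := norm_pos_iff.mpr (zpar_ne_zero α)
  calc ‖zpar F α‖ * A < ‖zpar F α‖ * qR F ^ m := mul_lt_mul_of_pos_left hm h3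
    _ ≤ (qR F ^ m)⁻¹ * qR F ^ m := mul_le_mul_of_nonneg_right h1 h2.le
    _ = 1 := inv_mul_cancel₀ h2.ne'

end Unfolding

/-! ### Stability of the coefficients of X -/

section Series

variable {F : Type*} [NontriviallyNormedField F] [IsUltrametricDist F] [ProperSpace F]
  [MeasurableSpace F] [BorelSpace F] {n : ℕ} {B : Matrix (Fin n) (Fin n) F}

theorem hasSum_xCoeffInt_iff {ρ : F} {z S : ℂ} :
    HasSum (fun l : ℤ => (xCoeffInt B ρ l : ℂ) * z ^ l) S ↔
      HasSum (fun l : ℕ => z ^ l * (XCoeff B l ρ : ℂ)) S := by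
  have hinj : Function.Injective fun i : ℕ => (i : ℤ) := Nat.cast_injective
  rw [← hinj.hasSum_iff]
  · refine iff_of_eq (congrArg (fun g => HasSum g S) (funext fun l => ?_))
    simp [xCoeffInt, mul_comm]
  · intro j hj
    have : ¬ 0 ≤ j := fun h1 => hj (by
      obtain ⟨k, rfl⟩ := Int.eq_ofNat_of_zero_le h1
      exact ⟨k, rfl⟩)
    simp [xCoeffInt, this]

theorem IsStable.smul_shift {q : ℝ} {c : ℤ → ℝ} {N J : ℤ} (h : IsStable q c N J) (a : ℝ) (i : ℤ) :
    IsStable q (fun l => a * c (l + i)) (N + i) (J - i) where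
  zero j hj := by rw [h.zero _ (by omega), mul_zero]
  step j hj := by rw [show j + 1 + i = j + i + 1 by ring, h.step _ (by omega), mul_div_assoc]

theorem IsStable.mono {q : ℝ} {c : ℤ → ℝ} {N J N' J' : ℤ} (h : IsStable q c N J) (hN : N ≤ N') (hJ : J ≤ J') :
    IsStable q c N' J' where
  zero j hj := h.zero j (by omega)
  step j hj := h.step j (by omega)

theorem exists_isStable_levelMass [CharZero F] (hF : IsNormalizedNorm F) (hB : B.IsSymm) (hBdet : IsUnit B.det)
    (κ : Measure (groupK B)) [IsProbabilityMeasure κ] [κ.IsMulLeftInvariant] :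
    ∃ c0 : ℕ, ∀ N : ℕ, ∀ y ∈ ballSet B N, IsStable (qR F) (levelMass κ y) N (3 * N + c0) ∧
      κ {k | ucoord (y.act (k : groupH B)) = 0} = 0 := by
  obtain ⟨c0, hc0, h⟩ := exists_stable hF hB hBdet κ
  obtain ⟨c, rfl⟩ := Int.eq_ofNat_of_zero_le hc0
  refine ⟨c, fun N y hy => ⟨⟨fun j hj => levelMass_eq_zero κ hy hj, ?_⟩, ?_⟩⟩
  · exact (h N (Int.natCast_nonneg N) y hy).1
  · exact (h N (Int.natCast_nonneg N) y hy).2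

/-- The masses in a ball are averages of `levelMass` over it, and the recursion there holds
pointwise with one threshold for the whole ball. -/
theorem isStable_ballMass [CharZero F] (hB : B.IsSymm) (hBdet : IsUnit B.det)
    {μ : Measure (ThetaQuot B)} [IsFiniteMeasureOnCompacts μ]
    (hμ : ∀ h : groupH B, μ.map (fun y => y.act h) = μ)
    (κ : Measure (groupK B)) [IsProbabilityMeasure κ] {c0 N : ℕ}
    (h : ∀ y ∈ ballSet B N, IsStable (qR F) (levelMass κ y) N (3 * N + c0)) {i : ℤ} (hi : i ≤ N) :
    IsStable (qR F) (ballMass μ i) N (3 * N + c0) where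
  zero j hj := by
    rw [← setIntegral_levelMass hB hBdet hμ κ]
    exact setIntegral_eq_zero_of_forall_eq_zero fun y hy => (h y (ballSet_mono hi hy)).zero j hj
  step j hj := by
    rw [← setIntegral_levelMass hB hBdet hμ κ, ← setIntegral_levelMass hB hBdet hμ κ,
      ← integral_div]
    exact setIntegral_congr_fun (isClosed_ballSet i).measurableSet
      fun y hy => (h y (ballSet_mono hi hy)).step j hj

/-- Reading `ballMass_eq` backwards, with the positive constant divided out, transfers rationality
from the group side to X; no congruences have to be counted. -/
theorem exists_isStable_xCoeffInt [CharZero F] (hF : IsNormalizedNorm F) (hB : B.IsSymm) (hBdet : IsUnit B.det)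
    {μ : Measure (ThetaQuot B)} [IsFiniteMeasureOnCompacts μ]
    (hμ : ∀ h : groupH B, μ.map (fun y => y.act h) = μ)
    (κ : Measure (groupK B)) [IsProbabilityMeasure κ] [κ.IsMulLeftInvariant]
    (hC : 0 < chartConst μ) (t : Fˣ) :
    ∃ N J : ℤ, IsStable (qR F) (xCoeffInt B ((t : F) ^ 2)) N J := by
  obtain ⟨c0, h⟩ := exists_isStable_levelMass hF hB hBdet κ
  -- The valuation of `t` may be negative, while the uniform threshold is indexed by natural
  -- numbers; hence the larger ball.
  have h1 := isStable_ballMass hB hBdet hμ κ (fun y hy => (h _ y hy).1) (Int.self_le_toNat (ord (t : F)))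
  have h2 := h1.smul_shift (chartConst μ * qR F ^ (n * ord (t : F)))⁻¹ (-ord (t : F))
  refine ⟨_, _, (congrArg (fun c => IsStable (qR F) c _ _) (funext fun l => ?_)).mp h2⟩
  have : chartConst μ * qR F ^ (n * ord (t : F)) ≠ 0 := (mul_pos hC (qR_zpow_pos _)).ne'
  rw [ballMass_eq hF hB hBdet hμ (norm_eq_ord hF t.ne_zero), neg_add_cancel_right, inv_mul_cancel_left₀ this]

theorem XSeries_eq_stableSum {ρ : F} {N J : ℤ} (h : IsStable (qR F) (xCoeffInt B ρ) N J) {β : ℂ} (hβ : -1 < β.re) :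
    XSeries B β ρ = stableSum (qR F) (xCoeffInt B ρ) (zpar F β) :=
  (hasSum_xCoeffInt_iff.mp (h.hasSum (zpar_ne_zero β) qR_pos (norm_zpar_lt hβ))).tsum_eq

end Series

/-! ### The functions `f` and their spherical means -/

section Generator

variable {F : Type*} [NontriviallyNormedField F] [IsUltrametricDist F] [ProperSpace F]
  [MeasurableSpace F] [BorelSpace F] {n : ℕ} {B : Matrix (Fin n) (Fin n) F}

theorem xCoeffInt_le_one (ρ : F) (l : ℤ) : xCoeffInt B ρ l ≤ 1 := by
  rw [xCoeffInt]
  split_ifs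
  · refine ENNReal.toReal_le_of_le_ofReal zero_le_one ?_
    rw [ENNReal.ofReal_one]
    exact ENNReal.div_le_of_le_mul (by rw [one_mul]; exact measure_mono fun a ha => ha.1)
  · exact zero_le_one

theorem measurable_ord_ucoord (hF : IsNormalizedNorm F) :
    Measurable fun y : ThetaQuot B => ord (ucoord y) :=
  (measurable_ord hF).comp measurable_ucoord

theorem ae_ne_zero {Ω : Type*} [MeasurableSpace Ω] {ν : Measure Ω} {u : Ω → F}
    (h0 : ν {x | u x = 0} = 0) : ∀ᵐ x ∂ν, u x ≠ 0 := by
  rw [ae_iff]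
  simpa only [not_not, ne_eq] using h0

theorem ord_preimage_real (hF : IsNormalizedNorm F) {Ω : Type*} [MeasurableSpace Ω] {ν : Measure Ω}
    {u : Ω → F} (h0 : ν {x | u x = 0} = 0) (l : ℤ) :
    ν.real ((fun x => ord (u x)) ⁻¹' {l}) = ν.real {x | ‖u x‖ = qR F ^ (-l)} := by
  refine measureReal_congr (Filter.eventuallyEq_set.mpr ?_)
  filter_upwards [ae_ne_zero h0] with x hx
  exact ord_eq_iff hF hx

theorem restrict_ucoord_eq_zero {μ : Measure (ThetaQuot B)} (h0 : μ {y | ucoord y = 0} = 0)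
    (S : Set (ThetaQuot B)) : (μ.restrict S) {y | ucoord y = 0} = 0 :=
  le_antisymm ((Measure.restrict_apply_le _ _).trans_eq h0) bot_le

theorem restrict_ord_real (hF : IsNormalizedNorm F) {μ : Measure (ThetaQuot B)}
    (h0 : μ {y | ucoord y = 0} = 0) (i l : ℤ) :
    (μ.restrict (ballSet B i)).real ((fun y => ord (ucoord y)) ⁻¹' {l}) = ballMass μ i l := by
  rw [ord_preimage_real hF (restrict_ucoord_eq_zero h0 _), measureReal_restrict_apply (measurableSet_norm_eq _), ballMass, Set.inter_comm]

theorem IsGenerator.ae_eq [CharZero F] (hF : IsNormalizedNorm F) (hB : B.IsSymm) (hBdet : IsUnit B.det)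
    {β : ℂ} {f : ThetaQuot B → ℂ} (hf : IsGenerator β f) {μ : Measure (ThetaQuot B)}
    (h0 : μ {y | ucoord y = 0} = 0) : f =ᵐ[μ] fun y => zpar F β ^ ord (ucoord y) := by
  filter_upwards [ae_ne_zero h0] with y hy
  rw [hf.apply_eq hB hBdet hy, absPow_eq hF hy]

theorem aestronglyMeasurable_zpow_ord (hF : IsNormalizedNorm F) (z : ℂ) (μ : Measure (ThetaQuot B)) :
    AEStronglyMeasurable (fun y => z ^ ord (ucoord y)) μ :=
  ((measurable_of_countable fun j : ℤ => z ^ j).comp (measurable_ord_ucoord hF)).aestronglyMeasurable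

theorem integrableOn_zpow_iff [CharZero F] (hF : IsNormalizedNorm F) (hB : B.IsSymm) (hBdet : IsUnit B.det)
    {μ : Measure (ThetaQuot B)} [IsFiniteMeasureOnCompacts μ] (h0 : μ {y | ucoord y = 0} = 0)
    (i : ℤ) (z : ℂ) :
    IntegrableOn (fun y => z ^ ord (ucoord y)) (ballSet B i) μ ↔
      Summable fun l => ballMass μ i l * ‖z ^ l‖ := by
  have hfin : ∀ j, (μ.restrict (ballSet B i)) ((fun y => ord (ucoord y)) ⁻¹' {j}) ≠ ⊤ := fun j =>
    (lt_of_le_of_lt ((measure_mono (Set.subset_univ _)).trans_eq (Measure.restrict_apply_univ _))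
      (measure_ballSet_lt_top hB hBdet μ i)).ne
  have h := integrable_level_iff (measurable_ord_ucoord hF) hfin (fun j : ℤ => z ^ j)
  simp only [restrict_ord_real hF h0] at h
  exact h

theorem hasSum_setIntegral_zpow (hF : IsNormalizedNorm F)
    {μ : Measure (ThetaQuot B)} (h0 : μ {y | ucoord y = 0} = 0)
    {i : ℤ} {z : ℂ} (h : IntegrableOn (fun y => z ^ ord (ucoord y)) (ballSet B i) μ) :
    HasSum (fun l => (ballMass μ i l : ℂ) * z ^ l) (∫ y in ballSet B i, z ^ ord (ucoord y) ∂μ) := by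
  have h1 := hasSum_level (measurable_ord_ucoord hF) (fun j : ℤ => z ^ j) h
  simp only [restrict_ord_real hF h0, Complex.real_smul] at h1
  exact h1

/-- For `‖z‖ < q`, the integrals of `|z| ^ ord` over the balls grow at most exponentially. -/
theorem exists_integral_zpow_le [CharZero F] (hF : IsNormalizedNorm F) (hB : B.IsSymm) (hBdet : IsUnit B.det)
    {μ : Measure (ThetaQuot B)} [IsFiniteMeasureOnCompacts μ]
    (hμ : ∀ h : groupH B, μ.map (fun y => y.act h) = μ)
    (κ : Measure (groupK B)) [IsProbabilityMeasure κ] [κ.IsMulLeftInvariant]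
    {z : ℂ} (hz : z ≠ 0) (hzq : ‖z‖ < qR F) :
    (∀ i : ℕ, IntegrableOn (fun y => z ^ ord (ucoord y)) (ballSet B i) μ) ∧
      ∃ K A : ℝ, 0 ≤ A ∧ ∀ i : ℕ, ∫ y in ballSet B i, ‖z ^ ord (ucoord y)‖ ∂μ ≤ K * A ^ i := by
  have h0 := measure_ucoord_eq_zero hF hB hBdet hμ κ
  obtain ⟨c0, hc⟩ := exists_isStable_levelMass hF hB hBdet κ
  have hst : ∀ i : ℕ, IsStable (qR F) (ballMass μ i) i (3 * i + c0) := fun i =>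
    isStable_ballMass hB hBdet hμ κ (fun y hy => (hc i y hy).1) le_rfl
  have hint : ∀ w : ℂ, w ≠ 0 → ‖w‖ < qR F → ∀ i : ℕ,
      IntegrableOn (fun y => w ^ ord (ucoord y)) (ballSet B i) μ := by
    intro w hw hwq i
    rw [integrableOn_zpow_iff hF hB hBdet h0]
    refine ((hst i).summable hw qR_pos hwq).norm.congr fun l => ?_
    rw [norm_mul, Complex.norm_real, Real.norm_of_nonneg (show 0 ≤ ballMass μ i l from measureReal_nonneg)]
  refine ⟨hint z hz hzq, ?_⟩
  -- The integral of the absolute value is itself a generating function, at the point |z|, so the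
  -- rational bound applies to it.
  set w : ℂ := ((‖z‖ : ℝ) : ℂ)
  have hwn : ‖w‖ = ‖z‖ := by simp [w]
  have hw : w ≠ 0 := norm_ne_zero_iff.mp (by rw [hwn]; exact norm_ne_zero_iff.mpr hz)
  have hwq : ‖w‖ < qR F := hwn ▸ hzq
  set R := max ‖w‖ ‖w‖⁻¹
  have hR : 0 ≤ R := le_max_of_le_left (norm_nonneg _)
  refine ⟨‖(1 - w / (qR F : ℝ))⁻¹‖ * ((c0 + 4) * (2 * R ^ c0)) * chartConst μ,
    qR F ^ n * (2 * R ^ 3), by have := qR_pos (F := F); positivity, fun i => ?_⟩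
  have h1 : ∫ y in ballSet B i, w ^ ord (ucoord y) ∂μ = stableSum (qR F) (ballMass μ i) w :=
    (hasSum_setIntegral_zpow hF h0 (hint w hw hwq i)).unique ((hst i).hasSum hw qR_pos hwq)
  have h2 : ((∫ y in ballSet B i, ‖z ^ ord (ucoord y)‖ ∂μ : ℝ) : ℂ) = stableSum (qR F) (ballMass μ i) w := by
    rw [← h1, ← integral_complex_ofReal]
    refine integral_congr_ae (Filter.Eventually.of_forall fun y => ?_)
    simp [w]
  -- The trivial bound X_l ≤ 1 is enough, since only exponential growth in `i` matters.
  have hM : ∀ j, |ballMass μ i j| ≤ chartConst μ * qR F ^ (n * i) := by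
    intro j
    obtain ⟨t, ht⟩ := exists_norm_eq hF (-(i : ℤ))
    have hq : (0 : ℝ) ≤ chartConst μ * qR F ^ (n * i) :=
      mul_nonneg measureReal_nonneg (pow_nonneg qR_pos.le _)
    rw [abs_of_nonneg (show 0 ≤ ballMass μ i j from measureReal_nonneg), ballMass_eq hF hB hBdet hμ ht j]
    have h3 : qR F ^ ((n : ℤ) * i) = qR F ^ (n * i) := by
      rw [← zpow_natCast]; push_cast; rfl
    rw [h3]
    exact mul_le_of_le_one_right hq (xCoeffInt_le_one _ _)
  have h3 := (hst i).norm_stableSum_le one_lt_qR.le hM hw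
  rw [← h2, Complex.norm_real, Real.norm_of_nonneg (integral_nonneg fun y => norm_nonneg _)] at h3
  refine h3.trans_eq ?_
  rw [mul_pow, ← pow_mul]
  ring

/-- The integral of `f` over a ball, in terms of `X`. -/
theorem setIntegral_generator [CharZero F] (hF : IsNormalizedNorm F) (hB : B.IsSymm) (hBdet : IsUnit B.det)
    {μ : Measure (ThetaQuot B)} [IsFiniteMeasureOnCompacts μ]
    (hμ : ∀ h : groupH B, μ.map (fun y => y.act h) = μ) (h0 : μ {y | ucoord y = 0} = 0)
    (hC : 0 < chartConst μ) {β : ℂ} {f : ThetaQuot B → ℂ} (hf : IsGenerator β f) {t : Fˣ} {i : ℕ}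
    (ht : ‖(t : F)‖ = qR F ^ (-(i : ℤ))) (hint : IntegrableOn f (ballSet B i) μ) :
    (Summable fun l : ℕ => ((residueCard F : ℂ) ^ (-β)) ^ l * (XCoeff B l ((t : F) ^ 2) : ℂ)) ∧
    ∫ y in ballSet B i, f y ∂μ
      = (chartConst μ : ℂ) * (qR F : ℂ) ^ (n * i) * (zpar F β ^ i)⁻¹ * XSeries B β ((t : F) ^ 2) := by
  have hae := hf.ae_eq hF hB hBdet h0
  have h1 := hasSum_setIntegral_zpow hF h0 (hint.congr_fun_ae (ae_restrict_of_ae hae))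
  rw [← integral_congr_ae (ae_restrict_of_ae hae)] at h1
  set S := ∫ y in ballSet B i, f y ∂μ
  set a : ℂ := (chartConst μ : ℂ) * (qR F : ℂ) ^ (n * i) * (zpar F β ^ i)⁻¹
  have hz := zpar_ne_zero (F := F) β
  have hq : ((qR F : ℝ) : ℂ) ≠ 0 := by exact_mod_cast (qR_pos (F := F)).ne'
  have hC' : (chartConst μ : ℂ) ≠ 0 := by exact_mod_cast hC.ne'
  have ha : a ≠ 0 := mul_ne_zero (mul_ne_zero hC' (pow_ne_zero _ hq)) (inv_ne_zero (pow_ne_zero _ hz))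
  -- Completing the exponent from l to l + i is what takes the factor z^(-i) out.
  have h2 : HasSum (fun l : ℤ => (xCoeffInt B ((t : F) ^ 2) (l + i) : ℂ) * zpar F β ^ (l + i)) (a⁻¹ * S) := by
    refine (h1.mul_left a⁻¹).congr_fun fun l => ?_
    have h3 : (ballMass μ i l : ℂ) * zpar F β ^ l
        = a * ((xCoeffInt B ((t : F) ^ 2) (l + i) : ℂ) * zpar F β ^ (l + i)) := by
      have h4 : ((qR F ^ ((n : ℤ) * i) : ℝ) : ℂ) = (qR F : ℂ) ^ (n * i) := by
        rw [← Nat.cast_mul, zpow_natCast, Complex.ofReal_pow]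
      rw [ballMass_eq hF hB hBdet hμ ht l, Complex.ofReal_mul, Complex.ofReal_mul, h4, zpow_add₀ hz, zpow_natCast]
      simp only [a]
      field_simp
    rw [h3, inv_mul_cancel_left₀ ha]
  have h3 : HasSum (fun l : ℤ => (xCoeffInt B ((t : F) ^ 2) l : ℂ) * zpar F β ^ l) (a⁻¹ * S) :=
    (Equiv.addRight (i : ℤ)).hasSum_iff (f := fun l : ℤ => (xCoeffInt B ((t : F) ^ 2) l : ℂ) * zpar F β ^ l) |>.mp h2
  have h4 := hasSum_xCoeffInt_iff.mp h3
  refine ⟨h4.summable, ?_⟩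
  rw [show XSeries B β ((t : F) ^ 2) = a⁻¹ * S from h4.tsum_eq, mul_inv_cancel_left₀ ha]

end Generator

/-! ### Spherical means and their continuation -/

section Spherical

variable {F : Type*} [NontriviallyNormedField F] [IsUltrametricDist F] [ProperSpace F]
  [MeasurableSpace F] [BorelSpace F] {n : ℕ} {B : Matrix (Fin n) (Fin n) F}

/-- For almost every k the integrand is z^ord(u(yk)), so the mean is the generating function of the
level masses, convergent because |z| < q. -/
theorem sphericalMean_eq [CharZero F] (hF : IsNormalizedNorm F) (hB : B.IsSymm) (hBdet : IsUnit B.det)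
    (κ : Measure (groupK B)) [IsProbabilityMeasure κ] {y : ThetaQuot B} {N J : ℤ}
    (hy : IsStable (qR F) (levelMass κ y) N J) (h0 : κ {k : groupK B | ucoord (y.act (k : groupH B)) = 0} = 0)
    {β : ℂ} (hβ : -1 < β.re) {f : ThetaQuot B → ℂ} (hf : IsGenerator β f) :
    sphericalMean κ f y = stableSum (qR F) (levelMass κ y) (zpar F β) := by
  have ho : Measurable fun k : groupK B => ord (ucoord (y.act (k : groupH B))) :=
    (measurable_ord hF).comp (continuous_ucoord_act y).measurable
  have hreal : ∀ l, κ.real ((fun k : groupK B => ord (ucoord (y.act (k : groupH B)))) ⁻¹' {l}) = levelMass κ y l :=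
    ord_preimage_real hF h0
  have hint : Integrable (fun k : groupK B => zpar F β ^ ord (ucoord (y.act (k : groupH B)))) κ := by
    refine (integrable_level_iff ho (fun j => measure_ne_top _ _) (fun j : ℤ => zpar F β ^ j)).mpr ?_
    refine (hy.summable (zpar_ne_zero β) qR_pos (norm_zpar_lt hβ)).norm.congr fun l => ?_
    rw [hreal, norm_mul, Complex.norm_real, Real.norm_of_nonneg (levelMass_nonneg κ y l)]
  have hs := hasSum_level ho (fun j : ℤ => zpar F β ^ j) hint
  simp only [hreal, Complex.real_smul] at hs
  rw [← hs.unique (hy.hasSum (zpar_ne_zero β) qR_pos (norm_zpar_lt hβ)), sphericalMean]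
  refine integral_congr_ae ?_
  filter_upwards [ae_ne_zero h0] with k hk
  rw [hf.apply_eq hB hBdet hk, absPow_eq hF hk]

/-- The range of the finite sum depends on `y`, so the function is written as a pointwise limit of
sums over fixed ranges, eventually constant at each point. -/
theorem measurable_stableSum [CharZero F] (hF : IsNormalizedNorm F) (hB : B.IsSymm) (hBdet : IsUnit B.det)
    (κ : Measure (groupK B)) [IsProbabilityMeasure κ] [κ.IsMulLeftInvariant] (z : ℂ) :
    Measurable fun y : ThetaQuot B => stableSum (qR F) (levelMass κ y) z := by
  obtain ⟨c0, hc⟩ := exists_isStable_levelMass hF hB hBdet κ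
  refine measurable_of_tendsto_metrizable (f := fun (m : ℕ) y => (1 - z / (qR F : ℝ))⁻¹ *
    ∑ j ∈ Finset.Icc (-(m : ℤ)) m, ((levelMass κ y j - levelMass κ y (j - 1) / qR F : ℝ) : ℂ) * z ^ j)
    (fun m => ?_) (tendsto_pi_nhds.mpr fun y => ?_)
  · refine (Finset.measurable_sum _ fun j _ => ?_).const_mul _
    exact (Complex.measurable_ofReal.comp ((measurable_levelMass κ j).sub
      ((measurable_levelMass κ (j - 1)).div_const _))).mul_const _
  · obtain ⟨N, hN⟩ := Set.mem_iUnion.mp ((iUnion_ballSet (B := B)).symm ▸ Set.mem_univ y)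
    refine tendsto_const_nhds.congr' ?_
    filter_upwards [Filter.eventually_ge_atTop (3 * N + c0)] with m hm
    exact ((hc N y hN).1.mono (by omega) (by omega)).stableSum_eq z

/-- On one ball all the sums run over a common finite range, so integration is termwise and the
identity holds for every nonzero `z`. This replaces any analytic continuation of integrals. -/
theorem setIntegral_stableSum [CharZero F] (hF : IsNormalizedNorm F) (hB : B.IsSymm) (hBdet : IsUnit B.det)
    {μ : Measure (ThetaQuot B)} [IsFiniteMeasureOnCompacts μ]
    (hμ : ∀ h : groupH B, μ.map (fun y => y.act h) = μ)
    (κ : Measure (groupK B)) [IsProbabilityMeasure κ] [κ.IsMulLeftInvariant] {z : ℂ} (hz : z ≠ 0)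
    {t : Fˣ} {i : ℕ} (ht : ‖(t : F)‖ = qR F ^ (-(i : ℤ))) :
    ∫ y in ballSet B i, stableSum (qR F) (levelMass κ y) z ∂μ
      = (chartConst μ : ℂ) * (qR F : ℂ) ^ (n * i) * (z ^ i)⁻¹ * stableSum (qR F) (xCoeffInt B ((t : F) ^ 2)) z := by
  obtain ⟨c0, hc⟩ := exists_isStable_levelMass hF hB hBdet κ
  have hst : IsStable (qR F) (ballMass μ i) i (3 * i + c0) :=
    isStable_ballMass hB hBdet hμ κ (fun y hy => (hc i y hy).1) le_rfl
  have h1 : ∫ y in ballSet B i, stableSum (qR F) (levelMass κ y) z ∂μ = stableSum (qR F) (ballMass μ i) z := by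
    rw [setIntegral_congr_fun (isClosed_ballSet _).measurableSet fun y hy => (hc i y hy).1.stableSum_eq z,
      hst.stableSum_eq, integral_const_mul, integral_finsetSum]
    · congr 1
      refine Finset.sum_congr rfl fun j _ => ?_
      rw [integral_mul_const, integral_complex_ofReal, integral_sub (integrableOn_levelMass hB hBdet κ i j)
        ((integrableOn_levelMass hB hBdet κ i (j - 1)).div_const _), integral_div,
        setIntegral_levelMass hB hBdet hμ κ, setIntegral_levelMass hB hBdet hμ κ]
    · intro j _
      exact (Integrable.ofReal ((integrableOn_levelMass hB hBdet κ i j).sub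
        ((integrableOn_levelMass hB hBdet κ i (j - 1)).div_const _))).mul_const _
  have h2 : ballMass μ i = fun l => chartConst μ * qR F ^ ((n : ℤ) * i) * xCoeffInt B ((t : F) ^ 2) (l + i) :=
    funext fun l => ballMass_eq hF hB hBdet hμ ht l
  have h4 : ((qR F ^ ((n : ℤ) * i) : ℝ) : ℂ) = (qR F : ℂ) ^ (n * i) := by
    rw [← Nat.cast_mul, zpow_natCast, Complex.ofReal_pow]
  rw [h1, h2, stableSum_smul_shift _ _ _ hz, Complex.ofReal_mul, h4, _root_.zpow_neg, zpow_natCast]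

theorem exists_integral_stableSum_le [CharZero F] (hF : IsNormalizedNorm F) (hB : B.IsSymm) (hBdet : IsUnit B.det)
    {μ : Measure (ThetaQuot B)} [IsFiniteMeasureOnCompacts μ]
    (hμ : ∀ h : groupH B, μ.map (fun y => y.act h) = μ)
    (κ : Measure (groupK B)) [IsProbabilityMeasure κ] [κ.IsMulLeftInvariant] {z : ℂ} (hz : z ≠ 0) :
    (∀ i : ℕ, IntegrableOn (fun y => stableSum (qR F) (levelMass κ y) z) (ballSet B i) μ) ∧
      ∃ K A : ℝ, 0 ≤ A ∧ ∀ i : ℕ,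
        ∫ y in ballSet B i, ‖stableSum (qR F) (levelMass κ y) z‖ ∂μ ≤ K * A ^ i := by
  obtain ⟨c0, hc⟩ := exists_isStable_levelMass hF hB hBdet κ
  -- At z = 1 the earlier estimate bounds the volumes of the balls themselves.
  obtain ⟨-, K, A, hA, hK⟩ := exists_integral_zpow_le hF hB hBdet hμ κ one_ne_zero
    (by rw [norm_one]; exact one_lt_qR)
  simp only [_root_.one_zpow, norm_one, setIntegral_const, smul_eq_mul, mul_one] at hK
  set R := max ‖z‖ ‖z‖⁻¹
  have hR : 0 ≤ R := le_max_of_le_left (norm_nonneg _)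
  set L := ‖(1 - z / (qR F : ℝ))⁻¹‖ * ((c0 + 4) * (2 * R ^ c0))
  have hL : 0 ≤ L := by positivity
  have hbound : ∀ i : ℕ, ∀ y ∈ ballSet B i, ‖stableSum (qR F) (levelMass κ y) z‖ ≤ L * (2 * R ^ 3) ^ i := by
    intro i y hy
    have := (hc i y hy).1.norm_stableSum_le one_lt_qR.le (M := 1)
      (fun j => by rw [abs_of_nonneg (levelMass_nonneg κ y j)]; exact levelMass_le_one κ y j) hz
    rwa [mul_one] at this
  have hint : ∀ i : ℕ, IntegrableOn (fun y => stableSum (qR F) (levelMass κ y) z) (ballSet B i) μ := fun i =>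
    Measure.integrableOn_of_bounded (measure_ballSet_lt_top hB hBdet μ i).ne
      (measurable_stableSum hF hB hBdet κ z).aestronglyMeasurable
      ((ae_restrict_iff' (isClosed_ballSet _).measurableSet).mpr (Filter.Eventually.of_forall (hbound i)))
  refine ⟨hint, L * K, 2 * R ^ 3 * A, by positivity, fun i => ?_⟩
  have h1 := norm_setIntegral_le_of_norm_le_const (f := fun y => ‖stableSum (qR F) (levelMass κ y) z‖)
    (measure_ballSet_lt_top hB hBdet μ i) (C := L * (2 * R ^ 3) ^ i)
    (fun y hy => by rw [norm_norm]; exact hbound i y hy)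
  calc ∫ y in ballSet B i, ‖stableSum (qR F) (levelMass κ y) z‖ ∂μ
      ≤ L * (2 * R ^ 3) ^ i * μ.real (ballSet B i) := (le_abs_self _).trans h1
    _ ≤ L * (2 * R ^ 3) ^ i * (K * A ^ i) := mul_le_mul_of_nonneg_left (hK i) (by positivity)
    _ = L * K * (2 * R ^ 3 * A) ^ i := by ring

end Spherical

end LocalPeriod

end

/-! ### Assembly of the four assertions -/

theorem mainTheorem3 {F : Type*} [NontriviallyNormedField F] [IsUltrametricDist F]
    [ProperSpace F] [CharZero F] [MeasurableSpace F] [BorelSpace F]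
    (hF : LocalPeriod.IsNormalizedNorm F)
    (n : ℕ) (B : Matrix (Fin n) (Fin n) F) (hBsymm : B.IsSymm) (hBdet : IsUnit B.det)
    -- a nonzero right `H`-invariant Radon measure on `Θ \ H`
    (μ : MeasureTheory.Measure (LocalPeriod.ThetaQuot B))
    [MeasureTheory.IsFiniteMeasureOnCompacts μ] (hμ0 : μ ≠ 0)
    (hμ : ∀ h : LocalPeriod.groupH B, μ.map (fun y => y.act h) = μ)
    -- the invariant probability measure on `K^H`
    (κ : MeasureTheory.Measure (LocalPeriod.groupK B))
    [MeasureTheory.IsProbabilityMeasure κ] [κ.IsMulLeftInvariant] :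
    -- the value `ψ(1)`, and `φ_ω(p) = |t| ^ α` when `e p = e / t`
    (∀ α : ℂ, 0 < α.re →
      LocalPeriod.psi α (1 : GL (LocalPeriod.Idx n) F)
        = LocalPeriod.absPow (2 : F) α * LocalPeriod.zetaFactor F α ∧
      LocalPeriod.phi α (1 : GL (LocalPeriod.Idx n) F) = 1 ∧
      ∀ p ∈ LocalPeriod.groupG B, ∀ t : Fˣ,
        Matrix.vecMul (LocalPeriod.eVec F n)
            (p : Matrix (LocalPeriod.Idx n) (LocalPeriod.Idx n) F)
          = ((t⁻¹ : Fˣ) : F) • LocalPeriod.eVec F n →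
        ∀ g ∈ LocalPeriod.groupG B,
          LocalPeriod.phi α (p * g) = LocalPeriod.absPow (t : F) α * LocalPeriod.phi α g) ∧
    -- absolute convergence of the local factor
    (∀ β : ℂ, -1 < β.re → ∃ σ : ℝ, ∀ α : ℂ, σ < α.re →
      ∀ f : LocalPeriod.ThetaQuot B → ℂ, LocalPeriod.IsGenerator β f →
        MeasureTheory.Integrable (fun y => LocalPeriod.phiQuot α y * f y) μ) ∧
    ∃ C : ℝ, 0 < C ∧
      -- the value of the local factor, wherever it converges absolutely
      (∀ (α β : ℂ) (f : LocalPeriod.ThetaQuot B → ℂ), 0 < α.re →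
        LocalPeriod.IsGenerator β f →
        MeasureTheory.Integrable (fun y => LocalPeriod.phiQuot α y * f y) μ →
        LocalPeriod.PiConverges B (α - β - n) β ∧
        ∫ y, LocalPeriod.phiQuot α y * f y ∂μ
          = 1 / LocalPeriod.psi α (1 : GL (LocalPeriod.Idx n) F)
              * ∫ y, LocalPeriod.psiQuot α y * f y ∂μ ∧
        1 / LocalPeriod.psi α (1 : GL (LocalPeriod.Idx n) F)
              * ∫ y, LocalPeriod.psiQuot α y * f y ∂μ
          = (C : ℂ) * (LocalPeriod.PiIntegral B (α - β - n) β
              / (LocalPeriod.absPow (2 : F) α * LocalPeriod.zetaFactor F α))) ∧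
      -- the local factor of the spherical vector `f'` with `f'(1) = 1`, for all parameters `β`,
      -- by continuation in `β` of the spherical vector and of `X`
      (∀ f : ℂ → LocalPeriod.ThetaQuot B → ℂ, (∀ β : ℂ, LocalPeriod.IsGenerator β (f β)) →
        ∃ (m : LocalPeriod.ThetaQuot B → ℂ → ℂ) (X : F → ℂ → ℂ),
          (∀ y, LocalPeriod.IsContinuation
            (fun β => LocalPeriod.sphericalMean κ (f β) y) (m y)) ∧
          (∀ t : Fˣ, LocalPeriod.IsContinuation
            (fun β => LocalPeriod.XSeries B β ((t : F) ^ 2)) (X ((t : F) ^ 2))) ∧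
          ∀ β : ℂ, (LocalPeriod.residueCard F : ℂ) ^ (-β - 1) ≠ 1 →
            m (LocalPeriod.ThetaQuot.mk 1) β ≠ 0 →
            ∃ σ : ℝ, ∀ α : ℂ, σ < α.re →
              ∀ f' : LocalPeriod.ThetaQuot B → ℂ,
                (∀ y, f' y = m y β / m (LocalPeriod.ThetaQuot.mk 1) β) →
                MeasureTheory.Integrable (fun y => LocalPeriod.phiQuot α y * f' y) μ ∧
                MeasureTheory.IntegrableOn
                  (LocalPeriod.PiIntegrand (fun ρ => X ρ β) (α - β - n))
                  (LocalPeriod.integralUnits F) (LocalPeriod.mulMeasure F) ∧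
                ∫ y, LocalPeriod.phiQuot α y * f' y ∂μ
                  = 1 / LocalPeriod.psi α (1 : GL (LocalPeriod.Idx n) F)
                      * ∫ y, LocalPeriod.psiQuot α y * f' y ∂μ ∧
                1 / LocalPeriod.psi α (1 : GL (LocalPeriod.Idx n) F)
                      * ∫ y, LocalPeriod.psiQuot α y * f' y ∂μ
                  = (C : ℂ) / m (LocalPeriod.ThetaQuot.mk 1) β
                      * (LocalPeriod.PiOf (fun ρ => X ρ β) (α - β - n)
                        / (LocalPeriod.absPow (2 : F) α * LocalPeriod.zetaFactor F α))) := by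
  have h0 := LocalPeriod.measure_ucoord_eq_zero hF hBsymm hBdet hμ κ
  have hC := LocalPeriod.chartConst_pos hF hBsymm hBdet hμ0 hμ h0
  have hC' : (LocalPeriod.chartConst μ : ℂ) ≠ 0 := by exact_mod_cast hC.ne'
  refine ⟨fun α hα => ⟨LocalPeriod.psi_one hF B hα, ?_, fun p _ t hp g _ => ?_⟩, fun β hβ => ?_,
    LocalPeriod.chartConst μ, hC, fun α β f hα hf hint => ?_, fun f hf => ?_⟩
  · exact div_self (LocalPeriod.psi_one_ne_zero hF B hα)
  · rw [LocalPeriod.phi, LocalPeriod.psi_mul α hp, mul_div_assoc, ← LocalPeriod.phi]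
  · obtain ⟨hi, K, A, hA, hK⟩ := LocalPeriod.exists_integral_zpow_le hF hBsymm hBdet hμ κ
      (LocalPeriod.zpar_ne_zero β) (LocalPeriod.norm_zpar_lt hβ)
    obtain ⟨σ, hσ0, hσ⟩ := LocalPeriod.exists_norm_zpar_mul_lt (F := F) A
    refine ⟨σ, fun α hα f hf => ?_⟩
    have h := LocalPeriod.integrable_phiQuot_mul hF (hσ0.trans_lt hα)
      (LocalPeriod.aestronglyMeasurable_zpow_ord hF _ μ) hi hK hA (hσ α hα)
    refine h.congr ?_
    filter_upwards [hf.ae_eq hF hBsymm hBdet h0] with y hy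
    rw [hy]
  · have hfm : MeasureTheory.AEStronglyMeasurable f μ :=
      (LocalPeriod.aestronglyMeasurable_zpow_ord hF _ μ).congr (hf.ae_eq hF hBsymm hBdet h0).symm
    obtain ⟨h1, h2, h3⟩ := LocalPeriod.integral_phiQuot_mul hF hα hC' hfm
      (fun hfi t i ht => (LocalPeriod.setIntegral_generator hF hBsymm hBdet hμ h0 hC hf ht (hfi i)).2) hint
    refine ⟨⟨fun t ht => ?_, h1⟩, h2, h3⟩
    obtain ⟨i, hi⟩ := Int.eq_ofNat_of_zero_le ((LocalPeriod.mem_integralUnits_iff hF).mp ht)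
    have hti := LocalPeriod.norm_eq_ord hF t.ne_zero
    rw [hi] at hti
    exact (LocalPeriod.setIntegral_generator hF hBsymm hBdet hμ h0 hC hf hti
      (LocalPeriod.integrableOn_of_phiQuot hF hα hfm hint i)).1
  · have hm : ∀ y : LocalPeriod.ThetaQuot B, ∃ g' : ℂ → ℂ,
        LocalPeriod.IsContinuation (fun β => LocalPeriod.sphericalMean κ (f β) y) g' ∧
        ∀ β, LocalPeriod.zpar F β / (LocalPeriod.qR F : ℝ) ≠ 1 →
          g' β = LocalPeriod.stableSum (LocalPeriod.qR F) (LocalPeriod.levelMass κ y)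
            (LocalPeriod.zpar F β) := by
      intro y
      obtain ⟨c0, hc⟩ := LocalPeriod.exists_isStable_levelMass hF hBsymm hBdet κ
      obtain ⟨N, hN⟩ := Set.mem_iUnion.mp ((LocalPeriod.iUnion_ballSet (B := B)).symm ▸ Set.mem_univ y)
      obtain ⟨hst, hnull⟩ := hc N y hN
      exact hst.exists_continuation fun β hβ =>
        LocalPeriod.sphericalMean_eq hF hBsymm hBdet κ hst hnull hβ (hf β)
    -- The continued X must be a function of ρ, but only nonzero squares matter; elsewhere it is set
    -- to 0.
    have hX : ∀ ρ : F, ∃ g' : ℂ → ℂ, (∃ t : Fˣ, (t : F) ^ 2 = ρ) →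
        LocalPeriod.IsContinuation (fun β => LocalPeriod.XSeries B β ρ) g' ∧
        ∀ β, LocalPeriod.zpar F β / (LocalPeriod.qR F : ℝ) ≠ 1 →
          g' β = LocalPeriod.stableSum (LocalPeriod.qR F) (LocalPeriod.xCoeffInt B ρ)
            (LocalPeriod.zpar F β) := by
      intro ρ
      by_cases h : ∃ t : Fˣ, (t : F) ^ 2 = ρ
      · obtain ⟨t, rfl⟩ := h
        obtain ⟨N, J, hst⟩ := LocalPeriod.exists_isStable_xCoeffInt hF hBsymm hBdet hμ κ hC t
        obtain ⟨g', hg'⟩ := hst.exists_continuation fun β hβ => LocalPeriod.XSeries_eq_stableSum hst hβ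
        exact ⟨g', fun _ => hg'⟩
      · exact ⟨0, fun h' => absurd h' h⟩
    choose m hm1 hm2 using hm
    choose X hX using hX
    refine ⟨m, X, hm1, fun t => (hX _ ⟨t, rfl⟩).1, fun β hβ hm0 => ?_⟩
    rw [← LocalPeriod.zpar_div_eq] at hβ
    have hz := LocalPeriod.zpar_ne_zero (F := F) β
    obtain ⟨hi, K, A, hA, hK⟩ := LocalPeriod.exists_integral_stableSum_le hF hBsymm hBdet hμ κ hz
    obtain ⟨σ, hσ0, hσ⟩ := LocalPeriod.exists_norm_zpar_mul_lt (F := F) A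
    refine ⟨σ, fun α hα f' hf' => ?_⟩
    have hα0 := hσ0.trans_lt hα
    have hfeq : f' = fun y => LocalPeriod.stableSum (LocalPeriod.qR F) (LocalPeriod.levelMass κ y)
        (LocalPeriod.zpar F β) / m (LocalPeriod.ThetaQuot.mk 1) β :=
      funext fun y => by rw [hf' y, hm2 y β hβ]
    have hsm := LocalPeriod.measurable_stableSum hF hBsymm hBdet κ (LocalPeriod.zpar F β)
    have hint : MeasureTheory.Integrable (fun y => LocalPeriod.phiQuot α y * f' y) μ := by
      have h := LocalPeriod.integrable_phiQuot_mul hF hα0 (μ := μ) hsm.aestronglyMeasurable hi hK hA (hσ α hα)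
      refine (h.div_const (m (LocalPeriod.ThetaQuot.mk 1) β)).congr
        (Filter.Eventually.of_forall fun y => ?_)
      simp only [hfeq, mul_div_assoc]
    have hfm : MeasureTheory.AEStronglyMeasurable f' μ :=
      hfeq ▸ (hsm.div_const _).aestronglyMeasurable
    -- The unfolding applies verbatim with constant C/m(1), because its hypothesis concerns only
    -- integrals over balls.
    refine ⟨hint, LocalPeriod.integral_phiQuot_mul hF hα0 (div_ne_zero hC' hm0) hfm
      (fun _ t i ht => ?_) hint⟩
    rw [hfeq, MeasureTheory.integral_div,
      LocalPeriod.setIntegral_stableSum hF hBsymm hBdet hμ κ hz ht, (hX _ ⟨t, rfl⟩).2 β hβ]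
    ring
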